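/- **Gradient estimate for the two-point function.** Setting. A probability measure $\rho$ on $\mathbb R$ is in the Griffiths--Simon (GS) class if either (1) it is the law of $\alpha\sum_{n=1}^N b_n\sigma_n$ for some $N$, $\alpha\in\mathbb R$, $b_n\ge 0$, where $\sigma\in\{-1,1\}^N$ has probability proportional to $\exp\big(\sum_{n,m=1}^N K_{n,m}\sigma_n\sigma_m\big)$ with $K_{n,m}\ge 0$; or (2) it is a weak limit of measures of type (1) and $\int e^{|\varphi|^{a}}\rho(d\varphi)<\infty$ for some $a>2$. For $J>0$, $\beta>0$, $h\in\mathbb R$ and $\Lambda_L=[-L,L]^d\cap\mathbb Z^d$, let $\langle\cdot\rangle_{\Lambda_L,\beta,h}$ be the expectation with respect to the probability measure on $\mathbb R^{\Lambda_L}$ proportional to $$\exp\Big(\beta\Big[\sum_{\{x,y\}\subset\Lambda_L,\ \|x-y\|_1=1}J\,\tau_x\tau_y+h\sum_{x\in\Lambda_L}\tau_x\Big]\Big)\prod_{x\in\Lambda_L}\rho(d\tau_x).$$ Let $S(x)=S_{\rho,\beta}(x)=\lim_{L\to\infty}\langle\tau_0\tau_x\rangle_{\Lambda_L,\beta,0}$,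 and let $\beta_c=\beta_c(\rho,J)\in[0,\infty]$ be the infimum of the $\beta\ge0$ for which the spontaneous magnetization $\lim_{h\downarrow0}\lim_{L\to\infty}\langle\tau_0\rangle_{\Lambda_L,\beta,h}$ is positive. Write $|x|=\max_i|x_i|$ and let ${\bf e}_1,\dots,{\bf e}_d$ be the unit vectors. Statement. Let $d\ge2$. (i) For all $\rho$ in the GS class, $J>0$ and $0<\beta\le\beta_c$, the limits defining $S(x)$, $x\in\mathbb Z^d$, exist. (ii) There is a constant $C=C(d)>0$ such that for all $\rho$ in the GS class, all $J>0$, all $0<\beta\le\beta_c$, all $x\in\mathbb Z^d\setminus\{0\}$, all $1\le i\le d$ and both signs, $$|S(x\pm{\bf e}_i)-S(x)|\le\frac{F(|x|)}{|x|}\,S(x),\qquad F(n):=C\,\frac{S(n{\bf e}_1)}{S(dn{\bf e}_1)}\,\log\Big(\frac{2S(\lfloor n/2\rfloor{\bf e}_1)}{S(n{\bf e}_1)}\Big).$$ (In the degenerate case $\rho=\delta_0$ one has $S\equiv0$, and the estimate is read as $0\le0$.) (iii) Consequently the gradient is of order $1/|x|$ when $S$ does not drop too fast between scales: for every $c_0>0$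 there is $C_0=C_0(c_0,d)>0$ such that for all $\rho,J,\beta$ as in (ii) and all $n\ge1$ with $S(2dn{\bf e}_1)\ge c_0S(\lfloor n/2\rfloor{\bf e}_1)$, one has $|S(x\pm{\bf e}_i)-S(x)|\le\frac{C_0}{|x|}S(x)$ for all $x\in\mathbb Z^d$ with $|x|=n$, all $i$ and both signs. -/

import Mathlib

open MeasureTheory Filter Topology

noncomputable section

namespace GSModel

/-! ### The Griffiths-Simon class of single-spin distributions -/

/-- The Boltzmann weight `exp (∑ K n m σ n σ m)` of a block of `N` Ising spins. -/
def blockWeight {N : ℕ} (K : Fin N → Fin N → ℝ) (σ : Fin N → ℤˣ) : ℝ :=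
  Real.exp (∑ n, ∑ m, K n m * ((σ n : ℤ) : ℝ) * ((σ m : ℤ) : ℝ))

/-- `ρ` is the law of `a * ∑ b n σ n`, where `σ` is a finite system of ferromagnetically coupled
Ising spins (zero field) and the coefficients `b n` are nonnegative. -/
def IsIsingBlock (ρ : Measure ℝ) : Prop :=
  ∃ (N : ℕ) (a : ℝ) (b : Fin N → ℝ) (K : Fin N → Fin N → ℝ),
    (∀ n, 0 ≤ b n) ∧ (∀ n m, 0 ≤ K n m) ∧
    ρ = ∑ σ : Fin N → ℤˣ,
      ENNReal.ofReal (blockWeight K σ / ∑ σ' : Fin N → ℤˣ, blockWeight K σ') •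
        Measure.dirac (a * ∑ n, b n * ((σ n : ℤ) : ℝ))

/-- Sub-gaussian growth: `∫ exp (|φ| ^ α) dρ < ∞` for some `α > 2`. -/
def SubGaussianGrowth (ρ : Measure ℝ) : Prop :=
  ∃ α : ℝ, 2 < α ∧ Integrable (fun φ : ℝ => Real.exp (|φ| ^ α)) ρ

/-- The Griffiths-Simon class: Ising blocks, and weak limits of Ising blocks that are of
sub-gaussian growth. -/
def IsGS (ρ : ProbabilityMeasure ℝ) : Prop :=
  IsIsingBlock (ρ : Measure ℝ) ∨
    (SubGaussianGrowth (ρ : Measure ℝ) ∧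
      ∃ u : ℕ → ProbabilityMeasure ℝ,
        (∀ k, IsIsingBlock (u k : Measure ℝ)) ∧ Tendsto u atTop (𝓝 ρ))

/-! ### Nearest-neighbour ferromagnetic models on `ℤ^d` -/

variable {d : ℕ}

/-- Nearest-neighbour coupling of strength `J`. -/
def coupling (J : ℝ) (x y : Fin d → ℤ) : ℝ :=
  if ∑ i, |x i - y i| = 1 then J else 0

/-- The Hamiltonian on `Λ` with free boundary conditions and external field `h`. Every unordered
pair of sites occurs twice in the double sum, whence the factor `1 / 2`. -/
def hamiltonian (J h : ℝ) (Λ : Finset (Fin d → ℤ)) (τ : Λ → ℝ) : ℝ :=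
  -(1 / 2 * ∑ x : Λ, ∑ y : Λ, coupling J x.1 y.1 * τ x * τ y) - h * ∑ x : Λ, τ x

/-- Finite-volume Gibbs expectation of `F` at inverse temperature `β`. -/
def gibbs (ρ : ProbabilityMeasure ℝ) (J h β : ℝ) (Λ : Finset (Fin d → ℤ))
    (F : (Λ → ℝ) → ℝ) : ℝ :=
  (∫ τ, F τ * Real.exp (-β * hamiltonian J h Λ τ)
      ∂(Measure.pi fun _ : Λ => (ρ : Measure ℝ))) /
    ∫ τ, Real.exp (-β * hamiltonian J h Λ τ) ∂(Measure.pi fun _ : Λ => (ρ : Measure ℝ))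

/-- The spin at `x` (zero if `x` lies outside `Λ`). -/
def spin (Λ : Finset (Fin d → ℤ)) (x : Fin d → ℤ) (τ : Λ → ℝ) : ℝ :=
  if hx : x ∈ Λ then τ ⟨x, hx⟩ else 0

/-- The box `[-L, L]^d ∩ ℤ^d`. -/
def box (d L : ℕ) : Finset (Fin d → ℤ) :=
  Finset.Icc (fun _ => -(L : ℤ)) (fun _ => (L : ℤ))

/-- The two-point function `⟨τ_0 τ_x⟩` in the box of size `L`, at zero field. -/
def boxTwoPoint (ρ : ProbabilityMeasure ℝ) (J β : ℝ) (L : ℕ) (x : Fin d → ℤ) : ℝ :=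
  gibbs ρ J 0 β (box d L) fun τ => spin (box d L) 0 τ * spin (box d L) x τ

/-- The infinite-volume two-point function `S(x) = ⟨τ_0 τ_x⟩`. -/
def twoPoint (ρ : ProbabilityMeasure ℝ) (J β : ℝ) (x : Fin d → ℤ) : ℝ :=
  limUnder atTop fun L : ℕ => boxTwoPoint ρ J β L x

/-- The infinite-volume magnetization `⟨τ_0⟩` in the field `h`. -/
def magnetization (d : ℕ) (ρ : ProbabilityMeasure ℝ) (J h β : ℝ) : ℝ :=
  limUnder atTop fun L : ℕ => gibbs ρ J h β (box d L) fun τ => spin (box d L) 0 τ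

/-- The spontaneous magnetization: the limit of the magnetization as `h ↓ 0`. -/
def spontaneousMagnetization (d : ℕ) (ρ : ProbabilityMeasure ℝ) (J β : ℝ) : ℝ :=
  limUnder (𝓝[>] (0 : ℝ)) fun h => magnetization d ρ J h β

/-- The critical inverse temperature: the infimum of the `β ≥ 0` with positive spontaneous
magnetization (`⊤` if there is none). -/
def criticalBeta (d : ℕ) (ρ : ProbabilityMeasure ℝ) (J : ℝ) : EReal :=
  ⨅ (β : ℝ) (_ : 0 ≤ β ∧ 0 < spontaneousMagnetization d ρ J β), (β : EReal)

/-! ### The objects in the gradient estimate -/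

/-- `|x| = max |x i|`. -/
def maxNorm (x : Fin d → ℤ) : ℕ :=
  Finset.univ.sup fun i => (x i).natAbs

/-- The point `n e_1 = (n, 0, …, 0)`. -/
def axisPoint (d n : ℕ) : Fin d → ℤ :=
  fun i => if (i : ℕ) = 0 then (n : ℤ) else 0

/-- `C * (S(n e_1) / S(d n e_1)) * log (2 S(⌊n/2⌋ e_1) / S(n e_1))`; `n / 2` is the
integer part. -/
def gradientFactor (d : ℕ) (S : (Fin d → ℤ) → ℝ) (C : ℝ) (n : ℕ) : ℝ :=
  C * (S (axisPoint d n) / S (axisPoint d (d * n))) *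
    Real.log (2 * S (axisPoint d (n / 2)) / S (axisPoint d n))

end GSModel

end

open GSModel

open GSModel
namespace GSModel

set_option linter.unusedSectionVars false

/-! ### Functions of gaussian-type growth -/

section Tame

variable {X Y : Type*} [MeasurableSpace X] [MeasurableSpace Y]

/-! The argument has a deterministic half, about functions on the lattice, and a half made of
correlation inequalities which show that S is such a function.

Deterministic half (`IsReflectionPositive.gradient`). Let e be the direction of the largest
coordinate of x, write x = |x| e + p, and put a(n) = S(n e) + S(n e + p) (`lineSum`). Reflection
positivity makes a log-convex, and a is decreasing. So log a(n) - log a(n+1) decreases in n and is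
at most its average over the scales between n/2 and n, which gives (2/n) Λ with Λ = log(2 S(⌊n/2⌋ e)
/ S(n e)). The axis term must be added because reflection positivity controls only the sum; it does
no harm, since it is itself decreasing and hence the decrements of a dominate those of n ↦ S(n e +
p). The resulting differences are of order S(|x| e) Λ / |x|. Moving all coordinates onto the largest
one by diagonal reflections gives S(x) ≥ S(‖x‖₁ e) ≥ S(d |x| e), which turns S(|x| e) into S(x) at
the cost of the ratio in F. Diagonal reflections also reduce every direction to e. The backward
difference needs care when a drops by more than a factor of Euler's number in one step: then |x| ≤ 2
Λ, and it is enough to bound S(x - e) by a multiple of S(x) S(|x| e) / S(d |x| e). That comparison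
holds because, up to a constant, all ratios S((n+1) e) / S(n e) with n < ‖x‖₁ + 1 can be compared
with S(e) / S(0): from below by log-convexity, from above by the field `step`.

Correlation inequalities. Ginibre's sign-reversal principle, applied to sums and differences of
mirror images (`integral_reflection_nonneg`), yields Griffiths' two inequalities and the
Messager-Miracle-Solé monotonicity. Conditioning on the spins of the mirror yields reflection
positivity (`integral_mul_reflection_nonneg`), and reflection positivity combined with a power
series identity yields a gaussian domination bound for S(0) - S(e). Members of the Griffiths-Simon
class obey the moment recursion of a gaussian as an inequality: for Ising blocks by a replica
expansion (`ising_gaussian`), for weak limits by passing to the limit. The recursion gives an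
integration by parts inequality (`integral_parts_nonneg`) and with it ⟨τ_0 τ_x⟩ ≤ s ∑ c_{0y} ⟨τ_y
τ_x⟩, s being the single-spin variance. `step` follows from gaussian domination if β J s ≥ 1, and
from the integration by parts bounds if β J s ≤ 1, so that its constant depends on d alone.

Finite-volume correlations increase with the volume and are bounded uniformly (`corr_self_le`), so
the limits exist and inherit all of these inequalities. -/

/-- Measurable functions that are bounded by a multiple of `exp (B * E)` for some `B`. -/
structure Tame (E f : X → ℝ) : Prop where
  meas : Measurable f
  bound : ∃ A B : ℝ, 0 ≤ A ∧ 0 ≤ B ∧ ∀ x, |f x| ≤ A * Real.exp (B * E x)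

/-- A nonnegative function all of whose exponential moments are finite. -/
structure ExpInt (E : X → ℝ) (μ : Measure X) : Prop where
  nonneg : ∀ x, 0 ≤ E x
  int : ∀ B : ℝ, Integrable (fun x => Real.exp (B * E x)) μ

variable {E f g : X → ℝ} {μ : Measure X}

theorem Tame.integrable (hf : Tame E f) (hE : ExpInt E μ) : Integrable f μ := by
  obtain ⟨A, B, -, -, h⟩ := hf.bound
  exact ((hE.int B).const_mul A).mono' hf.meas.aestronglyMeasurable (ae_of_all _ h)

theorem Tame.const (E : X → ℝ) (c : ℝ) : Tame E fun _ => c :=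
  ⟨measurable_const, |c|, 0, abs_nonneg c, le_rfl, fun x => by simp⟩

theorem Tame.mul (hf : Tame E f) (hg : Tame E g) : Tame E fun x => f x * g x := by
  obtain ⟨A, B, hA, hB, h⟩ := hf.bound
  obtain ⟨A', B', hA', hB', h'⟩ := hg.bound
  refine ⟨hf.meas.mul hg.meas, A * A', B + B', by positivity, by positivity, fun x => ?_⟩
  rw [abs_mul, add_mul, Real.exp_add]
  calc |f x| * |g x| ≤ (A * Real.exp (B * E x)) * (A' * Real.exp (B' * E x)) :=
        mul_le_mul (h x) (h' x) (abs_nonneg _) (by positivity)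
    _ = _ := by ring

theorem Tame.add (hE : ∀ x, 0 ≤ E x) (hf : Tame E f) (hg : Tame E g) :
    Tame E fun x => f x + g x := by
  obtain ⟨A, B, hA, hB, h⟩ := hf.bound
  obtain ⟨A', B', hA', hB', h'⟩ := hg.bound
  refine ⟨hf.meas.add hg.meas, A + A', B + B', by positivity, by positivity, fun x => ?_⟩
  have h1 : Real.exp (B * E x) ≤ Real.exp ((B + B') * E x) :=
    Real.exp_le_exp.2 (mul_le_mul_of_nonneg_right (by linarith) (hE x))
  have h2 : Real.exp (B' * E x) ≤ Real.exp ((B + B') * E x) :=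
    Real.exp_le_exp.2 (mul_le_mul_of_nonneg_right (by linarith) (hE x))
  calc |f x + g x| ≤ |f x| + |g x| := abs_add_le _ _
    _ ≤ A * Real.exp ((B + B') * E x) + A' * Real.exp ((B + B') * E x) :=
        add_le_add ((h x).trans (mul_le_mul_of_nonneg_left h1 hA))
          ((h' x).trans (mul_le_mul_of_nonneg_left h2 hA'))
    _ = _ := by ring

theorem Tame.const_mul (hf : Tame E f) (c : ℝ) : Tame E fun x => c * f x := by
  obtain ⟨A, B, hA, hB, h⟩ := hf.bound
  refine ⟨hf.meas.const_mul c, |c| * A, B, by positivity, hB, fun x => ?_⟩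
  rw [abs_mul, mul_assoc]
  exact mul_le_mul_of_nonneg_left (h x) (abs_nonneg c)

theorem Tame.sub (hE : ∀ x, 0 ≤ E x) (hf : Tame E f) (hg : Tame E g) :
    Tame E fun x => f x - g x := by
  simpa [sub_eq_add_neg] using hf.add hE (hg.const_mul (-1))

theorem Tame.abs (hf : Tame E f) : Tame E fun x => |f x| :=
  ⟨hf.meas.abs, by simpa using hf.bound⟩

theorem Tame.pow (hf : Tame E f) (n : ℕ) : Tame E fun x => f x ^ n := by
  induction n with
  | zero => simpa using Tame.const E 1
  | succ n ih => simpa [pow_succ] using ih.mul hf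

theorem Tame.sum {ι : Type*} (hE : ∀ x, 0 ≤ E x) {F : ι → X → ℝ} (s : Finset ι)
    (hF : ∀ i ∈ s, Tame E (F i)) : Tame E fun x => ∑ i ∈ s, F i x := by
  classical
  induction s using Finset.induction_on with
  | empty => simpa using Tame.const E 0
  | insert a s ha ih =>
    simp only [Finset.sum_insert ha]
    exact (hF a (by simp)).add hE (ih fun i hi => hF i (by simp [hi]))

theorem Tame.prod {ι : Type*} {F : ι → X → ℝ} (s : Finset ι)
    (hF : ∀ i ∈ s, Tame E (F i)) : Tame E fun x => ∏ i ∈ s, F i x := by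
  classical
  induction s using Finset.induction_on with
  | empty => simpa using Tame.const E 1
  | insert a s ha ih =>
    simp only [Finset.prod_insert ha]
    exact (hF a (by simp)).mul (ih fun i hi => hF i (by simp [hi]))

theorem Tame.exp {C : ℝ} (hC : 0 ≤ C) (hf : Measurable f) (h : ∀ x, f x ≤ C * E x) :
    Tame E fun x => Real.exp (f x) :=
  ⟨Real.measurable_exp.comp hf, 1, C, zero_le_one, hC, fun x => by
    rw [abs_of_pos (Real.exp_pos _), one_mul]; exact Real.exp_le_exp.2 (h x)⟩

theorem Tame.of_sq_le (hf : Measurable f) (h : ∀ x, f x ^ 2 ≤ E x) : Tame E f :=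
  ⟨hf, 1, 1, zero_le_one, zero_le_one, fun x => by
    have h1 := Real.add_one_le_exp (E x)
    have h2 : |f x| ≤ f x ^ 2 + 1 := by
      rw [← sq_abs]; nlinarith [sq_nonneg (|f x| - 1), abs_nonneg (f x)]
    rw [one_mul, one_mul]; linarith [h x]⟩

theorem Tame.comp {E' : Y → ℝ} {φ : Y → X} (hf : Tame E f) (hφ : Measurable φ)
    (h : ∀ y, E (φ y) ≤ E' y) : Tame E' fun y => f (φ y) := by
  obtain ⟨A, B, hA, hB, hb⟩ := hf.bound
  refine ⟨hf.meas.comp hφ, A, B, hA, hB, fun y => (hb _).trans ?_⟩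
  exact mul_le_mul_of_nonneg_left
    (Real.exp_le_exp.2 (mul_le_mul_of_nonneg_left (h y) hB)) hA

theorem ExpInt.prod {E' : Y → ℝ} {ν : Measure Y} [SFinite μ] [SFinite ν] (hE : ExpInt E μ)
    (hE' : ExpInt E' ν) : ExpInt (fun p : X × Y => E p.1 + E' p.2) (μ.prod ν) where
  nonneg p := add_nonneg (hE.nonneg _) (hE'.nonneg _)
  int B := by
    simp only [mul_add, Real.exp_add]
    exact (hE.int B).mul_prod (hE'.int B)

/-- If all `∫ f Q ^ k` are nonnegative, so is `∫ f exp Q`. -/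
theorem integral_mul_exp_nonneg {f Q : X → ℝ} (hf : Measurable f) (hQ : Measurable Q)
    (hint : Integrable (fun x => |f x| * Real.exp |Q x|) μ)
    (h : ∀ k : ℕ, 0 ≤ ∫ x, f x * Q x ^ k ∂μ) : 0 ≤ ∫ x, f x * Real.exp (Q x) ∂μ := by
  have hs : ∀ y : ℝ, HasSum (fun k : ℕ => y ^ k / (k.factorial : ℝ)) (Real.exp y) := fun y => by
    rw [Real.exp_eq_exp_ℝ]; exact NormedSpace.expSeries_div_hasSum_exp y
  have key := hasSum_integral_of_dominated_convergence (μ := μ)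
    (F := fun (k : ℕ) x => f x * (Q x ^ k / (k.factorial : ℝ)))
    (f := fun x => f x * Real.exp (Q x))
    (fun k x => |f x| * (|Q x| ^ k / (k.factorial : ℝ)))
    (fun k => (hf.mul ((hQ.pow_const k).div_const _)).aestronglyMeasurable)
    (fun k => ae_of_all _ fun x => by
      simp)
    (ae_of_all _ fun x => ((hs |Q x|).summable.mul_left _))
    (by
      have : (fun x => ∑' k : ℕ, |f x| * (|Q x| ^ k / (k.factorial : ℝ))) =
          fun x => |f x| * Real.exp |Q x| := by
        funext x; exact ((hs |Q x|).mul_left _).tsum_eq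
      rw [this]; exact hint)
    (ae_of_all _ fun x => (hs (Q x)).mul_left _)
  refine key.nonneg fun k => ?_
  have : (fun x => f x * (Q x ^ k / (k.factorial : ℝ))) =
      fun x => (k.factorial : ℝ)⁻¹ * (f x * Q x ^ k) := by funext x; ring
  rw [this, integral_const_mul]
  exact mul_nonneg (by positivity) (h k)

end Tame

/-! ### Ginibre's principle -/

section Ginibre

variable {X κ : Type*}

/-- Polynomials with nonnegative coefficients in the functions `g i`. -/
def PosPoly (g : κ → X → ℝ) (f : X → ℝ) : Prop :=
  ∃ p : MvPolynomial κ ℝ, (∀ m, 0 ≤ p.coeff m) ∧ ∀ x, f x = MvPolynomial.eval (fun i => g i x) p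

variable {g : κ → X → ℝ} {f f' : X → ℝ}

theorem PosPoly.const (g : κ → X → ℝ) {c : ℝ} (hc : 0 ≤ c) : PosPoly g fun _ => c := by
  classical
  refine ⟨MvPolynomial.C c, fun m => ?_, fun x => by simp⟩
  rw [MvPolynomial.coeff_C]; split_ifs <;> simp [hc]

theorem PosPoly.gen (g : κ → X → ℝ) (i : κ) : PosPoly g (g i) := by
  classical
  refine ⟨MvPolynomial.X i, fun m => ?_, fun x => by simp⟩
  rw [MvPolynomial.coeff_X]; split_ifs <;> simp

theorem PosPoly.add (h : PosPoly g f) (h' : PosPoly g f') : PosPoly g fun x => f x + f' x := by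
  obtain ⟨p, hp, h⟩ := h
  obtain ⟨q, hq, h'⟩ := h'
  exact ⟨p + q, fun m => by rw [MvPolynomial.coeff_add]; exact add_nonneg (hp m) (hq m),
    fun x => by simp [h, h']⟩

theorem PosPoly.mul (h : PosPoly g f) (h' : PosPoly g f') : PosPoly g fun x => f x * f' x := by
  classical
  obtain ⟨p, hp, h⟩ := h
  obtain ⟨q, hq, h'⟩ := h'
  refine ⟨p * q, fun m => ?_, fun x => by simp [h, h']⟩
  rw [MvPolynomial.coeff_mul]
  exact Finset.sum_nonneg fun y _ => mul_nonneg (hp _) (hq _)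

theorem PosPoly.const_mul (h : PosPoly g f) {c : ℝ} (hc : 0 ≤ c) : PosPoly g fun x => c * f x :=
  (PosPoly.const g hc).mul h

theorem PosPoly.pow (h : PosPoly g f) (k : ℕ) : PosPoly g fun x => f x ^ k := by
  induction k with
  | zero => simpa using PosPoly.const g zero_le_one
  | succ n ih => simpa [pow_succ] using ih.mul h

theorem PosPoly.sum {ι : Type*} {F : ι → X → ℝ} (s : Finset ι) (h : ∀ i ∈ s, PosPoly g (F i)) :
    PosPoly g fun x => ∑ i ∈ s, F i x := by
  classical
  induction s using Finset.induction_on with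
  | empty => simpa using PosPoly.const g le_rfl
  | insert a s ha ih =>
    simp only [Finset.sum_insert ha]
    exact (h a (by simp)).add (ih fun i hi => h i (by simp [hi]))

variable [MeasurableSpace X] {μ : Measure X} {E w : X → ℝ}

theorem PosPoly.tame (hE : ∀ x, 0 ≤ E x) (hg : ∀ i, Tame E (g i)) (h : PosPoly g f) :
    Tame E f := by
  obtain ⟨p, -, h⟩ := h
  have : f = fun x => ∑ m ∈ p.support, p.coeff m * ∏ i ∈ m.support, g i x ^ m i := by
    funext x; rw [h, MvPolynomial.eval_eq]
  rw [this]
  exact Tame.sum hE _ fun m _ => (Tame.prod _ fun i _ => (hg i).pow _).const_mul _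

/-- The integral of a monomial in the `g i` is nonnegative if each sign `g i` can be reversed,
without changing the other ones, by a transformation that preserves the measure. -/
theorem integral_monomial_nonneg {T : κ → X → X} (hw : ∀ x, 0 ≤ w x) (hwm : Measurable w)
    (hgm : ∀ i, Measurable (g i)) (hT : ∀ i, MeasurePreserving (T i) μ μ)
    (hwT : ∀ i x, w (T i x) = w x) (hneg : ∀ i x, g i (T i x) = -g i x)
    (hfix : ∀ i j x, i ≠ j → g j (T i x) = g j x) (m : κ →₀ ℕ) :
    0 ≤ ∫ x, (∏ i ∈ m.support, g i x ^ m i) * w x ∂μ := by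
  classical
  -- If all exponents are even the integrand is nonnegative. Otherwise reversing a generator of odd
  -- exponent shows that the integral equals its own negative.
  by_cases hm : ∀ i ∈ m.support, Even (m i)
  · exact integral_nonneg fun x =>
      mul_nonneg (Finset.prod_nonneg fun i hi => (hm i hi).pow_nonneg _) (hw x)
  push Not at hm
  obtain ⟨i, hi, hodd⟩ := hm
  have hodd : Odd (m i) := Nat.not_even_iff_odd.1 hodd
  set F : X → ℝ := fun x => (∏ i ∈ m.support, g i x ^ m i) * w x with hF
  have hFm : Measurable F :=
    (Finset.measurable_prod _ fun i _ => (hgm i).pow_const _).mul hwm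
  have h1 : ∀ x, F (T i x) = -F x := fun x => by
    simp only [hF, hwT]
    rw [← Finset.mul_prod_erase _ _ hi, ← Finset.mul_prod_erase _ (fun i => g i x ^ m i) hi,
      hneg, hodd.neg_pow]
    have : ∏ j ∈ m.support.erase i, g j (T i x) ^ m j = ∏ j ∈ m.support.erase i, g j x ^ m j :=
      Finset.prod_congr rfl fun j hj => by rw [hfix i j x (Finset.ne_of_mem_erase hj).symm]
    rw [this]; ring
  have h2 : ∫ x, F x ∂μ = -∫ x, F x ∂μ := by
    conv_lhs => rw [← (hT i).map_eq]
    rw [integral_map (hT i).measurable.aemeasurable hFm.aestronglyMeasurable]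
    simp only [h1, integral_neg]
  have h3 : ∫ x, F x ∂μ = 0 := by linarith
  exact h3.ge

/-- After expanding exp Q, each f * Q ^ k is again a polynomial with nonnegative coefficients, so
only monomials remain. The weight w only has to be invariant under the sign reversals; this is what
makes room for the part of the energy whose coefficients have the wrong sign. -/
theorem integral_posPoly_mul_exp_nonneg {T : κ → X → X} {Q : X → ℝ} (hE : ExpInt E μ)
    (hw : ∀ x, 0 ≤ w x) (hwt : Tame E w) (hg : ∀ i, Tame E (g i))
    (hT : ∀ i, MeasurePreserving (T i) μ μ)
    (hwT : ∀ i x, w (T i x) = w x) (hneg : ∀ i x, g i (T i x) = -g i x)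
    (hfix : ∀ i j x, i ≠ j → g j (T i x) = g j x)
    (hf : PosPoly g f) (hQ : PosPoly g Q) (hQt : Tame E fun x => Real.exp |Q x|) :
    0 ≤ ∫ x, f x * w x * Real.exp (Q x) ∂μ := by
  have hft := hf.tame hE.nonneg hg
  refine integral_mul_exp_nonneg (hft.mul hwt).meas (hQ.tame hE.nonneg hg).meas
    (((hft.mul hwt).abs.mul hQt).integrable hE) fun k => ?_
  obtain ⟨p, hp, h⟩ := hf.mul (hQ.pow k)
  have : (fun x => f x * w x * Q x ^ k) = fun x => ∑ m ∈ p.support,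
      p.coeff m * ((∏ i ∈ m.support, g i x ^ m i) * w x) := by
    funext x
    have h' : f x * Q x ^ k = _ := h x
    rw [MvPolynomial.eval_eq] at h'
    rw [mul_right_comm, h', Finset.sum_mul]
    exact Finset.sum_congr rfl fun m _ => mul_assoc _ _ _
  rw [this, integral_finsetSum]
  · refine Finset.sum_nonneg fun m _ => ?_
    rw [integral_const_mul]
    exact mul_nonneg (hp m)
      (integral_monomial_nonneg hw hwt.meas (fun i => (hg i).meas) hT hwT hneg hfix m)
  · exact fun m _ => ((((Tame.prod _ fun i _ => (hg i).pow _).mul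
      hwt).const_mul _).integrable hE)

end Ginibre

/-! ### Finite ferromagnetic systems with general even spins -/

/-- Symmetric distributions with gaussian moments of all orders. -/
structure IsEvenSpin (ρ : Measure ℝ) : Prop where
  symm : ρ.map (fun t => -t) = ρ
  int : ∀ B : ℝ, Integrable (fun t : ℝ => Real.exp (B * t ^ 2)) ρ


section Model

variable {ι : Type*} [Fintype ι]

def energy (τ : ι → ℝ) : ℝ := ∑ i, τ i ^ 2

/-- The interaction energy of a spin configuration. -/
noncomputable def quad (c : ι → ι → ℝ) (τ : ι → ℝ) : ℝ := 1 / 2 * ∑ x, ∑ y, c x y * τ x * τ y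

/-- Expectation in the Gibbs measure with couplings `c` and single-spin distribution `ρ`. -/
noncomputable def gibbsMean (ρ : Measure ℝ) (c : ι → ι → ℝ) (F : (ι → ℝ) → ℝ) : ℝ :=
  (∫ τ, F τ * Real.exp (quad c τ) ∂(Measure.pi fun _ : ι => ρ)) /
    ∫ τ, Real.exp (quad c τ) ∂(Measure.pi fun _ : ι => ρ)

theorem energy_nonneg (τ : ι → ℝ) : 0 ≤ energy τ := Finset.sum_nonneg fun _ _ => sq_nonneg _

theorem sq_le_energy (τ : ι → ℝ) (x : ι) : τ x ^ 2 ≤ energy τ :=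
  Finset.single_le_sum (f := fun i => τ i ^ 2) (fun _ _ => sq_nonneg _) (Finset.mem_univ x)

theorem abs_mul_le_energy (τ : ι → ℝ) (x y : ι) : |τ x * τ y| ≤ energy τ := by
  have hx := sq_le_energy τ x
  have hy := sq_le_energy τ y
  rw [abs_le]; constructor <;> nlinarith [sq_nonneg (τ x - τ y), sq_nonneg (τ x + τ y)]

theorem measurable_quad (c : ι → ι → ℝ) : Measurable (quad c) := by
  unfold quad; fun_prop

theorem abs_sum_sum_le {c : ι → ι → ℝ} {m : ι → ι → ℝ} {D : ℝ} (hm : ∀ x y, |m x y| ≤ D) :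
    |∑ x, ∑ y, c x y * m x y| ≤ (∑ x, ∑ y, |c x y|) * D := by
  rw [Finset.sum_mul]
  refine (Finset.abs_sum_le_sum_abs _ _).trans (Finset.sum_le_sum fun x _ => ?_)
  rw [Finset.sum_mul]
  refine (Finset.abs_sum_le_sum_abs _ _).trans (Finset.sum_le_sum fun y _ => ?_)
  rw [abs_mul]
  exact mul_le_mul_of_nonneg_left (hm x y) (abs_nonneg _)

theorem abs_quad_le (c : ι → ι → ℝ) (τ : ι → ℝ) :
    |quad c τ| ≤ (∑ x, ∑ y, |c x y|) * energy τ := by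
  have h := abs_sum_sum_le (c := c) (fun x y => abs_mul_le_energy τ x y)
  simp only [← mul_assoc] at h
  unfold quad
  rw [abs_mul]
  have h2 : |(1 / 2 : ℝ)| = 1 / 2 := by norm_num
  rw [h2]
  linarith [abs_nonneg (∑ x, ∑ y, c x y * τ x * τ y)]

theorem sum_sum_abs_nonneg (c : ι → ι → ℝ) : 0 ≤ ∑ x, ∑ y, |c x y| :=
  Finset.sum_nonneg fun _ _ => Finset.sum_nonneg fun _ _ => abs_nonneg _

theorem tame_coord (x : ι) : Tame (energy : (ι → ℝ) → ℝ) fun τ => τ x :=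
  Tame.of_sq_le (measurable_pi_apply x) fun τ => sq_le_energy τ x

theorem tame_exp_quad (c : ι → ι → ℝ) :
    Tame (energy : (ι → ℝ) → ℝ) fun τ => Real.exp (quad c τ) :=
  Tame.exp (sum_sum_abs_nonneg c) (measurable_quad c) fun τ =>
    (le_abs_self _).trans (abs_quad_le c τ)

variable {ρ : Measure ℝ} [IsProbabilityMeasure ρ]

theorem expInt_energy (hρ : IsEvenSpin ρ) :
    ExpInt (energy : (ι → ℝ) → ℝ) (Measure.pi fun _ : ι => ρ) where
  nonneg := energy_nonneg
  int B := by
    have : (fun τ : ι → ℝ => Real.exp (B * energy τ)) =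
        fun τ => ∏ i, Real.exp (B * τ i ^ 2) := by
      funext τ; rw [energy, Finset.mul_sum, Real.exp_sum]
    rw [this]
    exact Integrable.fintype_prod fun _ => hρ.int B

theorem Tame.integrable_pi (hρ : IsEvenSpin ρ) {F : (ι → ℝ) → ℝ} (hF : Tame energy F) :
    Integrable F (Measure.pi fun _ : ι => ρ) :=
  hF.integrable (expInt_energy hρ)

theorem partition_pos (hρ : IsEvenSpin ρ) (c : ι → ι → ℝ) :
    0 < ∫ τ, Real.exp (quad c τ) ∂(Measure.pi fun _ : ι => ρ) :=
  integral_exp_pos ((tame_exp_quad c).integrable_pi hρ)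

theorem measurePreserving_reindex {ι' : Type*} [Fintype ι'] (e : ι' ≃ ι) :
    MeasurePreserving (fun (τ : ι → ℝ) (i : ι') => τ (e i)) (Measure.pi fun _ : ι => ρ)
      (Measure.pi fun _ : ι' => ρ) := by
  have h := measurePreserving_piCongrLeft (fun _ : ι' => ρ) e.symm
  convert h using 1
  funext τ i
  rw [MeasurableEquiv.coe_piCongrLeft]
  simpa using (Equiv.piCongrLeft_apply_apply (fun _ => ℝ) e.symm τ (e i)).symm

theorem measurePreserving_signs (hρ : IsEvenSpin ρ) (ε : ι → ℝ) (hε : ∀ i, ε i = 1 ∨ ε i = -1) :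
    MeasurePreserving (fun (τ : ι → ℝ) (i : ι) => ε i * τ i) (Measure.pi fun _ : ι => ρ)
      (Measure.pi fun _ : ι => ρ) := by
  refine measurePreserving_pi (fun _ => ρ) (fun _ => ρ) (f := fun i t => ε i * t) fun i => ?_
  rcases hε i with h | h
  · simp only [h, one_mul]; exact MeasurePreserving.id ρ
  · simp only [h, neg_one_mul]
    exact ⟨measurable_neg, hρ.symm⟩

theorem measurePreserving_signedPerm (hρ : IsEvenSpin ρ) (ε : ι → ℝ)
    (hε : ∀ i, ε i = 1 ∨ ε i = -1) (π : Equiv.Perm ι) :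
    MeasurePreserving (fun (τ : ι → ℝ) (i : ι) => ε i * τ (π i)) (Measure.pi fun _ : ι => ρ)
      (Measure.pi fun _ : ι => ρ) :=
  (measurePreserving_signs hρ ε hε).comp (measurePreserving_reindex π)

/-! ### Reflections -/

/-- `θ` is a reflection that leaves the ferromagnetic couplings `c` invariant, `P` an open
half-space for it, and the only couplings across the mirror are between mirror images. -/
structure IsReflection (c : ι → ι → ℝ) (θ : ι → ι) (P : ι → Prop) : Prop where
  nonneg : ∀ x y, 0 ≤ c x y
  symm : ∀ x y, c x y = c y x
  invol : ∀ x, θ (θ x) = x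
  inv : ∀ x y, c (θ x) (θ y) = c x y
  disj : ∀ x, P x → ¬P (θ x)
  fixed : ∀ x, ¬P x → ¬P (θ x) → θ x = x
  cross : ∀ x y, P x → P y → c x (θ y) ≠ 0 → y = x

open Classical in
/-- The sums and differences of mirror images, listed once each. -/
noncomputable def reflGen (θ : ι → ι) (P : ι → Prop) : ι × Bool → (ι → ℝ) → ℝ
  | (x, true), τ => if P (θ x) then 0 else τ x + τ (θ x)
  | (x, false), τ => if P x then τ x - τ (θ x) else 0

open Classical in
/-- The transformation that reverses the sign of one element of `reflGen`. -/
noncomputable def reflFlip (θ : ι → ι) (P : ι → Prop) : ι × Bool → (ι → ℝ) → (ι → ℝ)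
  | (x, true), τ => fun i => (if ¬P (θ x) ∧ (i = x ∨ i = θ x) then -1 else 1) *
      τ ((if ¬P (θ x) then Equiv.swap x (θ x) else 1 : Equiv.Perm ι) i)
  | (x, false), τ => fun i => 1 *
      τ ((if P x then Equiv.swap x (θ x) else 1 : Equiv.Perm ι) i)

variable {c : ι → ι → ℝ} {θ : ι → ι} {P : ι → Prop}

theorem measurePreserving_reflFlip (hρ : IsEvenSpin ρ) (j : ι × Bool) :
    MeasurePreserving (reflFlip θ P j) (Measure.pi fun _ : ι => ρ)
      (Measure.pi fun _ : ι => ρ) := by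
  rcases j with ⟨x, _ | _⟩
  · exact measurePreserving_signedPerm hρ (fun _ => 1) (fun _ => Or.inl rfl) _
  · exact measurePreserving_signedPerm hρ _ (fun i => by split_ifs <;> simp) _

/-- Exchanging the spins at x and θ x reverses their difference and keeps their sum; exchanging them
and changing both signs does the opposite. On the mirror the sum is twice the spin, and the flip is
a change of sign. -/
theorem reflGen_reflFlip_self (j : ι × Bool) (τ : ι → ℝ) :
    reflGen θ P j (reflFlip θ P j τ) = -reflGen θ P j τ := by
  rcases j with ⟨x, _ | _⟩
  · by_cases h : P x <;> simp [reflGen, reflFlip, h]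
  · by_cases h : P (θ x) <;> simp [reflGen, reflFlip, h]

theorem reflFlip_apply_of_ne (j : ι × Bool) (τ : ι → ℝ) {i : ι} (h1 : i ≠ j.1)
    (h2 : i ≠ θ j.1) : reflFlip θ P j τ i = τ i := by
  rcases j with ⟨x, _ | _⟩ <;> simp only [reflFlip] <;> split_ifs <;>
    simp_all [Equiv.swap_apply_of_ne_of_ne]

theorem reflGen_reflFlip_of_ne (hr : IsReflection c θ P) {i j : ι × Bool} (τ : ι → ℝ)
    (hij : i ≠ j) : reflGen θ P j (reflFlip θ P i τ) = reflGen θ P j τ := by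
  obtain ⟨x, b⟩ := i
  obtain ⟨y, b'⟩ := j
  by_cases h : y = x
  · subst h
    have hd := hr.disj y
    rcases b with _ | _ <;> rcases b' with _ | _ <;> simp at hij
    · by_cases h : P y <;> simp [reflGen, reflFlip, h, hd]
      rw [add_comm]
    · by_cases h : P y
      · simp [reflGen, reflFlip, h, hd]; ring
      · simp [reflGen, h]
  by_cases h' : y = θ x
  · subst h'
    have hd := hr.disj x
    have hd' := hr.disj (θ x)
    have hf := hr.fixed x
    have hi := hr.invol x
    rcases b with _ | _ <;> rcases b' with _ | _ <;> by_cases h1 : P x <;> by_cases h2 : P (θ x) <;>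
      simp_all [reflGen, reflFlip]
  · have h1 : θ y ≠ x := fun e => h' (by rw [← e, hr.invol])
    have h2 : θ y ≠ θ x := fun e => h (by rw [← hr.invol y, e, hr.invol])
    rcases b' with _ | _ <;> simp only [reflGen] <;>
      rw [reflFlip_apply_of_ne _ _ h h', reflFlip_apply_of_ne _ _ h1 h2]

theorem tame_reflGen (j : ι × Bool) : Tame energy (reflGen θ P j) := by
  have hx := fun x : ι => tame_coord x
  rcases j with ⟨x, _ | _⟩
  · by_cases h : P x
    · convert (hx x).sub energy_nonneg (hx (θ x)) using 1
      funext τ; simp [reflGen, h]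
    · convert Tame.const energy 0 using 1
      funext τ; simp [reflGen, h]
  · by_cases h : P (θ x)
    · convert Tame.const energy 0 using 1
      funext τ; simp [reflGen, h]
    · convert (hx x).add energy_nonneg (hx (θ x)) using 1
      funext τ; simp [reflGen, h]

theorem posPoly_add (hr : IsReflection c θ P) (x : ι) :
    PosPoly (reflGen θ P) fun τ => τ x + τ (θ x) := by
  by_cases h : P (θ x)
  · have := PosPoly.gen (reflGen θ P) (θ x, true)
    have h' : ¬P x := fun hx => hr.disj x hx h
    convert this using 1
    funext τ
    simp [reflGen, hr.invol, h', add_comm]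
  · have := PosPoly.gen (reflGen θ P) (x, true)
    convert this using 1
    funext τ
    simp [reflGen, h]

theorem posPoly_sub (hr : IsReflection c θ P) {x : ι} (hx : ¬P (θ x)) :
    PosPoly (reflGen θ P) fun τ => τ x - τ (θ x) := by
  by_cases h : P x
  · have := PosPoly.gen (reflGen θ P) (x, false)
    convert this using 1
    funext τ
    simp [reflGen, h]
  · simpa [hr.fixed x h hx] using PosPoly.const (reflGen θ P) le_rfl

theorem posPoly_coord (hr : IsReflection c θ P) {x : ι} (hx : ¬P (θ x)) :
    PosPoly (reflGen θ P) fun τ => τ x := by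
  have := ((posPoly_add hr x).add (posPoly_sub hr hx)).const_mul (c := 1 / 2) (by norm_num)
  convert this using 1
  funext τ; ring

-- Average the energy with its mirror image and use 2(ab + a'b') = (a+a')(b+b') + (a-a')(b-b'). The
-- products of differences for which exactly one of x, y lies in P are split off, because there the
-- generators enter with a minus sign.
open Classical in
theorem quad_eq_reflection (hr : IsReflection c θ P) (τ : ι → ℝ) :
    quad c τ = (1 / 8 * ∑ x, ∑ y, c x y * ((τ x + τ (θ x)) * (τ y + τ (θ y))) +
      1 / 8 * ∑ x, ∑ y, if P x ↔ P y then c x y * ((τ x - τ (θ x)) * (τ y - τ (θ y))) else 0) +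
      1 / 8 * ∑ x, ∑ y, c x y * (if P x ↔ P y then 0 else (τ x - τ (θ x)) * (τ y - τ (θ y))) := by
  have h1 : ∑ x, ∑ y, c x y * τ x * τ y = ∑ x, ∑ y, c x y * τ (θ x) * τ (θ y) := by
    have hinv : Function.Involutive θ := hr.invol
    rw [← Equiv.sum_comp hinv.toPerm]
    refine Finset.sum_congr rfl fun x _ => ?_
    rw [← Equiv.sum_comp hinv.toPerm]
    refine Finset.sum_congr rfl fun y _ => ?_
    simp [hr.inv]
  have h2 : quad c τ = 1 / 8 * ∑ x, ∑ y, (2 * (c x y * τ x * τ y) +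
      2 * (c x y * τ (θ x) * τ (θ y))) := by
    simp only [Finset.sum_add_distrib, ← Finset.mul_sum, ← h1, quad]; ring
  rw [h2, ← mul_add, ← mul_add]
  congr 1
  simp only [← Finset.sum_add_distrib]
  refine Finset.sum_congr rfl fun x _ => Finset.sum_congr rfl fun y _ => ?_
  split_ifs <;> ring

/-- A bond that separates P from its complement either ends on the mirror, where the difference
vanishes, or joins two mirror images. In the latter case it contributes minus a square, which no
sign reversal changes. -/
theorem reflection_diff_mul_eq (hr : IsReflection c θ P) {x y : ι} (h : ¬(P x ↔ P y)) (τ : ι → ℝ) :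
    c x y * ((τ x - τ (θ x)) * (τ y - τ (θ y))) = 0 ∨ y = θ x := by
  by_cases hc : c x y = 0
  · simp [hc]
  by_cases hx : P x
  · have hy : ¬P y := fun hy => h (by simp [hx, hy])
    by_cases hy' : P (θ y)
    · right
      have := hr.cross x (θ y) hx hy' (by rwa [hr.invol])
      rw [← this, hr.invol]
    · simp [hr.fixed y hy hy']
  · have hy : P y := by tauto
    by_cases hx' : P (θ x)
    · right
      exact hr.cross (θ x) y hx' hy (by rw [hr.inv]; exact hc)
    · simp [hr.fixed x hx hx']

theorem sub_reflFlip_sq (hr : IsReflection c θ P) (j : ι × Bool) (τ : ι → ℝ) (x : ι) :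
    (reflFlip θ P j τ x - reflFlip θ P j τ (θ x)) ^ 2 = (τ x - τ (θ x)) ^ 2 := by
  have key : ∀ x, P x → (reflFlip θ P j τ x - reflFlip θ P j τ (θ x)) ^ 2 = (τ x - τ (θ x)) ^ 2 := by
    intro x hx
    have h0 : ∀ τ : ι → ℝ, reflGen θ P (x, false) τ = τ x - τ (θ x) := fun τ => by
      simp [reflGen, hx]
    rw [← h0, ← h0]
    by_cases h : j = (x, false)
    · rw [h, reflGen_reflFlip_self, neg_sq]
    · rw [reflGen_reflFlip_of_ne hr τ h]
  by_cases h1 : P x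
  · exact key x h1
  · by_cases h2 : P (θ x)
    · have := key (θ x) h2
      rw [hr.invol] at this
      linarith [sub_sq_comm (reflFlip θ P j τ x) (reflFlip θ P j τ (θ x)),
        sub_sq_comm (τ x) (τ (θ x))]
    · simp [hr.fixed x h1 h2]

/-- Ginibre's principle for the generators `reflGen`: the energy is a positive polynomial in them,
up to the squares of the bonds across the mirror, which go into the invariant weight. The extra
interaction Q' need not be symmetric under θ; Griffiths' second inequality uses this freedom. -/
theorem integral_reflection_nonneg (hρ : IsEvenSpin ρ) (hr : IsReflection c θ P)
    {f Q' : (ι → ℝ) → ℝ} (hf : PosPoly (reflGen θ P) f) (hQ' : PosPoly (reflGen θ P) Q')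
    {C : ℝ} (hC : 0 ≤ C) (hQ'C : ∀ τ, |Q' τ| ≤ C * energy τ) :
    0 ≤ ∫ τ, f τ * Real.exp (quad c τ + Q' τ) ∂(Measure.pi fun _ : ι => ρ) := by
  classical
  set R : (ι → ℝ) → ℝ := fun τ =>
    1 / 8 * ∑ x, ∑ y, c x y * (if P x ↔ P y then 0 else (τ x - τ (θ x)) * (τ y - τ (θ y))) with hR
  set S : (ι → ℝ) → ℝ := fun τ =>
    1 / 8 * ∑ x, ∑ y, c x y * ((τ x + τ (θ x)) * (τ y + τ (θ y))) +
      1 / 8 * ∑ x, ∑ y, if P x ↔ P y then c x y * ((τ x - τ (θ x)) * (τ y - τ (θ y))) else 0 with hS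
  have hSR : ∀ τ, quad c τ = S τ + R τ := quad_eq_reflection hr
  set D := ∑ x, ∑ y, |c x y|
  have hD : 0 ≤ D := sum_sum_abs_nonneg c
  have hRm : Measurable R := by
    refine (Finset.measurable_sum _ fun x _ => Finset.measurable_sum _ fun y _ =>
      Measurable.const_mul ?_ _).const_mul _
    split_ifs
    · exact measurable_const
    · fun_prop
  have hRb : ∀ τ, |R τ| ≤ D * energy τ := fun τ => by
    have h := abs_sum_sum_le (c := c) (D := 4 * energy τ)
      (m := fun x y => if P x ↔ P y then 0 else (τ x - τ (θ x)) * (τ y - τ (θ y)))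
      (fun x y => by
        have := energy_nonneg τ
        split_ifs
        · simpa using this
        · have e : (τ x - τ (θ x)) * (τ y - τ (θ y)) =
            τ x * τ y - τ x * τ (θ y) - τ (θ x) * τ y + τ (θ x) * τ (θ y) := by ring
          rw [e]
          have h1 := abs_le.1 (abs_mul_le_energy τ x y)
          have h2 := abs_le.1 (abs_mul_le_energy τ x (θ y))
          have h3 := abs_le.1 (abs_mul_le_energy τ (θ x) y)
          have h4 := abs_le.1 (abs_mul_le_energy τ (θ x) (θ y))
          rw [abs_le]; constructor <;> linarith)
    simp only [hR]
    rw [abs_mul]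
    have h2 : |(1 / 8 : ℝ)| = 1 / 8 := by norm_num
    rw [h2]
    have : 0 ≤ D * energy τ := mul_nonneg hD (energy_nonneg τ)
    change _ ≤ D * (4 * energy τ) at h
    linarith
  have hSp : PosPoly (reflGen θ P) S := by
    refine PosPoly.add (PosPoly.const_mul (PosPoly.sum _ fun x _ => PosPoly.sum _ fun y _ =>
      ((posPoly_add hr x).mul (posPoly_add hr y)).const_mul (hr.nonneg x y)) (by norm_num))
      (PosPoly.const_mul (PosPoly.sum _ fun x _ => PosPoly.sum _ fun y _ => ?_) (by norm_num))
    split_ifs with h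
    · refine PosPoly.const_mul ?_ (hr.nonneg x y)
      by_cases hx : P x
      · exact (posPoly_sub hr (hr.disj x hx)).mul (posPoly_sub hr (hr.disj y (h.1 hx)))
      · have hy : ¬P y := fun hy => hx (h.2 hy)
        have := (posPoly_sub hr (x := θ x) (by rwa [hr.invol])).mul
          (posPoly_sub hr (x := θ y) (by rwa [hr.invol]))
        convert this using 1
        funext τ
        rw [hr.invol, hr.invol]; ring
    · exact PosPoly.const _ le_rfl
  have hgt : ∀ j, Tame energy (reflGen θ P j) := tame_reflGen
  have hwt : Tame energy fun τ => Real.exp (R τ) :=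
    Tame.exp hD hRm fun τ => (le_abs_self _).trans (hRb τ)
  have hb : ∀ τ, |S τ + Q' τ| ≤ (2 * D + C) * energy τ := fun τ => by
    have h1 := abs_le.1 (hRb τ)
    have h2 := abs_le.1 (abs_quad_le c τ)
    have h3 := abs_le.1 (hQ'C τ)
    rw [hSR τ] at h2
    rw [abs_le]; constructor <;> linarith
  have key := integral_posPoly_mul_exp_nonneg (T := reflFlip θ P) (g := reflGen θ P)
    (f := f) (w := fun τ => Real.exp (R τ)) (Q := fun τ => S τ + Q' τ) (expInt_energy hρ)
    (fun τ => (Real.exp_pos _).le) hwt hgt (measurePreserving_reflFlip hρ)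
    (fun j τ => by
      congr 1
      simp only [hR]
      congr 1
      refine Finset.sum_congr rfl fun x _ => Finset.sum_congr rfl fun y _ => ?_
      split_ifs with h
      · rfl
      · rcases reflection_diff_mul_eq hr h τ with h1 | h1
        · rcases reflection_diff_mul_eq hr h (reflFlip θ P j τ) with h2 | h2
          · rw [h1, h2]
          · subst h2
            have h3 := sub_reflFlip_sq hr j τ x
            rw [hr.invol] at h1 ⊢
            linear_combination (-c x (θ x)) * h3
        · subst h1
          have h3 := sub_reflFlip_sq hr j τ x
          rw [hr.invol]
          linear_combination (-c x (θ x)) * h3)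
    (fun j τ => reflGen_reflFlip_self j τ)
    (fun i j τ hij => reflGen_reflFlip_of_ne hr τ hij)
    hf (hSp.add hQ')
    (Tame.exp (by positivity) ((hSp.add hQ').tame energy_nonneg hgt).meas.abs hb)
  convert key using 3 with τ
  rw [hSR, mul_assoc, ← Real.exp_add]
  congr 2; ring

/-- Reflection monotonicity (Messager and Miracle-Solé): the correlation of two spins on the same
side does not increase if one of them is reflected. -/
theorem integral_mul_sub_reflection_nonneg (hρ : IsEvenSpin ρ) (hr : IsReflection c θ P)
    {u y : ι} (hu : ¬P (θ u)) (hy : ¬P (θ y)) :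
    0 ≤ ∫ τ, τ u * (τ y - τ (θ y)) * Real.exp (quad c τ) ∂(Measure.pi fun _ : ι => ρ) := by
  have := integral_reflection_nonneg (C := 0) hρ hr ((posPoly_coord hr hu).mul (posPoly_sub hr hy))
    (PosPoly.const _ (le_refl 0)) le_rfl (fun τ => by simp)
  simpa using this

theorem isReflection_id (hc : ∀ x y, 0 ≤ c x y) (hs : ∀ x y, c x y = c y x) :
    IsReflection c id fun _ => False where
  nonneg := hc
  symm := hs
  invol _ := rfl
  inv _ _ := rfl
  disj _ h := h.elim
  fixed _ _ _ := rfl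
  cross _ _ h := h.elim

/-- Griffiths' first inequality. -/
theorem integral_posPoly_nonneg (hρ : IsEvenSpin ρ) (hc : ∀ x y, 0 ≤ c x y)
    (hs : ∀ x y, c x y = c y x) {f : (ι → ℝ) → ℝ}
    (hf : PosPoly (reflGen id fun _ : ι => False) f) :
    0 ≤ ∫ τ, f τ * Real.exp (quad c τ) ∂(Measure.pi fun _ : ι => ρ) := by
  have := integral_reflection_nonneg (C := 0) hρ (isReflection_id hc hs) hf
    (PosPoly.const _ (le_refl 0)) le_rfl (fun τ => by simp)
  simpa using this

theorem posPoly_coord_id (x : ι) : PosPoly (reflGen id fun _ : ι => False) fun τ => τ x := by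
  have := (PosPoly.gen (reflGen id fun _ : ι => False) (x, true)).const_mul (c := 1 / 2)
    (by norm_num)
  convert this using 1
  funext τ
  simp [reflGen]; ring

/-- Griffiths' second inequality: pair correlations increase with the couplings. -/
theorem gibbsMean_mono (hρ : IsEvenSpin ρ) {c c' : ι → ι → ℝ} (hc : ∀ x y, 0 ≤ c x y)
    (hs : ∀ x y, c x y = c y x) (hcc : ∀ x y, c x y ≤ c' x y) (u v : ι) :
    gibbsMean ρ c (fun τ => τ u * τ v) ≤ gibbsMean ρ c' fun τ => τ u * τ v := by
  classical
  -- Two independent copies of the system with couplings c; the reflection exchanges them and the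
  -- first copy plays the role of the half-space.
  set k : ι ⊕ ι → ι ⊕ ι → ℝ := fun a b => match a, b with
    | .inl x, .inl y => c x y
    | .inr x, .inr y => c x y
    | _, _ => 0
  have hr : IsReflection k Sum.swap (fun a => a.isLeft = true) :=
    { nonneg := by rintro (x | x) (y | y) <;> simp [k, hc]
      symm := by rintro (x | x) (y | y) <;> simp [k, hs x y]
      invol := by simp
      inv := by rintro (x | x) (y | y) <;> simp [k]
      disj := by rintro (x | x) <;> simp
      fixed := by rintro (x | x) <;> simp
      cross := by rintro (x | x) (y | y) <;> simp [k] }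
  have hl : ∀ x : ι, PosPoly (reflGen Sum.swap fun a : ι ⊕ ι => a.isLeft = true)
      fun τ => τ (.inl x) := fun x => posPoly_coord hr (by simp)
  have hf : PosPoly (reflGen Sum.swap fun a : ι ⊕ ι => a.isLeft = true)
      fun τ => τ (.inl u) * τ (.inl v) - τ (.inr u) * τ (.inr v) := by
    have h1 := posPoly_add hr (.inl u)
    have h2 := posPoly_add hr (.inl v)
    have h3 := posPoly_sub hr (x := .inl u) (by simp)
    have h4 := posPoly_sub hr (x := .inl v) (by simp)
    have := ((h1.mul h4).add (h3.mul h2)).const_mul (c := 1 / 2) (by norm_num)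
    convert this using 1
    funext τ; simp; ring
  -- The surplus c' - c is switched on in the first copy only. It is a positive polynomial, because
  -- each spin of the first copy is half a sum plus half a difference.
  set Q' : (ι ⊕ ι → ℝ) → ℝ := fun τ => quad (fun x y => c' x y - c x y) fun x => τ (.inl x) with hQ'
  have hQ'p : PosPoly (reflGen Sum.swap fun a : ι ⊕ ι => a.isLeft = true) Q' := by
    refine PosPoly.const_mul (PosPoly.sum _ fun x _ => PosPoly.sum _ fun y _ => ?_) (by norm_num)
    exact ((hl x).const_mul (sub_nonneg.2 (hcc x y))).mul (hl y)
  have hEl : ∀ τ : ι ⊕ ι → ℝ, energy (fun x => τ (.inl x)) ≤ energy τ := fun τ => by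
    unfold energy
    rw [Fintype.sum_sum_type]
    linarith [Finset.sum_nonneg fun (i : ι) (_ : i ∈ Finset.univ) => sq_nonneg (τ (.inr i))]
  have key := integral_reflection_nonneg hρ hr hf hQ'p (sum_sum_abs_nonneg _) (fun τ =>
    (abs_quad_le _ _).trans (mul_le_mul_of_nonneg_left (hEl τ) (sum_sum_abs_nonneg _)))
  have hk : ∀ τ : ι ⊕ ι → ℝ, quad k τ + Q' τ =
      quad c' (fun x => τ (.inl x)) + quad c fun x => τ (.inr x) := fun τ => by
    simp only [quad, hQ', Fintype.sum_sum_type, k, sub_mul, Finset.sum_sub_distrib]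
    simp
    ring
  have hprod : ∀ F G : (ι → ℝ) → ℝ,
      ∫ τ, F (fun x => τ (.inl x)) * G (fun x => τ (.inr x)) ∂(Measure.pi fun _ : ι ⊕ ι => ρ) =
      (∫ τ, F τ ∂(Measure.pi fun _ : ι => ρ)) * ∫ τ, G τ ∂(Measure.pi fun _ : ι => ρ) := by
    intro F G
    rw [← integral_prod_mul, ← (measurePreserving_sumPiEquivProdPi
      (fun _ : ι ⊕ ι => ρ)).integral_comp']
    rfl
  have hF : ∀ c : ι → ι → ℝ, Integrable (fun τ : ι → ℝ => τ u * τ v * Real.exp (quad c τ))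
      (Measure.pi fun _ : ι => ρ) := fun c =>
    (((tame_coord u).mul (tame_coord v)).mul (tame_exp_quad c)).integrable_pi hρ
  have hW : ∀ c : ι → ι → ℝ, Integrable (fun τ : ι → ℝ => Real.exp (quad c τ))
      (Measure.pi fun _ : ι => ρ) := fun c => (tame_exp_quad c).integrable_pi hρ
  have e : ∀ τ : ι ⊕ ι → ℝ, (τ (.inl u) * τ (.inl v) - τ (.inr u) * τ (.inr v)) *
      Real.exp (quad k τ + Q' τ) =
      (fun σ : ι → ℝ => σ u * σ v * Real.exp (quad c' σ)) (fun x => τ (.inl x)) *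
        (fun σ : ι → ℝ => Real.exp (quad c σ)) (fun x => τ (.inr x)) -
      (fun σ : ι → ℝ => Real.exp (quad c' σ)) (fun x => τ (.inl x)) *
        (fun σ : ι → ℝ => σ u * σ v * Real.exp (quad c σ)) (fun x => τ (.inr x)) := fun τ => by
    rw [hk, Real.exp_add]; ring
  have hint : ∀ F G : (ι → ℝ) → ℝ, Integrable F (Measure.pi fun _ : ι => ρ) →
      Integrable G (Measure.pi fun _ : ι => ρ) →
      Integrable (fun τ : ι ⊕ ι → ℝ => F (fun x => τ (.inl x)) * G (fun x => τ (.inr x)))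
        (Measure.pi fun _ : ι ⊕ ι => ρ) := fun F G hF hG =>
    ((measurePreserving_sumPiEquivProdPi (fun _ : ι ⊕ ι => ρ)).integrable_comp_emb
      (MeasurableEquiv.measurableEmbedding _)).2 (hF.mul_prod hG)
  have hsub : ∀ F G F' G' : (ι → ℝ) → ℝ, Integrable F (Measure.pi fun _ : ι => ρ) →
      Integrable G (Measure.pi fun _ : ι => ρ) → Integrable F' (Measure.pi fun _ : ι => ρ) →
      Integrable G' (Measure.pi fun _ : ι => ρ) →
      ∫ τ, (F (fun x => τ (.inl x)) * G (fun x => τ (.inr x)) -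
        F' (fun x => τ (.inl x)) * G' (fun x => τ (.inr x))) ∂(Measure.pi fun _ : ι ⊕ ι => ρ) =
      (∫ τ, F τ ∂(Measure.pi fun _ : ι => ρ)) * (∫ τ, G τ ∂(Measure.pi fun _ : ι => ρ)) -
      (∫ τ, F' τ ∂(Measure.pi fun _ : ι => ρ)) * ∫ τ, G' τ ∂(Measure.pi fun _ : ι => ρ) :=
    fun F G F' G' h1 h2 h3 h4 => by
      rw [integral_sub (hint F G h1 h2) (hint F' G' h3 h4), hprod, hprod]
  have key := key.trans_eq ((integral_congr_ae (ae_of_all _ e)).trans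
    (hsub _ _ _ _ (hF c') (hW c) (hW c') (hF c)))
  unfold gibbsMean
  rw [div_le_div_iff₀ (partition_pos hρ c) (partition_pos hρ c')]
  linarith

end Model

/-! ### Reflection positivity -/


section ReflectionPositivity

variable {ι : Type*} [Fintype ι]

/-- The bilinear form of `quad`. -/
noncomputable def bil (c : ι → ι → ℝ) (u v : ι → ℝ) : ℝ := 1 / 2 * ∑ x, ∑ y, c x y * (u x * v y)

theorem quad_eq_bil (c : ι → ι → ℝ) (u : ι → ℝ) : quad c u = bil c u u := by
  simp only [quad, bil, mul_assoc]

theorem bil_add_left (c : ι → ι → ℝ) (u u' v : ι → ℝ) :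
    bil c (fun x => u x + u' x) v = bil c u v + bil c u' v := by
  simp only [bil, add_mul, mul_add, Finset.sum_add_distrib]

theorem bil_add_right (c : ι → ι → ℝ) (u v v' : ι → ℝ) :
    bil c u (fun x => v x + v' x) = bil c u v + bil c u v' := by
  simp only [bil, mul_add, Finset.sum_add_distrib]

theorem bil_comm {c : ι → ι → ℝ} (hs : ∀ x y, c x y = c y x) (u v : ι → ℝ) :
    bil c u v = bil c v u := by
  simp only [bil]
  rw [Finset.sum_comm]
  congr 1
  refine Finset.sum_congr rfl fun x _ => Finset.sum_congr rfl fun y _ => ?_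
  rw [hs y x]; ring

theorem abs_bil_le (c : ι → ι → ℝ) (u v : ι → ℝ) :
    |bil c u v| ≤ (∑ x, ∑ y, |c x y|) * (energy u + energy v) := by
  have h := abs_sum_sum_le (c := c) (m := fun x y => u x * v y) (D := energy u + energy v)
    (fun x y => by
      have h1 := sq_le_energy u x
      have h2 := sq_le_energy v y
      rw [abs_le]; constructor <;> nlinarith [sq_nonneg (u x - v y), sq_nonneg (u x + v y)])
  unfold bil
  rw [abs_mul]
  have h2 : |(1 / 2 : ℝ)| = 1 / 2 := by norm_num
  rw [h2]
  linarith [abs_nonneg (∑ x, ∑ y, c x y * (u x * v y))]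

theorem measurable_bil (c : ι → ι → ℝ) {X : Type*} [MeasurableSpace X] {u v : X → ι → ℝ}
    (hu : Measurable u) (hv : Measurable v) : Measurable fun p => bil c (u p) (v p) := by
  unfold bil
  refine (Finset.measurable_sum _ fun x _ => Finset.measurable_sum _ fun y _ =>
    Measurable.const_mul ?_ _).const_mul _
  exact ((measurable_pi_apply x).comp hu).mul ((measurable_pi_apply y).comp hv)

open Classical in
/-- The configuration equal to `p.1` on the mirror, to `p.2.1` on the side `P`, and to the mirror
image of `p.2.2` on the other side. -/
noncomputable def reflMix (θ : ι → ι) (P : ι → Prop)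
    (p : (ι → ℝ) × (ι → ℝ) × (ι → ℝ)) : ι → ℝ :=
  fun x => if P x then p.2.1 x else if P (θ x) then p.2.2 (θ x) else p.1 x

open Classical in
noncomputable def restr (P : ι → Prop) (τ : ι → ℝ) : ι → ℝ := fun x => if P x then τ x else 0

open Classical in
noncomputable def overwrite (P : ι → Prop) (ζ τ : ι → ℝ) : ι → ℝ :=
  fun x => if P x then τ x else ζ x

variable {ρ : Measure ℝ} [IsProbabilityMeasure ρ] {c : ι → ι → ℝ} {θ : ι → ι} {P : ι → Prop}

theorem measurable_restr (P : ι → Prop) : Measurable (restr P) := by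
  refine measurable_pi_iff.2 fun x => ?_
  unfold restr
  split_ifs <;> fun_prop

theorem energy_restr_le (P : ι → Prop) (τ : ι → ℝ) : energy (restr P τ) ≤ energy τ := by
  refine Finset.sum_le_sum fun x _ => ?_
  unfold restr
  split_ifs
  · exact le_rfl
  · simpa using sq_nonneg (τ x)

theorem energy_overwrite_le (P : ι → Prop) (ζ τ : ι → ℝ) :
    energy (overwrite P ζ τ) ≤ energy ζ + energy τ := by
  unfold energy
  rw [← Finset.sum_add_distrib]
  refine Finset.sum_le_sum fun x _ => ?_
  unfold overwrite
  split_ifs <;> nlinarith [sq_nonneg (τ x), sq_nonneg (ζ x)]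

theorem measurable_overwrite (P : ι → Prop) :
    Measurable fun p : (ι → ℝ) × (ι → ℝ) => overwrite P p.1 p.2 := by
  refine measurable_pi_iff.2 fun x => ?_
  unfold overwrite
  split_ifs <;> fun_prop

/-- Each site reads exactly one coordinate of the three independent configurations, and distinct
sites read distinct coordinates. -/
theorem measurePreserving_reflMix (hr : IsReflection c θ P) :
    MeasurePreserving (reflMix θ P) ((Measure.pi fun _ : ι => ρ).prod
      ((Measure.pi fun _ : ι => ρ).prod (Measure.pi fun _ : ι => ρ)))
      (Measure.pi fun _ : ι => ρ) := by
  classical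
  have hm : Measurable (reflMix θ P) := by
    refine measurable_pi_iff.2 fun x => ?_
    unfold reflMix
    split_ifs <;> fun_prop
  refine ⟨hm, (Measure.pi_eq fun s hs => ?_).symm⟩
  rw [Measure.map_apply hm (MeasurableSet.univ_pi hs)]
  have : reflMix θ P ⁻¹' Set.pi Set.univ s =
      (Set.pi Set.univ fun x => if P x ∨ P (θ x) then Set.univ else s x) ×ˢ
        ((Set.pi Set.univ fun x => if P x then s x else Set.univ) ×ˢ
          (Set.pi Set.univ fun x => if P x then s (θ x) else Set.univ)) := by
    ext ⟨ζ, τ, τ'⟩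
    simp only [Set.mem_preimage, Set.mem_pi, Set.mem_univ, true_implies, Set.mem_prod, reflMix]
    constructor
    · intro h
      refine ⟨fun x => ?_, fun x => ?_, fun x => ?_⟩
      · have := h x
        split_ifs at this ⊢ <;> simp_all
      · have := h x
        split_ifs at this ⊢ <;> simp_all
      · have := h (θ x)
        have hd := hr.disj x
        split_ifs with h1
        · simpa [hd h1, hr.invol, h1] using this
        · trivial
    · rintro ⟨h1, h2, h3⟩ x
      split_ifs with hx hx'
      · simpa [hx] using h2 x
      · simpa [hx', hr.invol] using h3 (θ x)
      · simpa [hx, hx'] using h1 x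
  rw [this, Measure.prod_prod, Measure.prod_prod, Measure.pi_pi, Measure.pi_pi, Measure.pi_pi]
  have hinv : Function.Involutive θ := hr.invol
  have h3 : ∏ x, ρ (if P x then s (θ x) else Set.univ) =
      ∏ x, ρ (if P (θ x) then s x else Set.univ) := by
    rw [← Equiv.prod_comp hinv.toPerm]
    simp [hr.invol]
  rw [h3, ← Finset.prod_mul_distrib, ← Finset.prod_mul_distrib]
  refine Finset.prod_congr rfl fun x _ => ?_
  have hd := hr.disj x
  by_cases h1 : P x
  · simp [h1, hd h1]
  · by_cases h2 : P (θ x) <;> simp [h1, h2]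

theorem bil_refl (hr : IsReflection c θ P) (u v : ι → ℝ) :
    bil c (fun x => u (θ x)) (fun x => v (θ x)) = bil c u v := by
  have hinv : Function.Involutive θ := hr.invol
  unfold bil
  congr 1
  conv_rhs => rw [← Equiv.sum_comp hinv.toPerm]
  refine Finset.sum_congr rfl fun x _ => ?_
  conv_rhs => rw [← Equiv.sum_comp hinv.toPerm]
  refine Finset.sum_congr rfl fun y _ => ?_
  simp [hr.inv]

/-- The part of the energy of `reflMix` that comes from one closed half-space. -/
noncomputable def halfQuad (c : ι → ι → ℝ) (θ : ι → ι) (P : ι → Prop)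
    (p : (ι → ℝ) × (ι → ℝ)) : ℝ :=
  1 / 2 * bil c (restr (fun x => ¬P x ∧ ¬P (θ x)) p.1) (restr (fun x => ¬P x ∧ ¬P (θ x)) p.1) +
    bil c (restr P p.2) (restr P p.2) +
    2 * bil c (restr (fun x => ¬P x ∧ ¬P (θ x)) p.1) (restr P p.2)

open Classical in
noncomputable def crossTerm (c : ι → ι → ℝ) (θ : ι → ι) (P : ι → Prop) (τ τ' : ι → ℝ) : ℝ :=
  ∑ x, (if P x then c x (θ x) else 0) * (τ x * τ' x)

theorem bil_restr_refl (hr : IsReflection c θ P) (τ τ' : ι → ℝ) :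
    2 * bil c (restr P τ) (fun x => restr P τ' (θ x)) = crossTerm c θ P τ τ' := by
  classical
  have hinv : Function.Involutive θ := hr.invol
  unfold bil crossTerm
  rw [← mul_assoc, show (2 : ℝ) * (1 / 2) = 1 by norm_num, one_mul]
  refine Finset.sum_congr rfl fun x _ => ?_
  rw [← Equiv.sum_comp hinv.toPerm, Finset.sum_eq_single x]
  · by_cases h : P x <;> simp [restr, h, hr.invol]
  · intro y _ hy
    simp only [Function.Involutive.coe_toPerm, hr.invol, restr]
    by_cases h1 : P x
    · by_cases h2 : P y
      · have : c x (θ y) = 0 := by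
          by_contra h
          exact hy (hr.cross x y h1 h2 h)
        simp [this]
      · simp [h2]
    · simp [h1]
  · simp

/-- The open half-spaces interact only through pairs of mirror images. The energy inside the mirror
is shared equally by the two halves, hence the factor 1/2 in `halfQuad`. -/
theorem quad_reflMix (hr : IsReflection c θ P) (p : (ι → ℝ) × (ι → ℝ) × (ι → ℝ)) :
    quad c (reflMix θ P p) = halfQuad c θ P (p.1, p.2.1) + halfQuad c θ P (p.1, p.2.2) +
      crossTerm c θ P p.2.1 p.2.2 := by
  classical
  obtain ⟨ζ, τ, τ'⟩ := p
  set a := restr (fun x => ¬P x ∧ ¬P (θ x)) ζ with ha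
  have h1 : reflMix θ P (ζ, τ, τ') = fun x => a x + (restr P τ x + restr P τ' (θ x)) := by
    funext x
    have hd := hr.disj x
    by_cases h1 : P x
    · simp [reflMix, a, restr, h1, hd h1]
    · by_cases h2 : P (θ x) <;> simp [reflMix, a, restr, h1, h2]
  have h2 : (fun x => a (θ x)) = a := by
    funext x
    have hf := hr.fixed x
    by_cases h1 : P x
    · simp [a, restr, h1, hr.invol]
    · by_cases h2 : P (θ x)
      · simp [a, restr, h2]
      · simp [hf h1 h2]
  have h3 : bil c a (fun x => restr P τ' (θ x)) = bil c a (restr P τ') := by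
    conv_lhs => rw [← h2]
    exact bil_refl hr a (restr P τ')
  rw [quad_eq_bil, h1, bil_add_left, bil_add_right, bil_add_right, bil_add_left, bil_add_right,
    bil_add_right, bil_add_right, bil_add_right, h3, bil_refl hr (restr P τ') (restr P τ'), ← bil_restr_refl hr,
    bil_comm hr.symm (restr P τ) a, bil_comm hr.symm (fun x => restr P τ' (θ x)) a, h3,
    bil_comm hr.symm (fun x => restr P τ' (θ x)) (restr P τ)]
  simp only [halfQuad, ← ha]
  ring

/-- For a fixed first coordinate the other two are independent and identically distributed, so the
inner integral is a square. -/
theorem integral_prod_self_mul {X Y : Type*} [MeasurableSpace X] [MeasurableSpace Y]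
    {μ : Measure X} {ν : Measure Y} [SFinite μ] [SFinite ν] {A : X × Y → ℝ}
    (hA : Integrable (fun p : X × Y × Y => A (p.1, p.2.1) * A (p.1, p.2.2)) (μ.prod (ν.prod ν))) :
    0 ≤ ∫ p, A (p.1, p.2.1) * A (p.1, p.2.2) ∂(μ.prod (ν.prod ν)) := by
  rw [integral_prod _ hA]
  refine integral_nonneg fun x => ?_
  simp only
  rw [integral_prod_mul (fun y => A (x, y)) fun y => A (x, y)]
  exact mul_self_nonneg _

/-- Reflection positivity. -/
theorem integral_mul_reflection_nonneg (hρ : IsEvenSpin ρ) (hr : IsReflection c θ P)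
    {F : (ι → ℝ) → ℝ} (hF : Tame energy F)
    (hFP : ∀ τ τ' : ι → ℝ, (∀ x, ¬P (θ x) → τ x = τ' x) → F τ = F τ') :
    0 ≤ ∫ τ, F τ * F (fun x => τ (θ x)) * Real.exp (quad c τ) ∂(Measure.pi fun _ : ι => ρ) := by
  classical
  set μ : Measure (ι → ℝ) := Measure.pi fun _ : ι => ρ
  set A : (ι → ℝ) × (ι → ℝ) → ℝ := fun p =>
    F (overwrite P p.1 p.2) * Real.exp (halfQuad c θ P p) with hA
  have hE := expInt_energy (ι := ι) hρ
  have hE3 := hE.prod (hE.prod hE)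
  set E2 : (ι → ℝ) × (ι → ℝ) → ℝ := fun p => energy p.1 + energy p.2 with hE2
  set E3 : (ι → ℝ) × (ι → ℝ) × (ι → ℝ) → ℝ := fun p => energy p.1 + (energy p.2.1 + energy p.2.2)
    with hE3'
  set D := ∑ x, ∑ y, |c x y|
  have hD : 0 ≤ D := sum_sum_abs_nonneg c
  have hAt : Tame E2 A := by
    refine (hF.comp (measurable_overwrite P) fun p => energy_overwrite_le P p.1 p.2).mul
      (Tame.exp (C := 6 * D) (by positivity) ?_ fun p => ?_)
    · have h1 := (measurable_restr (fun x => ¬P x ∧ ¬P (θ x))).comp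
        (measurable_fst : Measurable (Prod.fst : (ι → ℝ) × (ι → ℝ) → _))
      have h2 := (measurable_restr P).comp
        (measurable_snd : Measurable (Prod.snd : (ι → ℝ) × (ι → ℝ) → _))
      exact (((measurable_bil c h1 h1).const_mul _).add (measurable_bil c h2 h2)).add
        ((measurable_bil c h1 h2).const_mul _)
    · set a := restr (fun x => ¬P x ∧ ¬P (θ x)) p.1
      have ha : energy a ≤ energy p.1 := energy_restr_le _ _
      have hb : energy (restr P p.2) ≤ energy p.2 := energy_restr_le _ _
      have h1 := (le_abs_self _).trans (abs_bil_le c a a)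
      have h2 := (le_abs_self _).trans (abs_bil_le c (restr P p.2) (restr P p.2))
      have h3 := (le_abs_self _).trans (abs_bil_le c a (restr P p.2))
      have h4 := mul_le_mul_of_nonneg_left ha hD
      have h5 := mul_le_mul_of_nonneg_left hb hD
      have h6 := mul_nonneg hD (energy_nonneg p.1)
      have h7 := mul_nonneg hD (energy_nonneg p.2)
      rw [mul_add] at h1 h2 h3
      simp only [halfQuad]
      linarith
  have hfst : Tame E3 fun p => A (p.1, p.2.1) :=
    hAt.comp (φ := fun p : (ι → ℝ) × (ι → ℝ) × (ι → ℝ) => (p.1, p.2.1)) (by fun_prop) fun p => by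
      simp only [hE2, hE3']; linarith [energy_nonneg p.2.2]
  have hsnd : Tame E3 fun p => A (p.1, p.2.2) :=
    hAt.comp (φ := fun p : (ι → ℝ) × (ι → ℝ) × (ι → ℝ) => (p.1, p.2.2)) (by fun_prop) fun p => by
      simp only [hE2, hE3']; linarith [energy_nonneg p.2.1]
  set γ : ι → ℝ := fun x => if P x then c x (θ x) else 0 with hγ
  have hγ0 : ∀ x, 0 ≤ γ x := fun x => by
    simp only [hγ]; split_ifs
    · exact hr.nonneg _ _
    · exact le_rfl
  have hKm : Measurable fun p : (ι → ℝ) × (ι → ℝ) × (ι → ℝ) => crossTerm c θ P p.2.1 p.2.2 := by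
    unfold crossTerm; fun_prop
  have hKb : ∀ p : (ι → ℝ) × (ι → ℝ) × (ι → ℝ),
      |crossTerm c θ P p.2.1 p.2.2| ≤ (∑ x, γ x) * E3 p := fun p => by
    unfold crossTerm
    rw [Finset.sum_mul]
    refine (Finset.abs_sum_le_sum_abs _ _).trans (Finset.sum_le_sum fun x _ => ?_)
    rw [abs_mul, abs_of_nonneg (hγ0 x)]
    refine mul_le_mul_of_nonneg_left ?_ (hγ0 x)
    have h0 := energy_nonneg p.1
    have h1 := sq_le_energy p.2.1 x
    have h2 := sq_le_energy p.2.2 x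
    simp only [hE3']
    rw [abs_le]; constructor <;>
      nlinarith [sq_nonneg (p.2.1 x - p.2.2 x), sq_nonneg (p.2.1 x + p.2.2 x)]
  have key : 0 ≤ ∫ p, A (p.1, p.2.1) * A (p.1, p.2.2) *
      Real.exp (crossTerm c θ P p.2.1 p.2.2) ∂(μ.prod (μ.prod μ)) := by
    refine integral_mul_exp_nonneg (hfst.mul hsnd).meas hKm ?_ fun k => ?_
    · exact ((hfst.mul hsnd).abs.mul (Tame.exp (Finset.sum_nonneg fun x _ => hγ0 x)
        hKm.abs hKb)).integrable hE3
    -- A power of the cross term expands, with nonnegative coefficients, into products of a function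
    -- of (ζ, τ) with the same function of (ζ, τ').
    · have e : ∀ p : (ι → ℝ) × (ι → ℝ) × (ι → ℝ), A (p.1, p.2.1) * A (p.1, p.2.2) *
          crossTerm c θ P p.2.1 p.2.2 ^ k = ∑ q : Fin k → ι, (∏ i, γ (q i)) *
            ((A (p.1, p.2.1) * ∏ i, p.2.1 (q i)) * (A (p.1, p.2.2) * ∏ i, p.2.2 (q i))) := by
        intro p
        unfold crossTerm
        rw [Fintype.sum_pow, Finset.mul_sum]
        refine Finset.sum_congr rfl fun q _ => ?_
        simp only [Finset.prod_mul_distrib]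
        ring
      have ht : ∀ q : Fin k → ι, Tame E3 fun p => (A (p.1, p.2.1) * ∏ i, p.2.1 (q i)) *
          (A (p.1, p.2.2) * ∏ i, p.2.2 (q i)) := fun q => by
        refine (hfst.mul (Tame.prod _ fun i _ => ?_)).mul (hsnd.mul (Tame.prod _ fun i _ => ?_))
        · exact (tame_coord (q i)).comp (φ := fun p : (ι → ℝ) × (ι → ℝ) × (ι → ℝ) => p.2.1)
            (by fun_prop) fun p => by
              simp only [hE3']; linarith [energy_nonneg p.2.2, energy_nonneg p.1]
        · exact (tame_coord (q i)).comp (φ := fun p : (ι → ℝ) × (ι → ℝ) × (ι → ℝ) => p.2.2)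
            (by fun_prop) fun p => by
              simp only [hE3']; linarith [energy_nonneg p.2.1, energy_nonneg p.1]
      simp only [e]
      rw [integral_finsetSum _ fun q _ => ((ht q).const_mul _).integrable hE3]
      refine Finset.sum_nonneg fun q _ => ?_
      rw [integral_const_mul]
      exact mul_nonneg (Finset.prod_nonneg fun i _ => hγ0 _)
        (integral_prod_self_mul (A := fun p : (ι → ℝ) × (ι → ℝ) => A p * ∏ i, p.2 (q i))
          ((ht q).integrable hE3))
  have hmp := measurePreserving_reflMix (ρ := ρ) hr
  have hθm : Measurable fun (τ : ι → ℝ) (x : ι) => τ (θ x) := by fun_prop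
  have hGm : Measurable fun τ : ι → ℝ => F τ * F (fun x => τ (θ x)) * Real.exp (quad c τ) :=
    (hF.meas.mul (hF.meas.comp hθm)).mul (tame_exp_quad c).meas
  rw [show μ = _ from hmp.map_eq.symm, integral_map hmp.measurable.aemeasurable hGm.aestronglyMeasurable]
  convert key using 3 with p
  have h1 : F (reflMix θ P p) = F (overwrite P p.1 p.2.1) := hFP _ _ fun x hx => by
    simp [reflMix, overwrite, hx]
  have h2 : F (fun x => reflMix θ P p (θ x)) = F (overwrite P p.1 p.2.2) := hFP _ _ fun x hx => by
    by_cases h : P x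
    · simp [reflMix, overwrite, hx, hr.invol, h]
    · simp [hr.fixed x h hx, reflMix, overwrite, h]
  rw [h1, h2, quad_reflMix hr, Real.exp_add, Real.exp_add]
  ring

/-! ### Gaussian domination -/

/-- Both sides are (∂_u - a u)(∂_v - a v) exp(a u v): on the left the operators act on the terms a ^
n u ^ n v ^ n / n!, on the right on the closed form. The left side is a sum of products of one
function evaluated at u and at v, the form to which reflection positivity applies. -/
theorem hasSum_gaussian_kernel (a u v : ℝ) :
    HasSum (fun n : ℕ => a ^ n / (n.factorial : ℝ) * ((n * u ^ (n - 1) - a * u ^ (n + 1)) *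
      (n * v ^ (n - 1) - a * v ^ (n + 1))))
      (a * (1 - a * (u - v) ^ 2) * Real.exp (a * (u * v))) := by
  have hs : ∀ y : ℝ, HasSum (fun k : ℕ => y ^ k / (k.factorial : ℝ)) (Real.exp y) := fun y => by
    rw [Real.exp_eq_exp_ℝ]; exact NormedSpace.expSeries_div_hasSum_exp y
  have h0 := hs (a * (u * v))
  have hfac : ∀ n : ℕ, ((n + 1).factorial : ℝ) = (n + 1) * n.factorial := fun n => by
    push_cast [Nat.factorial_succ]; ring
  have h1 : HasSum (fun n : ℕ => (n : ℝ) * (a ^ n * (u * v) ^ (n - 1)) / (n.factorial : ℝ))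
      (a * Real.exp (a * (u * v))) := by
    rw [← hasSum_nat_add_iff' 1]
    have e1 : (fun n : ℕ => ((n + 1 : ℕ) : ℝ) * (a ^ (n + 1) * (u * v) ^ (n + 1 - 1)) /
        ((n + 1).factorial : ℝ)) = fun n : ℕ => a * ((a * (u * v)) ^ n / (n.factorial : ℝ)) := by
      funext n
      rw [hfac]
      simp only [Nat.add_sub_cancel]
      push_cast
      field_simp
      ring
    rw [e1]
    simpa using h0.mul_left a
  have h2 : HasSum (fun n : ℕ => (n : ℝ) ^ 2 * (a ^ n * (u * v) ^ (n - 1)) / (n.factorial : ℝ))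
      (a * (1 + a * (u * v)) * Real.exp (a * (u * v))) := by
    rw [← hasSum_nat_add_iff' 1]
    have e1 : (fun n : ℕ => ((n + 1 : ℕ) : ℝ) ^ 2 * (a ^ (n + 1) * (u * v) ^ (n + 1 - 1)) /
        ((n + 1).factorial : ℝ)) = fun n : ℕ => a * ((a * (u * v)) ^ n / (n.factorial : ℝ)) +
          a * (u * v) * ((n : ℝ) * (a ^ n * (u * v) ^ (n - 1)) / (n.factorial : ℝ)) := by
      funext n
      rw [hfac]
      rcases n with _ | n
      · simp
      · simp only [Nat.add_sub_cancel]
        push_cast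
        field_simp
        ring
    rw [e1]
    have := (h0.mul_left a).add (h1.mul_left (a * (u * v)))
    have e2 : a * (1 + a * (u * v)) * Real.exp (a * (u * v)) =
      a * Real.exp (a * (u * v)) + a * (u * v) * (a * Real.exp (a * (u * v))) := by ring
    rw [e2]
    simpa using this
  have h3 := ((h2.sub (h1.mul_left (a * u ^ 2))).sub (h1.mul_left (a * v ^ 2))).add
    (h0.mul_left (a ^ 2 * (u * v)))
  have e2 : a * (1 - a * (u - v) ^ 2) * Real.exp (a * (u * v)) =
      a * (1 + a * (u * v)) * Real.exp (a * (u * v)) -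
        a * u ^ 2 * (a * Real.exp (a * (u * v))) - a * v ^ 2 * (a * Real.exp (a * (u * v))) +
      a ^ 2 * (u * v) * Real.exp (a * (u * v)) := by ring
  rw [e2]
  refine h3.congr_fun fun n => ?_
  rcases n with _ | n
  · simp; ring
  · simp only [Nat.add_sub_cancel]
    push_cast
    field_simp
    ring

/-- Gaussian domination for one pair of mirror images. -/
theorem integral_gaussian_domination (hρ : IsEvenSpin ρ) (hr : IsReflection c θ P) {o : ι}
    (ho : P o) (ha : 0 < c o (θ o)) :
    0 ≤ ∫ τ, (1 - c o (θ o) * (τ o - τ (θ o)) ^ 2) * Real.exp (quad c τ)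
      ∂(Measure.pi fun _ : ι => ρ) := by
  classical
  set a := c o (θ o) with haa
  -- The bond between o and θ o is removed from the energy; its Boltzmann factor becomes part of the
  -- kernel.
  set c' : ι → ι → ℝ := fun x y => if (x = o ∧ y = θ o) ∨ (x = θ o ∧ y = o) then 0 else c x y
    with hc'
  have hne : θ o ≠ o := fun h => hr.disj o ho (by rwa [h])
  have hinj : ∀ x y, θ x = θ y ↔ x = y := fun x y =>
    ⟨fun h => by rw [← hr.invol x, h, hr.invol], fun h => by rw [h]⟩
  have hio : ∀ x, θ x = o ↔ x = θ o := fun x => by rw [← hinj, hr.invol]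
  have hr' : IsReflection c' θ P :=
    { nonneg := fun x y => by
        simp only [hc']; split_ifs
        · exact le_rfl
        · exact hr.nonneg x y
      symm := fun x y => by
        simp only [hc', hr.symm x y]
        congr 1
        simp only [eq_iff_iff]; tauto
      invol := hr.invol
      inv := fun x y => by
        simp only [hc', hr.inv, hinj, hio]
        congr 1
        simp only [eq_iff_iff]; tauto
      disj := hr.disj
      fixed := hr.fixed
      cross := fun x y hx hy h => hr.cross x y hx hy fun h0 => h (by simp [hc', h0]) }
  have hq : ∀ τ : ι → ℝ, quad c τ = quad c' τ + a * (τ o * τ (θ o)) := fun τ => by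
    have h1 : ∀ x y, c x y * τ x * τ y = c' x y * τ x * τ y +
        ((if x = o then (if y = θ o then a * (τ o * τ (θ o)) else 0) else 0) +
        (if x = θ o then (if y = o then a * (τ o * τ (θ o)) else 0) else 0)) := by
      intro x y
      by_cases h1 : x = o
      · subst h1
        by_cases h2 : y = θ x
        · subst h2
          simp [hc', hne.symm, haa]; ring
        · simp [hc', h2, hne.symm]
      · by_cases h3 : x = θ o
        · subst h3
          by_cases h2 : y = o
          · subst h2
            simp [hc', hne, haa, hr.symm (θ y) y]; ring
          · simp [hc', h2, hne]
        · simp [hc', h1, h3]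
    unfold quad
    simp only [h1, Finset.sum_add_distrib]
    simp
    ring
  set G : ℕ → ℝ → ℝ := fun n u => n * u ^ (n - 1) - a * u ^ (n + 1) with hG
  have hGt : ∀ n x, Tame energy fun τ : ι → ℝ => G n (τ x) := fun n x =>
    (((tame_coord x).pow _).const_mul _).sub energy_nonneg (((tame_coord x).pow _).const_mul _)
  have key : ∀ n : ℕ, 0 ≤ ∫ τ, G n (τ o) * G n (τ (θ o)) * Real.exp (quad c' τ)
      ∂(Measure.pi fun _ : ι => ρ) := fun n =>
    integral_mul_reflection_nonneg hρ hr' (F := fun τ => G n (τ o)) (hGt n o)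
      fun τ τ' h => by rw [h o (hr.disj o ho)]
  -- The kernel identity at (-a, |u|, -|v|): all terms then have the same sign, which gives a
  -- summable majorant in closed form.
  have hbsum : ∀ u v : ℝ, HasSum (fun n : ℕ => a ^ n / (n.factorial : ℝ) *
      ((n * |u| ^ (n - 1) + a * |u| ^ (n + 1)) * (n * |v| ^ (n - 1) + a * |v| ^ (n + 1))))
      (a * (1 + a * (|u| + |v|) ^ 2) * Real.exp (a * (|u| * |v|))) := fun u v => by
    have h := (hasSum_gaussian_kernel (-a) |u| (-|v|)).neg
    have e : -(-a * (1 - -a * (|u| - -|v|) ^ 2) * Real.exp (-a * (|u| * -|v|))) =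
        a * (1 + a * (|u| + |v|) ^ 2) * Real.exp (a * (|u| * |v|)) := by
      rw [show -a * (|u| * -|v|) = a * (|u| * |v|) by ring]; ring
    rw [e] at h
    refine h.congr_fun fun n => ?_
    rcases n with _ | n
    · simp
    · simp only [Nat.add_sub_cancel, neg_pow a, neg_pow |v|, pow_succ]
      rcases neg_one_pow_eq_or ℝ n with h | h <;> rw [h] <;> ring
  have hprodm : ∀ τ : ι → ℝ, |τ o| * |τ (θ o)| ≤ energy τ := fun τ => by
    rw [← abs_mul]; exact abs_mul_le_energy τ _ _
  have hbt : Tame energy fun τ : ι → ℝ => a * (1 + a * (|τ o| + |τ (θ o)|) ^ 2) *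
      Real.exp (a * (|τ o| * |τ (θ o)|)) * Real.exp (quad c' τ) := by
    refine Tame.mul (Tame.mul ?_ (Tame.exp ha.le (by fun_prop) fun τ =>
      mul_le_mul_of_nonneg_left (hprodm τ) ha.le)) (tame_exp_quad c')
    exact ((Tame.const energy 1).add energy_nonneg (Tame.const_mul (Tame.pow (Tame.add energy_nonneg
      (tame_coord o).abs (tame_coord (θ o)).abs) 2) a)).const_mul a
  have hsum := hasSum_integral_of_dominated_convergence (μ := Measure.pi fun _ : ι => ρ)
    (F := fun (n : ℕ) τ => a ^ n / (n.factorial : ℝ) * (G n (τ o) * G n (τ (θ o))) *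
      Real.exp (quad c' τ))
    (f := fun τ => a * (1 - a * (τ o - τ (θ o)) ^ 2) * Real.exp (a * (τ o * τ (θ o))) *
      Real.exp (quad c' τ))
    (fun n τ => a ^ n / (n.factorial : ℝ) * ((n * |τ o| ^ (n - 1) + a * |τ o| ^ (n + 1)) *
      (n * |τ (θ o)| ^ (n - 1) + a * |τ (θ o)| ^ (n + 1))) * Real.exp (quad c' τ))
    (fun n => ((((hGt n o).mul (hGt n (θ o))).const_mul _).mul
      (tame_exp_quad c')).meas.aestronglyMeasurable)
    (fun n => ae_of_all _ fun τ => by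
      have hb : ∀ u : ℝ, |G n u| ≤ n * |u| ^ (n - 1) + a * |u| ^ (n + 1) := fun u => by
        refine (abs_sub _ _).trans (le_of_eq ?_)
        rw [abs_mul, abs_mul, abs_pow, abs_pow, abs_of_pos ha, Nat.abs_cast]
      rw [Real.norm_eq_abs, abs_mul, abs_mul, abs_mul, Real.abs_exp,
        abs_of_nonneg (show 0 ≤ a ^ n / (n.factorial : ℝ) by positivity)]
      refine mul_le_mul_of_nonneg_right (mul_le_mul_of_nonneg_left ?_ (by positivity))
        (Real.exp_pos _).le
      exact mul_le_mul (hb _) (hb _) (abs_nonneg _) (by positivity))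
    (ae_of_all _ fun τ => ((hbsum (τ o) (τ (θ o))).mul_right _).summable)
    (by
      have e : (fun τ : ι → ℝ => ∑' n : ℕ, a ^ n / (n.factorial : ℝ) *
          ((n * |τ o| ^ (n - 1) + a * |τ o| ^ (n + 1)) *
          (n * |τ (θ o)| ^ (n - 1) + a * |τ (θ o)| ^ (n + 1))) * Real.exp (quad c' τ)) = _ :=
        funext fun τ => ((hbsum (τ o) (τ (θ o))).mul_right _).tsum_eq
      rw [e]
      exact hbt.integrable_pi hρ)
    (ae_of_all _ fun τ => (hasSum_gaussian_kernel a (τ o) (τ (θ o))).mul_right _)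
  have h0 := hsum.nonneg fun n => by
    have e : (fun τ : ι → ℝ => a ^ n / (n.factorial : ℝ) * (G n (τ o) * G n (τ (θ o))) *
        Real.exp (quad c' τ)) = fun τ => a ^ n / (n.factorial : ℝ) *
          (G n (τ o) * G n (τ (θ o)) * Real.exp (quad c' τ)) := by funext τ; ring
    rw [e, integral_const_mul]
    exact mul_nonneg (by positivity) (key n)
  have e : (fun τ : ι → ℝ => a * (1 - a * (τ o - τ (θ o)) ^ 2) * Real.exp (a * (τ o * τ (θ o))) *
      Real.exp (quad c' τ)) = fun τ => a * ((1 - a * (τ o - τ (θ o)) ^ 2) *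
        Real.exp (quad c τ)) := by
    funext τ
    rw [hq, Real.exp_add]; ring
  rw [e, integral_const_mul] at h0
  exact nonneg_of_mul_nonneg_right h0 ha

end ReflectionPositivity

/-! ### Resampling a spin -/

section Resampling

/-- Even spin distributions whose moments satisfy the gaussian recursion inequality. -/
structure IsGaussianSpin (ρ : Measure ℝ) : Prop extends IsEvenSpin ρ where
  -- Equality holds for a centred gaussian. The truncated exponent at j = 0 does not matter, since
  -- the prefactor vanishes.
  moment : ∀ j : ℕ, ∫ t, t ^ (j + 1) ∂ρ ≤ j * (∫ t, t ^ 2 ∂ρ) * ∫ t, t ^ (j - 1) ∂ρ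

variable {ι : Type*} [Fintype ι] {ρ : Measure ℝ} [IsProbabilityMeasure ρ] {c : ι → ι → ℝ}

theorem IsEvenSpin.expInt (hρ : IsEvenSpin ρ) : ExpInt (fun t : ℝ => t ^ 2) ρ :=
  ⟨fun t => sq_nonneg t, hρ.int⟩

theorem tame_id : Tame (fun t : ℝ => t ^ 2) fun t => t :=
  Tame.of_sq_le measurable_id fun _ => le_rfl

theorem IsEvenSpin.integral_odd (hρ : IsEvenSpin ρ) {f : ℝ → ℝ} (hf : Measurable f)
    (h : ∀ t, f (-t) = -f t) : ∫ t, f t ∂ρ = 0 := by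
  have h1 : ∫ t, f t ∂ρ = ∫ t, f (-t) ∂ρ := by
    conv_lhs => rw [← hρ.symm]
    exact integral_map measurable_neg.aemeasurable hf.aestronglyMeasurable
  simp only [h, integral_neg] at h1
  linarith

theorem one_le_integral_exp (hρ : IsEvenSpin ρ) (s : ℝ) : 1 ≤ ∫ t, Real.exp (s * t) ∂ρ := by
  have h0 : ∫ t, s * t ∂ρ = 0 := hρ.integral_odd (by fun_prop) fun t => by ring
  have hi : Integrable (fun t => s * t) ρ := (tame_id.const_mul s).integrable hρ.expInt
  have he : Integrable (fun t => Real.exp (s * t)) ρ := by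
    refine (Tame.exp (E := fun t : ℝ => t ^ 2 + 1) (C := s ^ 2 + 1) (by positivity) (by fun_prop)
      fun t => ?_).integrable ⟨fun t => by positivity, fun B => ?_⟩
    · nlinarith [sq_nonneg (s - t), sq_nonneg (s * t), sq_nonneg s, sq_nonneg t]
    · simp only [mul_add, Real.exp_add]
      exact (hρ.int B).mul_const _
  calc (1 : ℝ) = ∫ t, (1 + s * t) ∂ρ := by
        rw [integral_add (integrable_const _) hi, h0]; simp
    _ ≤ _ := integral_mono ((integrable_const _).add hi) he fun t => by
        have := Real.add_one_le_exp (s * t)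
        simp only; linarith

-- This lets the spin at o be integrated on its own, the other spins being frozen.
open Classical in
theorem measurePreserving_update (o : ι) :
    MeasurePreserving (fun p : ℝ × (ι → ℝ) => Function.update p.2 o p.1)
      (ρ.prod (Measure.pi fun _ : ι => ρ)) (Measure.pi fun _ : ι => ρ) := by
  have hm : Measurable fun p : ℝ × (ι → ℝ) => Function.update p.2 o p.1 := by
    refine measurable_pi_iff.2 fun x => ?_
    by_cases h : x = o
    · subst h; simpa using measurable_fst
    · simp only [Function.update_of_ne h]; fun_prop
  refine ⟨hm, (Measure.pi_eq fun s hs => ?_).symm⟩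
  rw [Measure.map_apply hm (MeasurableSet.univ_pi hs)]
  have : (fun p : ℝ × (ι → ℝ) => Function.update p.2 o p.1) ⁻¹' Set.pi Set.univ s =
      s o ×ˢ Set.pi Set.univ fun x => if x = o then Set.univ else s x := by
    ext ⟨t, τ⟩
    simp only [Set.mem_preimage, Set.mem_pi, Set.mem_univ, true_implies, Set.mem_prod]
    constructor
    · intro h
      refine ⟨by simpa using h o, fun x => ?_⟩
      split_ifs with hx
      · trivial
      · simpa [hx] using h x
    · rintro ⟨h1, h2⟩ x
      by_cases hx : x = o
      · subst hx; simpa using h1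
      · simpa [hx] using h2 x
  rw [this, Measure.prod_prod, Measure.pi_pi, ← Finset.mul_prod_erase _ _ (Finset.mem_univ o),
    ← Finset.mul_prod_erase _ (fun i => ρ (s i)) (Finset.mem_univ o)]
  simp only [if_true, measure_univ, one_mul]
  congr 1
  refine Finset.prod_congr rfl fun x hx => ?_
  rw [if_neg (Finset.ne_of_mem_erase hx)]

/-- The field acting on the spin at `o`. -/
def localField (c : ι → ι → ℝ) (o : ι) (τ : ι → ℝ) : ℝ := ∑ y, c o y * τ y

open Classical in
/-- The couplings with those of the site `o` removed. -/
noncomputable def delSite (c : ι → ι → ℝ) (o : ι) (x y : ι) : ℝ :=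
  if x = o ∨ y = o then 0 else c x y

theorem measurable_localField (c : ι → ι → ℝ) (o : ι) : Measurable (localField c o) := by
  unfold localField; fun_prop

open Classical in
theorem localField_update (o : ι) (ho : c o o = 0) (τ : ι → ℝ) (t : ℝ) :
    localField c o (Function.update τ o t) = localField c o τ := by
  refine Finset.sum_congr rfl fun y _ => ?_
  by_cases h : y = o
  · subst h; simp [ho]
  · simp [h]

open Classical in
theorem quad_update (hs : ∀ x y, c x y = c y x) {o : ι} (ho : c o o = 0) (τ : ι → ℝ) (t : ℝ) :
    quad c (Function.update τ o t) = localField c o τ * t + quad (delSite c o) τ := by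
  have h1 : ∀ x y, c x y * Function.update τ o t x * Function.update τ o t y =
      (if x = o then c o y * τ y * t else 0) + (if y = o then c o x * τ x * t else 0) +
        delSite c o x y * τ x * τ y := by
    intro x y
    by_cases hx : x = o
    · subst hx
      by_cases hy : y = x
      · subst hy; simp [ho, delSite]
      · simp [hy, delSite]; ring
    · by_cases hy : y = o
      · subst hy
        simp [hx, delSite, hs y x]
      · simp [hx, hy, delSite]
  unfold quad localField
  simp only [h1, Finset.sum_add_distrib, Finset.sum_ite_eq', Finset.mem_univ, if_true, ← Finset.sum_mul]
  rw [Finset.sum_comm]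
  simp only [Finset.sum_ite_eq', Finset.mem_univ, if_true, ← Finset.sum_mul]
  ring

theorem tame_fst {f : ℝ → ℝ} (hf : Tame (fun t : ℝ => t ^ 2) f) :
    Tame (fun p : ℝ × (ι → ℝ) => p.1 ^ 2 + energy p.2) fun p => f p.1 :=
  hf.comp measurable_fst fun p => by linarith [energy_nonneg p.2]

theorem tame_snd {f : (ι → ℝ) → ℝ} (hf : Tame energy f) :
    Tame (fun p : ℝ × (ι → ℝ) => p.1 ^ 2 + energy p.2) fun p => f p.2 :=
  hf.comp measurable_snd fun p => by linarith [sq_nonneg p.1]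

theorem tame_localField (c : ι → ι → ℝ) (o : ι) : Tame energy (localField c o) :=
  Tame.sum energy_nonneg _ fun y _ => (tame_coord y).const_mul _

theorem abs_localField_mul_le (c : ι → ι → ℝ) (o : ι) (p : ℝ × (ι → ℝ)) :
    |localField c o p.2| * |p.1| ≤ (∑ y, |c o y|) * (p.1 ^ 2 + energy p.2) := by
  rw [← abs_mul]
  unfold localField
  rw [Finset.sum_mul, Finset.sum_mul]
  refine (Finset.abs_sum_le_sum_abs _ _).trans (Finset.sum_le_sum fun y _ => ?_)
  rw [mul_assoc, abs_mul]
  refine mul_le_mul_of_nonneg_left ?_ (abs_nonneg _)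
  have := sq_le_energy p.2 y
  rw [abs_le]; constructor <;> nlinarith [sq_nonneg (p.1 - p.2 y), sq_nonneg (p.1 + p.2 y)]

theorem tame_exp_abs_localField (c : ι → ι → ℝ) (o : ι) :
    Tame (fun p : ℝ × (ι → ℝ) => p.1 ^ 2 + energy p.2)
      fun p => Real.exp (|localField c o p.2| * |p.1|) := by
  refine Tame.exp (Finset.sum_nonneg fun y (_ : y ∈ Finset.univ) => abs_nonneg (c o y)) ?_
    (abs_localField_mul_le c o)
  have := measurable_localField c o
  fun_prop

/-- The bracket times the exponential is s d/dt (t ^ p exp(h t)) - t ^ (p + 1) exp(h t). Expanded in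
powers of the field h, it only involves combinations of moments that the recursion controls. -/
theorem hasSum_gaussian_parts (s h t : ℝ) (p : ℕ) :
    HasSum (fun k : ℕ => h ^ k / (k.factorial : ℝ) *
      (s * (p + k : ℕ) * t ^ (p + k - 1) - t ^ (p + k + 1)))
      ((s * (p * t ^ (p - 1) + h * t ^ p) - t ^ (p + 1)) * Real.exp (h * t)) := by
  have h0 : HasSum (fun k : ℕ => (h * t) ^ k / (k.factorial : ℝ)) (Real.exp (h * t)) := by
    rw [Real.exp_eq_exp_ℝ]; exact NormedSpace.expSeries_div_hasSum_exp _
  have hfac : ∀ n : ℕ, ((n + 1).factorial : ℝ) = (n + 1) * n.factorial := fun n => by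
    push_cast [Nat.factorial_succ]; ring
  have h1 : HasSum (fun k : ℕ => (k : ℝ) * (h ^ k * t ^ (k - 1)) / (k.factorial : ℝ))
      (h * Real.exp (h * t)) := by
    rw [← hasSum_nat_add_iff' 1]
    have e1 : (fun n : ℕ => ((n + 1 : ℕ) : ℝ) * (h ^ (n + 1) * t ^ (n + 1 - 1)) /
        ((n + 1).factorial : ℝ)) = fun n : ℕ => h * ((h * t) ^ n / (n.factorial : ℝ)) := by
      funext n
      rw [hfac]
      simp only [Nat.add_sub_cancel]
      push_cast
      field_simp
      ring
    rw [e1]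
    simpa using h0.mul_left h
  have h3 := ((h0.mul_left (s * (p * t ^ (p - 1)))).add (h1.mul_left (s * t ^ p))).sub
    (h0.mul_left (t ^ (p + 1)))
  have e2 : (s * (p * t ^ (p - 1) + h * t ^ p) - t ^ (p + 1)) * Real.exp (h * t) =
      s * (p * t ^ (p - 1)) * Real.exp (h * t) + s * t ^ p * (h * Real.exp (h * t)) -
        t ^ (p + 1) * Real.exp (h * t) := by ring
  rw [e2]
  refine h3.congr_fun fun k => ?_
  rcases p with _ | p
  · simp only [Nat.cast_zero, zero_add, zero_mul, pow_zero, mul_zero]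
    rw [mul_pow, pow_succ t k]; ring
  · rw [show p + 1 + k - 1 = p + k by omega]
    rcases k with _ | k
    · simp; ring
    · simp only [Nat.add_sub_cancel]
      push_cast
      rw [mul_pow]
      ring

/-- The integration by parts inequality for spins with sub-gaussian moment recursion. -/
theorem integral_parts_nonneg (hρ : IsGaussianSpin ρ) (hc : ∀ x y, 0 ≤ c x y)
    (hs : ∀ x y, c x y = c y x) {o : ι} (ho : c o o = 0) (p : ℕ) {f : (ι → ℝ) → ℝ}
    (hf : PosPoly (reflGen id fun _ : ι => False) f)
    (hfo : ∀ τ τ' : ι → ℝ, (∀ x, x ≠ o → τ x = τ' x) → f τ = f τ') :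
    0 ≤ ∫ τ, ((∫ t, t ^ 2 ∂ρ) * (p * τ o ^ (p - 1) + localField c o τ * τ o ^ p) - τ o ^ (p + 1)) *
      f τ * Real.exp (quad c τ) ∂(Measure.pi fun _ : ι => ρ) := by
  classical
  set s := ∫ t, t ^ 2 ∂ρ with hsdef
  have hs0 : 0 ≤ s := integral_nonneg fun t => sq_nonneg t
  have hft : Tame energy f := hf.tame energy_nonneg tame_reflGen
  have hmp := measurePreserving_update (ρ := ρ) o
  have hm : Measurable fun τ : ι → ℝ => (s * (p * τ o ^ (p - 1) + localField c o τ * τ o ^ p) -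
      τ o ^ (p + 1)) * f τ * Real.exp (quad c τ) := by
    have h1 := hft.meas
    have h2 := measurable_localField c o
    have h3 := measurable_quad c
    fun_prop
  have hE := hρ.expInt.prod (expInt_energy (ι := ι) hρ.toIsEvenSpin)
  rw [← hmp.map_eq, integral_map hmp.measurable.aemeasurable hm.aestronglyMeasurable]
  have e : ∀ q : ℝ × (ι → ℝ), (s * (p * Function.update q.2 o q.1 o ^ (p - 1) +
      localField c o (Function.update q.2 o q.1) * Function.update q.2 o q.1 o ^ p) -
      Function.update q.2 o q.1 o ^ (p + 1)) * f (Function.update q.2 o q.1) *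
      Real.exp (quad c (Function.update q.2 o q.1)) =
      (s * (p * q.1 ^ (p - 1) + localField c o q.2 * q.1 ^ p) - q.1 ^ (p + 1)) *
        Real.exp (localField c o q.2 * q.1) * (f q.2 * Real.exp (quad (delSite c o) q.2)) := by
    intro q
    rw [localField_update o ho, quad_update hs ho, Real.exp_add,
      hfo (Function.update q.2 o q.1) q.2 fun x hx => Function.update_of_ne hx _ _]
    simp only [Function.update_self]
    ring
  simp only [e]
  set g : (ι → ℝ) → ℝ := fun τ => f τ * Real.exp (quad (delSite c o) τ) with hg
  have hgt : Tame energy g := hft.mul (tame_exp_quad _)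
  set B : ℝ → ℝ → ℕ → ℝ := fun h t k => |h| ^ k / (k.factorial : ℝ) *
    (s * (p + k : ℕ) * |t| ^ (p + k - 1) + |t| ^ (p + k + 1)) with hB
  have hBsum : ∀ h t : ℝ, HasSum (B h t)
      ((s * (p * |t| ^ (p - 1) + |h| * |t| ^ p) + |t| ^ (p + 1)) * Real.exp (|h| * |t|)) := by
    intro h t
    have h1 := hasSum_gaussian_parts s |h| |t| p
    have h2 : HasSum (fun k : ℕ => (|h| * |t|) ^ k / (k.factorial : ℝ))
        (Real.exp (|h| * |t|)) := by
      rw [Real.exp_eq_exp_ℝ]; exact NormedSpace.expSeries_div_hasSum_exp _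
    have h3 := h1.add (h2.mul_left (2 * |t| ^ (p + 1)))
    have e2 : (s * (p * |t| ^ (p - 1) + |h| * |t| ^ p) + |t| ^ (p + 1)) * Real.exp (|h| * |t|) =
      (s * (p * |t| ^ (p - 1) + |h| * |t| ^ p) - |t| ^ (p + 1)) * Real.exp (|h| * |t|) +
        2 * |t| ^ (p + 1) * Real.exp (|h| * |t|) := by ring
    rw [e2]
    refine h3.congr_fun fun k => ?_
    simp only [hB, mul_pow, pow_add]; ring
  have hterm : ∀ k : ℕ, Tame (fun q : ℝ × (ι → ℝ) => q.1 ^ 2 + energy q.2) fun q =>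
      localField c o q.2 ^ k / (k.factorial : ℝ) *
      (s * (p + k : ℕ) * q.1 ^ (p + k - 1) - q.1 ^ (p + k + 1)) * g q.2 := fun k => by
    have h1 : Tame (fun t : ℝ => t ^ 2) fun t =>
        s * (p + k : ℕ) * t ^ (p + k - 1) - t ^ (p + k + 1) :=
      ((tame_id.pow _).const_mul _).sub sq_nonneg (tame_id.pow _)
    have h2 := ((tame_localField c o).pow k).const_mul (k.factorial : ℝ)⁻¹
    have := ((tame_snd h2).mul (tame_fst h1)).mul (tame_snd hgt)
    convert this using 2
    ring
  have hsum := hasSum_integral_of_dominated_convergence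
    (μ := ρ.prod (Measure.pi fun _ : ι => ρ))
    (F := fun (k : ℕ) q => localField c o q.2 ^ k / (k.factorial : ℝ) *
      (s * (p + k : ℕ) * q.1 ^ (p + k - 1) - q.1 ^ (p + k + 1)) * g q.2)
    (f := fun q => (s * (p * q.1 ^ (p - 1) + localField c o q.2 * q.1 ^ p) - q.1 ^ (p + 1)) *
        Real.exp (localField c o q.2 * q.1) * g q.2)
    (fun k q => B (localField c o q.2) q.1 k * |g q.2|)
    (fun k => (hterm k).meas.aestronglyMeasurable)
    (fun k => ae_of_all _ fun q => by
      simp only [hB]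
      rw [Real.norm_eq_abs, abs_mul, abs_mul, abs_div, abs_pow, Nat.abs_cast]
      refine mul_le_mul_of_nonneg_right (mul_le_mul_of_nonneg_left ?_ (by positivity))
        (abs_nonneg _)
      refine (abs_sub _ _).trans (le_of_eq ?_)
      rw [abs_mul, abs_mul, abs_pow, abs_pow, abs_of_nonneg hs0, Nat.abs_cast])
    (ae_of_all _ fun q => ((hBsum _ _).mul_right _).summable)
    (by
      have e : (fun q : ℝ × (ι → ℝ) => ∑' k : ℕ, B (localField c o q.2) q.1 k * |g q.2|) = _ :=
        funext fun q => ((hBsum (localField c o q.2) q.1).mul_right |g q.2|).tsum_eq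
      rw [e]
      have h1 : Tame (fun q : ℝ × (ι → ℝ) => q.1 ^ 2 + energy q.2) fun q => |q.1| :=
        tame_fst tame_id.abs
      have h2 : Tame (fun q : ℝ × (ι → ℝ) => q.1 ^ 2 + energy q.2) fun q =>
          |localField c o q.2| := tame_snd (tame_localField c o).abs
      exact (((((h1.pow _).const_mul (p : ℝ)).add hE.nonneg (h2.mul (h1.pow _))).const_mul s).add
        hE.nonneg (h1.pow _) |>.mul (tame_exp_abs_localField c o) |>.mul
          (tame_snd hgt.abs)).integrable hE)
    (ae_of_all _ fun q => (hasSum_gaussian_parts s (localField c o q.2) q.1 p).mul_right _)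
  -- Each term factorizes: the integral over the spin at o is nonnegative by the moment recursion
  -- with j = p + k, and the one over the other spins by Griffiths' first inequality, the local
  -- field being a positive polynomial.
  refine hsum.nonneg fun k => ?_
  have e3 : ∀ q : ℝ × (ι → ℝ), localField c o q.2 ^ k / (k.factorial : ℝ) *
      (s * (p + k : ℕ) * q.1 ^ (p + k - 1) - q.1 ^ (p + k + 1)) * g q.2 =
      (s * (p + k : ℕ) * q.1 ^ (p + k - 1) - q.1 ^ (p + k + 1)) *
        ((k.factorial : ℝ)⁻¹ * (localField c o q.2 ^ k * g q.2)) := fun q => by ring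
  simp only [e3]
  rw [integral_prod_mul (fun t : ℝ => s * (p + k : ℕ) * t ^ (p + k - 1) - t ^ (p + k + 1))
    fun τ : ι → ℝ => (k.factorial : ℝ)⁻¹ * (localField c o τ ^ k * g τ), integral_const_mul]
  refine mul_nonneg ?_ (mul_nonneg (by positivity) ?_)
  · rw [integral_sub (((tame_id.pow _).const_mul _).integrable hρ.expInt)
      ((tame_id.pow _).integrable hρ.expInt), integral_const_mul]
    have := hρ.moment (p + k)
    rw [mul_comm (((p + k : ℕ) : ℝ))] at this
    linarith
  · have hl : PosPoly (reflGen id fun _ : ι => False) (localField c o) :=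
      PosPoly.sum _ fun y _ => (posPoly_coord_id y).const_mul (hc o y)
    have := integral_posPoly_nonneg (c := delSite c o) hρ.toIsEvenSpin
      (fun x y => by unfold delSite; split_ifs; exacts [le_rfl, hc x y])
      (fun x y => by unfold delSite; simp only [hs x y, or_comm]) ((hl.pow k).mul hf)
    simpa only [hg, mul_assoc] using this

/-- A bound on the second moment of a spin in terms of that of the local field. -/
theorem integral_sq_le_localField (hρ : IsEvenSpin ρ) (hs : ∀ x y, c x y = c y x) {o : ι}
    (ho : c o o = 0) {δ : ℝ} (hδ : 0 < δ) :
    0 ≤ ∫ τ, (δ ^ 2 * localField c o τ ^ 2 + (∫ t, t ^ 2 * Real.exp (δ⁻¹ * t ^ 2) ∂ρ) - τ o ^ 2) *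
      Real.exp (quad c τ) ∂(Measure.pi fun _ : ι => ρ) := by
  classical
  set C := ∫ t, t ^ 2 * Real.exp (δ⁻¹ * t ^ 2) ∂ρ with hC
  have hC0 : 0 ≤ C := integral_nonneg fun t => by positivity
  have hmp := measurePreserving_update (ρ := ρ) o
  have hh := measurable_localField c o
  have hm : Measurable fun τ : ι → ℝ => (δ ^ 2 * localField c o τ ^ 2 + C - τ o ^ 2) *
      Real.exp (quad c τ) := by
    have h3 := measurable_quad c
    fun_prop
  have hE := hρ.expInt.prod (expInt_energy (ι := ι) hρ)
  rw [← hmp.map_eq, integral_map hmp.measurable.aemeasurable hm.aestronglyMeasurable]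
  have e : ∀ q : ℝ × (ι → ℝ), (δ ^ 2 * localField c o (Function.update q.2 o q.1) ^ 2 + C -
      Function.update q.2 o q.1 o ^ 2) * Real.exp (quad c (Function.update q.2 o q.1)) =
      Real.exp (quad (delSite c o) q.2) * ((δ ^ 2 * localField c o q.2 ^ 2 + C - q.1 ^ 2) *
        Real.exp (localField c o q.2 * q.1)) := by
    intro q
    rw [localField_update o ho, quad_update hs ho, Real.exp_add]
    simp only [Function.update_self]
    ring
  simp only [e]
  have hexp : Tame (fun q : ℝ × (ι → ℝ) => q.1 ^ 2 + energy q.2)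
      fun q => Real.exp (localField c o q.2 * q.1) :=
    Tame.exp (Finset.sum_nonneg fun y (_ : y ∈ Finset.univ) => abs_nonneg (c o y)) (by fun_prop)
      fun q => (le_abs_self _).trans (by rw [abs_mul]; exact abs_localField_mul_le c o q)
  have hl := tame_snd (tame_localField c o)
  rw [integral_prod_symm]
  · refine integral_nonneg fun τ => ?_
    simp only
    rw [integral_const_mul]
    refine mul_nonneg (Real.exp_pos _).le ?_
    set h := localField c o τ
    have hexp1 : ∀ s : ℝ, Integrable (fun t => Real.exp (s * t)) ρ := fun s => by
      by_contra hcon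
      have := one_le_integral_exp hρ s
      rw [integral_undef hcon] at this
      linarith
    have hC' : Integrable (fun t : ℝ => t ^ 2 * Real.exp (δ⁻¹ * t ^ 2)) ρ :=
      ((tame_id.pow 2).mul (Tame.exp (inv_nonneg.2 hδ.le) (by fun_prop) fun t => le_rfl)).integrable
        hρ.expInt
    have h2 : C ≤ ∫ t, C * Real.exp (h * t) ∂ρ := by
      rw [integral_const_mul]
      nlinarith [one_le_integral_exp hρ h]
    have hpt : ∀ t : ℝ, C * Real.exp (h * t) - t ^ 2 * Real.exp (δ⁻¹ * t ^ 2) ≤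
        (δ ^ 2 * h ^ 2 + C - t ^ 2) * Real.exp (h * t) := fun t => by
      -- Either t² ≤ δ² h², or |h| ≤ |t| / δ and the field can be absorbed in the gaussian weight, h
      -- t ≤ t² / δ. The constant C may then be compared with C exp(h t), because exp(h t) has mean
      -- at least 1.
      have h3 : t ^ 2 * Real.exp (h * t) ≤
          δ ^ 2 * h ^ 2 * Real.exp (h * t) + t ^ 2 * Real.exp (δ⁻¹ * t ^ 2) := by
        rcases le_total (t ^ 2) (δ ^ 2 * h ^ 2) with h4 | h4
        · have := mul_le_mul_of_nonneg_right h4 (Real.exp_pos (h * t)).le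
          have : 0 ≤ t ^ 2 * Real.exp (δ⁻¹ * t ^ 2) := by positivity
          linarith
        · have h5 : h * t ≤ δ⁻¹ * t ^ 2 := by
            rw [inv_mul_eq_div, le_div_iff₀ hδ]
            have h6 : δ * |h| ≤ |t| := by
              rw [← abs_of_pos hδ, ← abs_mul]
              exact sq_le_sq.1 (by rw [mul_pow]; exact h4)
            have h7 := mul_le_mul_of_nonneg_right h6 (abs_nonneg t)
            rw [← sq, sq_abs] at h7
            have h8 : h * t ≤ |h| * |t| := by rw [← abs_mul]; exact le_abs_self _
            nlinarith [mul_le_mul_of_nonneg_left h8 hδ.le]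
          have h6 := mul_le_mul_of_nonneg_left (Real.exp_le_exp.2 h5) (sq_nonneg t)
          have : 0 ≤ δ ^ 2 * h ^ 2 * Real.exp (h * t) := by positivity
          linarith
      linarith
    have hint : Integrable (fun t : ℝ => (δ ^ 2 * h ^ 2 + C - t ^ 2) * Real.exp (h * t)) ρ := by
      have h1 : Integrable (fun t : ℝ => t ^ 2 * Real.exp (h * t)) ρ := by
        refine ((hexp1 h).const_mul (δ ^ 2 * h ^ 2) |>.add hC').mono'
          (by fun_prop) (ae_of_all _ fun t => ?_)
        rw [Real.norm_eq_abs, abs_of_nonneg (by positivity)]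
        have := hpt t
        simp only [Pi.add_apply]
        linarith
      convert ((hexp1 h).const_mul (δ ^ 2 * h ^ 2 + C)).sub h1 using 1
      funext t; simp; ring
    have := integral_mono (((hexp1 h).const_mul C).sub hC') hint hpt
    simp only [Pi.sub_apply] at this
    rw [integral_sub ((hexp1 h).const_mul C) hC'] at this
    linarith
  · refine ((tame_snd (tame_exp_quad _)).mul (Tame.mul ?_ hexp)).integrable hE
    exact (((hl.pow 2).const_mul _).add hE.nonneg (Tame.const _ C)).sub hE.nonneg
      (tame_fst (tame_id.pow 2))

end Resampling

/-! ### Pair correlations of finite systems -/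

section Corr

variable {ι : Type*} [Fintype ι] {ρ : Measure ℝ} [IsProbabilityMeasure ρ] {c : ι → ι → ℝ}
  {θ : ι → ι} {P : ι → Prop} {F G : (ι → ℝ) → ℝ}

theorem gibbsMean_nonneg_of_integral (h : 0 ≤ ∫ τ, F τ * Real.exp (quad c τ)
    ∂(Measure.pi fun _ : ι => ρ)) : 0 ≤ gibbsMean ρ c F :=
  div_nonneg h (integral_nonneg fun _ => (Real.exp_pos _).le)

theorem gibbsMean_const (hρ : IsEvenSpin ρ) (a : ℝ) : gibbsMean ρ c (fun _ => a) = a := by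
  unfold gibbsMean
  rw [integral_const_mul, mul_div_assoc, div_self (partition_pos hρ c).ne', mul_one]

theorem gibbsMean_add (hρ : IsEvenSpin ρ) (hF : Tame energy F) (hG : Tame energy G) :
    gibbsMean ρ c (fun τ => F τ + G τ) = gibbsMean ρ c F + gibbsMean ρ c G := by
  unfold gibbsMean
  simp only [add_mul]
  rw [integral_add ((hF.mul (tame_exp_quad c)).integrable_pi hρ)
    ((hG.mul (tame_exp_quad c)).integrable_pi hρ), add_div]

theorem gibbsMean_const_mul (a : ℝ) (F : (ι → ℝ) → ℝ) :
    gibbsMean ρ c (fun τ => a * F τ) = a * gibbsMean ρ c F := by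
  unfold gibbsMean
  simp only [mul_assoc]
  rw [integral_const_mul, mul_div_assoc]

theorem gibbsMean_sub (hρ : IsEvenSpin ρ) (hF : Tame energy F) (hG : Tame energy G) :
    gibbsMean ρ c (fun τ => F τ - G τ) = gibbsMean ρ c F - gibbsMean ρ c G := by
  have h := gibbsMean_add (c := c) hρ hF (hG.const_mul (-1))
  rw [gibbsMean_const_mul] at h
  simpa [sub_eq_add_neg] using h

theorem gibbsMean_sum (hρ : IsEvenSpin ρ) {κ : Type*} (s : Finset κ) {F : κ → (ι → ℝ) → ℝ}
    (hF : ∀ i, Tame energy (F i)) :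
    gibbsMean ρ c (fun τ => ∑ i ∈ s, F i τ) = ∑ i ∈ s, gibbsMean ρ c (F i) := by
  classical
  induction s using Finset.induction_on with
  | empty => simp [gibbsMean]
  | insert a s ha ih =>
    simp only [Finset.sum_insert ha]
    rw [gibbsMean_add hρ (hF a) (Tame.sum energy_nonneg _ fun i _ => hF i), ih]

/-- The correlation of two spins. -/
noncomputable def corr (ρ : Measure ℝ) (c : ι → ι → ℝ) (x y : ι) : ℝ :=
  gibbsMean ρ c fun τ => τ x * τ y

theorem tame_pair (x y : ι) : Tame energy fun τ : ι → ℝ => τ x * τ y :=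
  (tame_coord x).mul (tame_coord y)

theorem corr_comm (x y : ι) : corr ρ c x y = corr ρ c y x := by
  unfold corr; simp only [mul_comm]

theorem corr_nonneg (hρ : IsEvenSpin ρ) (hc : ∀ x y, 0 ≤ c x y) (hs : ∀ x y, c x y = c y x)
    (x y : ι) : 0 ≤ corr ρ c x y :=
  gibbsMean_nonneg_of_integral
    (integral_posPoly_nonneg hρ hc hs ((posPoly_coord_id x).mul (posPoly_coord_id y)))

theorem corr_reflection_le (hρ : IsEvenSpin ρ) (hr : IsReflection c θ P) {u y : ι}
    (hu : ¬P (θ u)) (hy : ¬P (θ y)) : corr ρ c u (θ y) ≤ corr ρ c u y := by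
  have h := gibbsMean_nonneg_of_integral (integral_mul_sub_reflection_nonneg hρ hr hu hy)
  simp only [mul_sub] at h
  rw [gibbsMean_sub hρ (tame_pair u y) (tame_pair u (θ y))] at h
  exact sub_nonneg.1 h

theorem sum_corr_reflection_nonneg (hρ : IsEvenSpin ρ) (hr : IsReflection c θ P) (s : Finset ι)
    (hs : ∀ x ∈ s, ¬P (θ x)) (v : ι → ℝ) :
    0 ≤ ∑ x ∈ s, ∑ y ∈ s, v x * v y * corr ρ c x (θ y) := by
  have hF : Tame energy fun τ : ι → ℝ => ∑ x ∈ s, v x * τ x :=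
    Tame.sum energy_nonneg _ fun x _ => (tame_coord x).const_mul _
  have h := gibbsMean_nonneg_of_integral (integral_mul_reflection_nonneg hρ hr hF fun τ τ' h =>
    Finset.sum_congr rfl fun x hx => by rw [h x (hs x hx)])
  convert h using 1
  have e : (fun τ : ι → ℝ => (∑ x ∈ s, v x * τ x) * ∑ x ∈ s, v x * τ (θ x)) =
      fun τ => ∑ x ∈ s, ∑ y ∈ s, v x * v y * (τ x * τ (θ y)) := by
    funext τ
    rw [Finset.sum_mul_sum]
    exact Finset.sum_congr rfl fun x _ => Finset.sum_congr rfl fun y _ => by ring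
  rw [e, gibbsMean_sum hρ _ fun x => Tame.sum energy_nonneg _ fun y _ =>
    (tame_pair x (θ y)).const_mul _]
  refine Finset.sum_congr rfl fun x _ => ?_
  rw [gibbsMean_sum hρ _ fun y => (tame_pair x (θ y)).const_mul _]
  exact Finset.sum_congr rfl fun y _ => (gibbsMean_const_mul _ _).symm

theorem corr_gaussian_domination (hρ : IsEvenSpin ρ) (hr : IsReflection c θ P) {o : ι} (ho : P o)
    (ha : 0 < c o (θ o)) :
    c o (θ o) * (corr ρ c o o + corr ρ c (θ o) (θ o) - 2 * corr ρ c o (θ o)) ≤ 1 := by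
  have h := gibbsMean_nonneg_of_integral (integral_gaussian_domination hρ hr ho ha)
  have e : (fun τ : ι → ℝ => 1 - c o (θ o) * (τ o - τ (θ o)) ^ 2) = fun τ =>
      1 - c o (θ o) * ((τ o * τ o + τ (θ o) * τ (θ o)) - 2 * (τ o * τ (θ o))) := by
    funext τ; ring
  have h2 := (tame_pair o o).add energy_nonneg (tame_pair (θ o) (θ o))
  have h3 := (tame_pair o (θ o)).const_mul 2
  rw [e, gibbsMean_sub hρ (Tame.const _ 1) ((h2.sub energy_nonneg h3).const_mul _),
    gibbsMean_const hρ, gibbsMean_const_mul, gibbsMean_sub hρ h2 h3, gibbsMean_const_mul,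
    gibbsMean_add hρ (tame_pair o o) (tame_pair (θ o) (θ o))] at h
  exact sub_nonneg.1 h

theorem gibbsMean_localField_mul (hρ : IsEvenSpin ρ) (o x : ι) :
    gibbsMean ρ c (fun τ => localField c o τ * τ x) = ∑ y, c o y * corr ρ c y x := by
  have e : (fun τ : ι → ℝ => localField c o τ * τ x) = fun τ => ∑ y, c o y * (τ y * τ x) := by
    funext τ
    rw [localField, Finset.sum_mul]
    exact Finset.sum_congr rfl fun y _ => mul_assoc _ _ _
  rw [e, gibbsMean_sum hρ _ fun y => (tame_pair y x).const_mul _]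
  exact Finset.sum_congr rfl fun y _ => gibbsMean_const_mul _ _

/-- Integration by parts with p = 0 and f = τ x, which is why x must differ from o. In
`corr_self_le_sum` one takes p = 1 and f = 1; differentiating the factor τ o produces the additional
1. -/
theorem corr_le_sum (hρ : IsGaussianSpin ρ) (hc : ∀ x y, 0 ≤ c x y) (hs : ∀ x y, c x y = c y x)
    {o x : ι} (ho : c o o = 0) (hx : x ≠ o) :
    corr ρ c o x ≤ (∫ t, t ^ 2 ∂ρ) * ∑ y, c o y * corr ρ c y x := by
  have h := gibbsMean_nonneg_of_integral (integral_parts_nonneg hρ hc hs ho 0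
    (posPoly_coord_id x) fun τ τ' h => h x hx)
  have e : (fun τ : ι → ℝ => ((∫ t, t ^ 2 ∂ρ) * (((0 : ℕ) : ℝ) * τ o ^ (0 - 1) +
      localField c o τ * τ o ^ 0) - τ o ^ (0 + 1)) * τ x) =
      fun τ => (∫ t, t ^ 2 ∂ρ) * (localField c o τ * τ x) - τ o * τ x := by
    funext τ; simp; ring
  rw [e, gibbsMean_sub hρ.toIsEvenSpin (((tame_localField c o).mul (tame_coord x)).const_mul _)
    (tame_pair o x), gibbsMean_const_mul, gibbsMean_localField_mul hρ.toIsEvenSpin] at h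
  exact sub_nonneg.1 h

theorem corr_self_le_sum (hρ : IsGaussianSpin ρ) (hc : ∀ x y, 0 ≤ c x y)
    (hs : ∀ x y, c x y = c y x) {o : ι} (ho : c o o = 0) :
    corr ρ c o o ≤ (∫ t, t ^ 2 ∂ρ) * (1 + ∑ y, c o y * corr ρ c y o) := by
  have h := gibbsMean_nonneg_of_integral (integral_parts_nonneg hρ hc hs ho 1
    (PosPoly.const _ zero_le_one) fun τ τ' h => rfl)
  have e : (fun τ : ι → ℝ => ((∫ t, t ^ 2 ∂ρ) * (((1 : ℕ) : ℝ) * τ o ^ (1 - 1) +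
      localField c o τ * τ o ^ 1) - τ o ^ (1 + 1)) * 1) =
      fun τ => (∫ t, t ^ 2 ∂ρ) * (1 + localField c o τ * τ o) - τ o * τ o := by
    funext τ; simp; ring
  have ht := (tame_localField c o).mul (tame_coord o)
  rw [e, gibbsMean_sub hρ.toIsEvenSpin (((Tame.const _ 1).add energy_nonneg ht).const_mul _)
    (tame_pair o o), gibbsMean_const_mul, gibbsMean_add hρ.toIsEvenSpin (Tame.const _ 1) ht,
    gibbsMean_const hρ.toIsEvenSpin, gibbsMean_localField_mul hρ.toIsEvenSpin] at h
  exact sub_nonneg.1 h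

theorem corr_sq_le (x y : ι) (hρ : IsEvenSpin ρ) :
    corr ρ c x y ≤ (corr ρ c x x + corr ρ c y y) / 2 := by
  have h : 0 ≤ gibbsMean ρ c fun τ => τ x * τ x + τ y * τ y - 2 * (τ x * τ y) :=
    gibbsMean_nonneg_of_integral (integral_nonneg fun τ =>
      mul_nonneg (by nlinarith [sq_nonneg (τ x - τ y)]) (Real.exp_pos _).le)
  rw [gibbsMean_sub hρ ((tame_pair x x).add energy_nonneg (tame_pair y y))
    ((tame_pair x y).const_mul _), gibbsMean_add hρ (tame_pair x x) (tame_pair y y),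
    gibbsMean_const_mul] at h
  unfold corr
  linarith

/-- The second moments are bounded uniformly in the size of the system. -/
theorem corr_self_le (hρ : IsEvenSpin ρ) (hc : ∀ x y, 0 ≤ c x y) (hs : ∀ x y, c x y = c y x)
    (hd : ∀ x, c x x = 0) {D : ℝ} (hD : 0 < D) (hcD : ∀ x, ∑ y, c x y ≤ D) (x : ι) :
    corr ρ c x x ≤ 2 * ∫ t, t ^ 2 * Real.exp ((1 / (2 * D))⁻¹ * t ^ 2) ∂ρ := by
  set C := ∫ t, t ^ 2 * Real.exp ((1 / (2 * D))⁻¹ * t ^ 2) ∂ρ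
  have hC0 : 0 ≤ C := integral_nonneg fun t => by positivity
  have : Nonempty ι := ⟨x⟩
  -- Take a site whose second moment M is largest. By Cauchy-Schwarz the local field there has
  -- second moment at most D² M, and δ = 1 / (2 D) makes its contribution M / 4, which is absorbed:
  -- M ≤ M / 4 + C.
  obtain ⟨z, hz⟩ := Finite.exists_max fun x => corr ρ c x x
  refine (hz x).trans ?_
  have h := gibbsMean_nonneg_of_integral (integral_sq_le_localField hρ hs (hd z)
    (show 0 < 1 / (2 * D) by positivity))
  have hlt := (tame_localField c z).pow 2
  have e : (fun τ : ι → ℝ => (1 / (2 * D)) ^ 2 * localField c z τ ^ 2 + C - τ z ^ 2) =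
      fun τ => (1 / (2 * D)) ^ 2 * localField c z τ ^ 2 + C - τ z * τ z := by
    funext τ; ring
  rw [e, gibbsMean_sub hρ ((hlt.const_mul _).add energy_nonneg (Tame.const _ C)) (tame_pair z z),
    gibbsMean_add hρ (hlt.const_mul _) (Tame.const _ C), gibbsMean_const hρ,
    gibbsMean_const_mul] at h
  have h1 : gibbsMean ρ c (fun τ => localField c z τ ^ 2) ≤ D ^ 2 * corr ρ c z z := by
    have h2 : 0 ≤ gibbsMean ρ c fun τ =>
        D * (∑ y, c z y * (τ y * τ y)) - localField c z τ ^ 2 := by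
      refine gibbsMean_nonneg_of_integral (integral_nonneg fun τ =>
        mul_nonneg (sub_nonneg.2 ?_) (Real.exp_pos _).le)
      have h3 := Finset.sum_sq_le_sum_mul_sum_of_sq_le_mul Finset.univ (r := fun y => c z y * τ y)
        (f := fun y => c z y) (g := fun y => c z y * (τ y * τ y)) (fun y _ => hc z y)
        (fun y _ => mul_nonneg (hc z y) (mul_self_nonneg _)) (fun y _ => le_of_eq (by ring))
      refine h3.trans (mul_le_mul_of_nonneg_right (hcD z) ?_)
      exact Finset.sum_nonneg fun y _ => mul_nonneg (hc z y) (mul_self_nonneg _)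
    have ht : Tame energy fun τ : ι → ℝ => ∑ y, c z y * (τ y * τ y) :=
      Tame.sum energy_nonneg _ fun y _ => (tame_pair y y).const_mul _
    rw [gibbsMean_sub hρ (ht.const_mul D) hlt, gibbsMean_const_mul,
      gibbsMean_sum hρ _ fun y => (tame_pair y y).const_mul _] at h2
    have h4 : ∑ y, gibbsMean ρ c (fun τ => c z y * (τ y * τ y)) ≤ D * corr ρ c z z := by
      calc _ = ∑ y, c z y * corr ρ c y y :=
            Finset.sum_congr rfl fun y _ => gibbsMean_const_mul _ _
        _ ≤ ∑ y, c z y * corr ρ c z z :=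
            Finset.sum_le_sum fun y _ => mul_le_mul_of_nonneg_left (hz y) (hc z y)
        _ ≤ _ := by
            rw [← Finset.sum_mul]
            exact mul_le_mul_of_nonneg_right (hcD z) (corr_nonneg hρ hc hs z z)
    nlinarith [mul_le_mul_of_nonneg_left h4 hD.le]
  have h5 : (1 / (2 * D)) ^ 2 * gibbsMean ρ c (fun τ => localField c z τ ^ 2) ≤
      1 / 4 * corr ρ c z z := by
    refine (mul_le_mul_of_nonneg_left h1 (by positivity)).trans (le_of_eq ?_)
    field_simp
    ring
  change 0 ≤ _ + C - corr ρ c z z at h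
  linarith

theorem integral_coord_sq (x : ι) :
    ∫ τ, τ x ^ 2 ∂(Measure.pi fun _ : ι => ρ) = ∫ t, t ^ 2 ∂ρ := by
  have h := measurePreserving_eval (fun _ : ι => ρ) x
  conv_rhs => rw [← h.map_eq]
  rw [integral_map h.measurable.aemeasurable (by fun_prop)]

theorem le_corr_self (hρ : IsEvenSpin ρ) (hc : ∀ x y, 0 ≤ c x y) (x : ι) :
    ∫ t, t ^ 2 ∂ρ ≤ corr ρ c x x := by
  have h := gibbsMean_mono (c := fun _ _ => 0) (c' := c) hρ (fun _ _ => le_rfl) (fun _ _ => rfl) hc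
    x x
  refine le_trans (le_of_eq ?_) h
  simp only [gibbsMean, quad, zero_mul, Finset.sum_const_zero, mul_zero, Real.exp_zero, mul_one]
  simp only [← sq, integral_coord_sq]
  simp

/-- A lower bound for nearest-neighbour correlations. -/
theorem corr_ge_of_edge (hρ : IsEvenSpin ρ) (hc : ∀ x y, 0 ≤ c x y) (hs : ∀ x y, c x y = c y x)
    {o x : ι} (hx : x ≠ o) :
    c o x * (∫ t, t ^ 2 ∂ρ) ^ 2 / (1 + (c o x * ∫ t, t ^ 2 ∂ρ) ^ 2) ≤ corr ρ c o x := by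
  classical
  set κ := c o x with hκ
  set s := ∫ t, t ^ 2 ∂ρ with hsd
  have hκ0 : 0 ≤ κ := hc o x
  -- By Griffiths' second inequality all bonds but the one from o to x may be dropped; a two-spin
  -- computation remains.
  set c₀ : ι → ι → ℝ := fun u v => if (u = o ∧ v = x) ∨ (u = x ∧ v = o) then κ else 0 with hc₀
  have h := gibbsMean_mono (c := c₀) (c' := c) hρ
    (fun u v => by simp only [hc₀]; split_ifs; exacts [hκ0, le_rfl])
    (fun u v => by
      simp only [hc₀]; congr 1
      simp only [eq_iff_iff]; tauto)
    (fun u v => by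
      simp only [hc₀]; split_ifs with h
      · rcases h with ⟨rfl, rfl⟩ | ⟨rfl, rfl⟩
        · exact le_rfl
        · rw [hκ, hs]
      · exact hc u v) o x
  refine le_trans ?_ h
  have hq : ∀ τ : ι → ℝ, quad c₀ τ = κ * (τ o * τ x) := fun τ => by
    have h1 : ∀ u v, c₀ u v * τ u * τ v = (if u = o then (if v = x then κ * (τ o * τ x) else 0)
        else 0) + (if u = x then (if v = o then κ * (τ o * τ x) else 0) else 0) := by
      intro u v
      by_cases h1 : u = o
      · subst h1
        by_cases h2 : v = x
        · subst h2; simp [hc₀, hx.symm]; ring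
        · simp [hc₀, h2, hx.symm]
      · by_cases h3 : u = x
        · subst h3
          by_cases h2 : v = o
          · subst h2; simp [hc₀, h1]; ring
          · simp [hc₀, h1, h2]
        · simp [hc₀, h1, h3]
    unfold quad
    simp only [h1, Finset.sum_add_distrib]
    simp
    ring
  have hN := fun c : ι → ι → ℝ => ((tame_pair o x).mul (tame_exp_quad c)).integrable_pi hρ
  set N := ∫ τ, τ o * τ x * Real.exp (κ * (τ o * τ x)) ∂(Measure.pi fun _ : ι => ρ) with hNd
  set Z := ∫ τ, Real.exp (κ * (τ o * τ x)) ∂(Measure.pi fun _ : ι => ρ) with hZd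
  have hZ : 0 < Z := by
    have := partition_pos hρ c₀
    simpa only [hq] using this
  have hNi : Integrable (fun τ : ι → ℝ => τ o * τ x * Real.exp (κ * (τ o * τ x)))
      (Measure.pi fun _ : ι => ρ) := by simpa only [hq] using hN c₀
  have hZi : Integrable (fun τ : ι → ℝ => Real.exp (κ * (τ o * τ x)))
      (Measure.pi fun _ : ι => ρ) := by
    simpa only [hq] using (tame_exp_quad c₀).integrable_pi hρ
  have hmp := measurePreserving_signs (ι := ι) hρ (fun i => if i = o then -1 else 1)
    fun i => by split_ifs <;> simp
  -- Reversing the spin at o symmetrizes N into an integral of z sinh(κ z), to which y ≤ sinh y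
  -- applies.
  have hflip : N = ∫ τ, -(τ o * τ x * Real.exp (-(κ * (τ o * τ x))))
      ∂(Measure.pi fun _ : ι => ρ) := by
    rw [hNd]
    conv_lhs => rw [← hmp.map_eq]
    rw [integral_map hmp.measurable.aemeasurable (by fun_prop)]
    refine integral_congr_ae (ae_of_all _ fun τ => ?_)
    simp [hx]
  have hNi' : Integrable (fun τ : ι → ℝ => -(τ o * τ x * Real.exp (-(κ * (τ o * τ x)))))
      (Measure.pi fun _ : ι => ρ) := by
    have e : ∀ τ : ι → ℝ, quad (fun u v => -c₀ u v) τ = -(κ * (τ o * τ x)) := fun τ => by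
      rw [← hq]; simp [quad]
    have h1 := hN fun u v => -c₀ u v
    simp only [e] at h1
    exact h1.neg
  have hsq : ∫ τ, (τ o * τ x) ^ 2 ∂(Measure.pi fun _ : ι => ρ) = s ^ 2 := by
    have hmu := measurePreserving_update (ρ := ρ) o
    rw [← hmu.map_eq, integral_map hmu.measurable.aemeasurable (by fun_prop)]
    simp only [Function.update_self, Function.update_of_ne hx, mul_pow]
    rw [integral_prod_mul (fun t : ℝ => t ^ 2) fun τ : ι → ℝ => τ x ^ 2, integral_coord_sq, sq s]
  have hNlow : κ * s ^ 2 ≤ N := by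
    have h1 : ∫ τ, 2 * κ * (τ o * τ x) ^ 2 ∂(Measure.pi fun _ : ι => ρ) ≤ N + N := by
      nth_rewrite 2 [hflip]
      rw [hNd, ← integral_add hNi hNi']
      refine integral_mono ((((tame_pair o x).pow 2).const_mul _).integrable_pi hρ)
        (hNi.add hNi') fun τ => ?_
      simp only
      set z := τ o * τ x
      have hy : ∀ y : ℝ, 0 ≤ y → 2 * y ≤ Real.exp y - Real.exp (-y) := fun y hy => by
        have := Real.self_le_sinh_iff.2 hy
        rw [Real.sinh_eq] at this
        linarith
      have key : 2 * κ * z ^ 2 ≤ z * (Real.exp (κ * z) - Real.exp (-(κ * z))) := by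
        rcases le_total 0 z with hz | hz
        · have := mul_le_mul_of_nonneg_left (hy (κ * z) (by positivity)) hz
          linarith [this]
        · have := mul_le_mul_of_nonneg_left (hy (κ * -z) (mul_nonneg hκ0 (by linarith)))
            (show 0 ≤ -z by linarith)
          rw [show κ * -z = -(κ * z) by ring, neg_neg] at this
          linarith
      linarith
    rw [integral_const_mul, hsq] at h1
    linarith
  have hZup : Z ≤ 1 + κ * N := by
    have h1 : Z ≤ ∫ τ, (1 + κ * (τ o * τ x * Real.exp (κ * (τ o * τ x))))
        ∂(Measure.pi fun _ : ι => ρ) := by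
      refine integral_mono hZi ((integrable_const _).add (hNi.const_mul _)) fun τ => ?_
      simp only
      set z := κ * (τ o * τ x) with hz
      have h1 := Real.add_one_le_exp (-z)
      have h2 := mul_le_mul_of_nonneg_right h1 (Real.exp_pos z).le
      rw [← Real.exp_add, neg_add_cancel, Real.exp_zero] at h2
      rw [← mul_assoc, ← hz]
      linarith
    rw [integral_add (integrable_const _) (hNi.const_mul _), integral_const_mul] at h1
    simpa using h1
  simp only [gibbsMean, hq]
  change _ ≤ N / Z
  -- From Z ≤ 1 + κ N the quotient is at least N / (1 + κ N), which increases with N, so κ s² may be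
  -- inserted for N.
  rw [div_le_div_iff₀ (by positivity) hZ]
  have h1 : κ * s ^ 2 * Z ≤ κ * s ^ 2 * (1 + κ * N) :=
    mul_le_mul_of_nonneg_left hZup (by positivity)
  nlinarith

end Corr

/-! ### The Griffiths-Simon class satisfies the gaussian moment recursion -/

section Ising


variable {V : Type*} [Fintype V] [DecidableEq V]

/-- The sign of a spin as a real number. -/
def sgn (u : ℤˣ) : ℝ := ((u : ℤ) : ℝ)

theorem sgn_mul (u v : ℤˣ) : sgn (u * v) = sgn u * sgn v := by simp [sgn]

theorem sgn_eq (u : ℤˣ) : sgn u = 1 ∨ sgn u = -1 := by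
  rcases Int.units_eq_one_or u with rfl | rfl <;> simp [sgn]

theorem sgn_mul_self (u : ℤˣ) : sgn u * sgn u = 1 := by
  rcases sgn_eq u with h | h <;> rw [h] <;> norm_num

/-- The sum of a monomial over all configurations factorizes over the sites, with factor 2 or 0
according to the parity of the exponent. -/
theorem sum_posPoly_nonneg {f : (V → ℤˣ) → ℝ}
    (hf : PosPoly (fun v (σ : V → ℤˣ) => sgn (σ v)) f) : 0 ≤ ∑ σ, f σ := by
  classical
  obtain ⟨p, hp, h⟩ := hf
  simp only [h, MvPolynomial.eval_eq']
  rw [Finset.sum_comm]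
  refine Finset.sum_nonneg fun m _ => ?_
  rw [← Finset.mul_sum]
  refine mul_nonneg (hp m) ?_
  rw [← Fintype.prod_sum (fun v (u : ℤˣ) => sgn u ^ m v)]
  refine Finset.prod_nonneg fun v _ => ?_
  have : (Finset.univ : Finset ℤˣ) = {1, -1} := by decide
  rw [this, Finset.sum_pair (by decide)]
  rcases neg_one_pow_eq_or ℝ (m v) with h | h <;> simp [sgn, h]

theorem posPoly_prod {X κ ι : Type*} {g : κ → X → ℝ} {F : ι → X → ℝ} (s : Finset ι)
    (h : ∀ i ∈ s, PosPoly g (F i)) : PosPoly g fun x => ∏ i ∈ s, F i x := by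
  classical
  induction s using Finset.induction_on with
  | empty => simpa using PosPoly.const g zero_le_one
  | insert a s ha ih =>
    simp only [Finset.prod_insert ha]
    exact (h a (by simp)).mul (ih fun i hi => h i (by simp [hi]))

/-- The Boltzmann weight of an Ising configuration. -/
noncomputable def isingWeight (K : V → V → ℝ) (σ : V → ℤˣ) : ℝ :=
  Real.exp (∑ n, ∑ m, K n m * sgn (σ n) * sgn (σ m))

/-- The two coefficients of the expansion of a pair of replica bonds in the spins of the first
replica. -/
noncomputable def bondA (K : V → V → ℝ) (q : V → ℤˣ) (e : V × V) : ℝ :=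
  1 + (Real.cosh (2 * K e.1 e.2) - 1) / 2 * (1 + sgn (q e.1) * sgn (q e.2))

noncomputable def bondB (K : V → V → ℝ) (q : V → ℤˣ) (e : V × V) : ℝ :=
  Real.sinh (2 * K e.1 e.2) / 2 * (1 + sgn (q e.1) * sgn (q e.2))

theorem isingWeight_mul (K : V → V → ℝ) (σ q : V → ℤˣ) :
    isingWeight K σ * isingWeight K (σ * q) =
      ∏ e : V × V, (bondB K q e * (sgn (σ e.1) * sgn (σ e.2)) + bondA K q e) := by
  unfold isingWeight
  rw [← Real.exp_add, ← Fintype.sum_prod_type', ← Fintype.sum_prod_type', ← Finset.sum_add_distrib,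
    Real.exp_sum]
  refine Finset.prod_congr rfl fun e _ => ?_
  simp only [Pi.mul_apply, sgn_mul, bondA, bondB]
  set k := K e.1 e.2
  have h1 : ∀ a b c d : ℝ, k * a * b + k * (a * c) * (b * d) = k * (a * b) * (1 + c * d) :=
    fun a b c d => by ring
  rw [h1]
  have h2 : ∀ u v : ℤˣ, sgn u * sgn v = 1 ∨ sgn u * sgn v = -1 := fun u v => by
    rw [← sgn_mul]; exact sgn_eq _
  rcases h2 (q e.1) (q e.2) with h | h <;> rw [h]
  · rcases h2 (σ e.1) (σ e.2) with h' | h' <;> rw [h']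
    · rw [show k * 1 * (1 + 1) = 2 * k by ring, ← Real.cosh_add_sinh]; ring
    · rw [show k * -1 * (1 + 1) = -(2 * k) by ring, ← Real.cosh_sub_sinh]; ring
  · simp

/-- The gaussian inequality for ferromagnetic Ising spins. -/
theorem ising_gaussian {K : V → V → ℝ} (hK : ∀ n m, 0 ≤ K n m) (o : V) {n : ℕ}
    (p : Fin (n + 1) → V) :
    (∑ σ : V → ℤˣ, sgn (σ o) * (∏ i, sgn (σ (p i))) * isingWeight K σ) *
        (∑ σ, isingWeight K σ) ≤
      ∑ i, (∑ σ : V → ℤˣ, (∏ k, sgn (σ (p (i.succAbove k)))) * isingWeight K σ) *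
        (∑ σ : V → ℤˣ, sgn (σ o) * sgn (σ (p i)) * isingWeight K σ) := by
  classical
  -- The second replica is written as σ * q, so that the sum runs over the first replica σ and the
  -- relative configuration q.
  have hrep : ∀ f g : (V → ℤˣ) → ℝ, (∑ σ, f σ) * (∑ σ, g σ) = ∑ σ, ∑ q, f σ * g (σ * q) := by
    intro f g
    rw [Finset.sum_mul_sum]
    refine Finset.sum_congr rfl fun σ _ => ?_
    rw [← Equiv.sum_comp (Equiv.mulLeft σ)]
    rfl
  set mon : (V → ℤˣ) → ℝ := fun σ => sgn (σ o) * ∏ i, sgn (σ (p i)) with hmon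
  have hposs : ∀ v : V, PosPoly (fun v (σ : V → ℤˣ) => sgn (σ v)) fun σ => sgn (σ v) :=
    fun v => PosPoly.gen (fun v (σ : V → ℤˣ) => sgn (σ v)) v
  rw [← sub_nonneg]
  -- Expand the product over bonds in `isingWeight_mul`, S being the set of bonds that contribute a
  -- pair of spins of σ. The sums over σ and q then separate. In the relative variable the
  -- inequality reads (∑ i, q_o q_{p i}) - 1, which is not a positive polynomial by itself.
  have hE : ∑ i, (∑ σ : V → ℤˣ, (∏ k, sgn (σ (p (i.succAbove k)))) * isingWeight K σ) *
        (∑ σ : V → ℤˣ, sgn (σ o) * sgn (σ (p i)) * isingWeight K σ) -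
      (∑ σ : V → ℤˣ, mon σ * isingWeight K σ) * (∑ σ, isingWeight K σ) =
      ∑ S : Finset (V × V), (∑ σ, mon σ * ∏ e ∈ S, (sgn (σ e.1) * sgn (σ e.2))) *
        ∑ q : V → ℤˣ, ((∑ i, sgn (q o) * sgn (q (p i))) - 1) *
          ((∏ e ∈ S, bondB K q e) * ∏ e ∈ Sᶜ, bondA K q e) := by
    have h1 : ∀ S : Finset (V × V), (∑ σ, mon σ * ∏ e ∈ S, (sgn (σ e.1) * sgn (σ e.2))) *
        (∑ q : V → ℤˣ, ((∑ i, sgn (q o) * sgn (q (p i))) - 1) *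
          ((∏ e ∈ S, bondB K q e) * ∏ e ∈ Sᶜ, bondA K q e)) =
        ∑ σ, ∑ q : V → ℤˣ, mon σ * ((∑ i, sgn (q o) * sgn (q (p i))) - 1) *
          ((∏ e ∈ S, bondB K q e * (sgn (σ e.1) * sgn (σ e.2))) * ∏ e ∈ Sᶜ, bondA K q e) := by
      intro S
      rw [Finset.sum_mul_sum]
      refine Finset.sum_congr rfl fun σ _ => Finset.sum_congr rfl fun q _ => ?_
      rw [Finset.prod_mul_distrib (f := fun e => bondB K q e)]
      ring
    simp only [h1]
    rw [Finset.sum_comm]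
    simp only [hrep]
    rw [Finset.sum_comm, ← Finset.sum_sub_distrib]
    refine Finset.sum_congr rfl fun σ _ => ?_
    rw [Finset.sum_comm, ← Finset.sum_sub_distrib, Finset.sum_comm]
    refine Finset.sum_congr rfl fun q _ => ?_
    rw [← Finset.mul_sum]
    have h2 := isingWeight_mul K σ q
    rw [Fintype.prod_add] at h2
    rw [← h2]
    have h3 : ∀ i, (∏ k, sgn (σ (p (i.succAbove k)))) * isingWeight K σ *
        (sgn ((σ * q) o) * sgn ((σ * q) (p i)) * isingWeight K (σ * q)) =
        mon σ * (sgn (q o) * sgn (q (p i))) * (isingWeight K σ * isingWeight K (σ * q)) := by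
      intro i
      simp only [hmon, Pi.mul_apply, sgn_mul]
      rw [Fin.prod_univ_succAbove _ i]
      ring
    simp only [h3]
    rw [← Finset.sum_mul, ← Finset.mul_sum]
    ring
  rw [hE]
  refine Finset.sum_nonneg fun S _ => ?_
  have hM : 0 ≤ ∑ σ, mon σ * ∏ e ∈ S, (sgn (σ e.1) * sgn (σ e.2)) :=
    sum_posPoly_nonneg (((hposs o).mul (posPoly_prod _ fun i _ => hposs (p i))).mul
      (posPoly_prod _ fun e _ => (hposs e.1).mul (hposs e.2)))
  rcases hM.eq_or_lt with hM0 | hM0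
  · rw [← hM0, zero_mul]
  refine mul_nonneg hM ?_
  -- `C` is the connected component of o in the graph with edge set S.
  set C : V → Prop := fun v =>
    ∀ q : V → ℤˣ, (∀ e ∈ S, q e.1 = q e.2) → q o = q v with hC
  have hi : ∃ i, C (p i) := by
    by_contra hcon
    push Not at hcon
    -- If no p i is connected to o, reversing the component of o changes the sign of the monomial
    -- and preserves all bonds of S, so the sum over σ vanishes.
    set fl : V → ℤˣ := fun v => if C v then -1 else 1 with hfl
    have hneg : ∀ σ : V → ℤˣ, mon (fl * σ) * ∏ e ∈ S, (sgn ((fl * σ) e.1) * sgn ((fl * σ) e.2)) =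
        -(mon σ * ∏ e ∈ S, (sgn (σ e.1) * sgn (σ e.2))) := by
      intro σ
      have h1 : mon (fl * σ) = -mon σ := by
        have h2 : fl o = -1 := by simp [hfl, hC]
        have h3 : ∀ i, fl (p i) = 1 := fun i => by simp [hfl, hcon i]
        simp [hmon, h2, h3, sgn]
      have h2 : ∏ e ∈ S, (sgn ((fl * σ) e.1) * sgn ((fl * σ) e.2)) =
          ∏ e ∈ S, (sgn (σ e.1) * sgn (σ e.2)) := by
        refine Finset.prod_congr rfl fun e he => ?_
        have h3 : fl e.1 = fl e.2 := by
          have h4 : C e.1 ↔ C e.2 :=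
            ⟨fun h q hq => (h q hq).trans (hq e he), fun h q hq => (h q hq).trans (hq e he).symm⟩
          simp only [hfl, h4]
        simp only [Pi.mul_apply, sgn_mul, h3]
        linear_combination sgn (σ e.1) * sgn (σ e.2) * sgn_mul_self (fl e.2)
      rw [h1, h2, neg_mul]
    have h5 := Equiv.sum_comp (Equiv.mulLeft fl)
      fun σ => mon σ * ∏ e ∈ S, (sgn (σ e.1) * sgn (σ e.2))
    simp only [Equiv.coe_mulLeft, hneg, Finset.sum_neg_distrib] at h5
    linarith
  obtain ⟨i, hi⟩ := hi
  -- The factors `bondB` vanish unless q is constant along the bonds of S. On that set q_o = q_{p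
  -- i}, the i-th term of the sum equals 1 and cancels the -1.
  have h6 : ∀ q : V → ℤˣ, ((∑ i, sgn (q o) * sgn (q (p i))) - 1) *
      ((∏ e ∈ S, bondB K q e) * ∏ e ∈ Sᶜ, bondA K q e) =
      (∑ k, sgn (q o) * sgn (q (p (i.succAbove k)))) *
      ((∏ e ∈ S, bondB K q e) * ∏ e ∈ Sᶜ, bondA K q e) := by
    intro q
    by_cases hq : ∀ e ∈ S, q e.1 = q e.2
    · rw [Fin.sum_univ_succAbove _ i, ← hi q hq, sgn_mul_self]
      ring
    · push Not at hq
      obtain ⟨e, he, hne⟩ := hq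
      have : ∏ e ∈ S, bondB K q e = 0 := by
        refine Finset.prod_eq_zero he ?_
        have h7 : sgn (q e.1) * sgn (q e.2) = -1 := by
          rcases Int.units_eq_one_or (q e.1) with h | h <;>
            rcases Int.units_eq_one_or (q e.2) with h' | h' <;> simp_all [sgn]
        simp [bondB, h7]
      rw [this]; ring
  simp only [h6]
  have hbond : ∀ e : V × V, PosPoly (fun v (q : V → ℤˣ) => sgn (q v))
      fun q => 1 + sgn (q e.1) * sgn (q e.2) := fun e =>
    (PosPoly.const _ zero_le_one).add ((hposs e.1).mul (hposs e.2))
  refine sum_posPoly_nonneg ((PosPoly.sum _ fun k _ => (hposs o).mul (hposs _)).mul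
    ((posPoly_prod _ fun e _ => ?_).mul (posPoly_prod _ fun e _ => ?_)))
  · exact (hbond e).const_mul
      (div_nonneg (Real.sinh_nonneg_iff.2 (by linarith [hK e.1 e.2])) (by norm_num))
  · exact (PosPoly.const _ zero_le_one).add ((hbond e).const_mul
      (div_nonneg (by linarith [Real.one_le_cosh (2 * K e.1 e.2)]) (by norm_num)))

/-- Expand the power into spin products, apply `ising_gaussian` with one spin singled out, and resum
with the weights b. By relabelling the sites with `Fin.insertNthEquiv`, each of the n + 1 pairings
gives the same product. -/
theorem ising_moment {K : V → V → ℝ} (hK : ∀ n m, 0 ≤ K n m) {b : V → ℝ} (hb : ∀ v, 0 ≤ b v)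
    (n : ℕ) :
    (∑ σ : V → ℤˣ, (∑ v, b v * sgn (σ v)) ^ (n + 2) * isingWeight K σ) *
        (∑ σ, isingWeight K σ) ≤
      (n + 1) * (∑ σ : V → ℤˣ, (∑ v, b v * sgn (σ v)) ^ 2 * isingWeight K σ) *
        ∑ σ : V → ℤˣ, (∑ v, b v * sgn (σ v)) ^ n * isingWeight K σ := by
  classical
  have hpow : ∀ (n : ℕ) (σ : V → ℤˣ), (∑ v, b v * sgn (σ v)) ^ n =
      ∑ p : Fin n → V, (∏ i, b (p i)) * ∏ i, sgn (σ (p i)) := fun n σ => by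
    rw [Fintype.sum_pow]
    exact Finset.sum_congr rfl fun p _ => Finset.prod_mul_distrib
  set W : (V → ℤˣ) → ℝ := isingWeight K
  set Z := ∑ σ, W σ
  have hl : (∑ σ : V → ℤˣ, (∑ v, b v * sgn (σ v)) ^ (n + 2) * W σ) * Z =
      ∑ o, ∑ p : Fin (n + 1) → V, b o * (∏ i, b (p i)) *
        ((∑ σ : V → ℤˣ, sgn (σ o) * (∏ i, sgn (σ (p i))) * W σ) * Z) := by
    have h1 : ∀ σ : V → ℤˣ, (∑ v, b v * sgn (σ v)) ^ (n + 2) * W σ =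
        ∑ o, ∑ p : Fin (n + 1) → V, b o * (∏ i, b (p i)) *
          (sgn (σ o) * (∏ i, sgn (σ (p i))) * W σ) := fun σ => by
      rw [pow_succ', hpow, Finset.sum_mul_sum, Finset.sum_mul]
      refine Finset.sum_congr rfl fun o _ => ?_
      rw [Finset.sum_mul]
      exact Finset.sum_congr rfl fun p _ => by ring
    simp only [h1]
    rw [Finset.sum_comm, Finset.sum_mul]
    refine Finset.sum_congr rfl fun o _ => ?_
    rw [Finset.sum_comm, Finset.sum_mul]
    refine Finset.sum_congr rfl fun p _ => ?_
    rw [← Finset.mul_sum, mul_assoc]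
  have h2 : ∑ σ : V → ℤˣ, (∑ v, b v * sgn (σ v)) ^ 2 * W σ =
      ∑ o, ∑ v, b o * b v * ∑ σ : V → ℤˣ, sgn (σ o) * sgn (σ v) * W σ := by
    have h1 : ∀ σ : V → ℤˣ, (∑ v, b v * sgn (σ v)) ^ 2 * W σ =
        ∑ o, ∑ v, b o * b v * (sgn (σ o) * sgn (σ v) * W σ) := fun σ => by
      rw [sq, Finset.sum_mul_sum, Finset.sum_mul]
      refine Finset.sum_congr rfl fun o _ => ?_
      rw [Finset.sum_mul]
      exact Finset.sum_congr rfl fun p _ => by ring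
    simp only [h1]
    rw [Finset.sum_comm]
    refine Finset.sum_congr rfl fun o _ => ?_
    rw [Finset.sum_comm]
    exact Finset.sum_congr rfl fun v _ => (Finset.mul_sum _ _ _).symm
  have h3 : ∑ σ : V → ℤˣ, (∑ v, b v * sgn (σ v)) ^ n * W σ =
      ∑ p : Fin n → V, (∏ i, b (p i)) * ∑ σ : V → ℤˣ, (∏ i, sgn (σ (p i))) * W σ := by
    simp only [hpow, Finset.sum_mul]
    rw [Finset.sum_comm]
    refine Finset.sum_congr rfl fun p _ => ?_
    rw [Finset.mul_sum]
    exact Finset.sum_congr rfl fun σ _ => by ring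
  have hswap : ∀ (A : V → (Fin (n + 1) → V) → ℝ) (B : Fin (n + 1) → V → (Fin (n + 1) → V) → ℝ),
      ∑ o, ∑ p, A o p * ∑ i, B i o p = ∑ i, ∑ o, ∑ p, A o p * B i o p := by
    intro A B
    rw [Finset.sum_comm]
    simp only [Finset.mul_sum]
    conv_rhs => rw [Finset.sum_comm]
    rw [Finset.sum_comm]
    refine Finset.sum_congr rfl fun o _ => ?_
    rw [Finset.sum_comm]
  rw [hl]
  calc _ ≤ ∑ o, ∑ p : Fin (n + 1) → V, b o * (∏ i, b (p i)) *
        ∑ i, (∑ σ : V → ℤˣ, (∏ k, sgn (σ (p (i.succAbove k)))) * W σ) *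
          (∑ σ : V → ℤˣ, sgn (σ o) * sgn (σ (p i)) * W σ) := by
        refine Finset.sum_le_sum fun o _ => Finset.sum_le_sum fun p _ =>
          mul_le_mul_of_nonneg_left (ising_gaussian hK o p)
            (mul_nonneg (hb o) (Finset.prod_nonneg fun i _ => hb _))
    _ = ∑ i : Fin (n + 1), ∑ o, ∑ p : Fin (n + 1) → V, b o * (∏ i, b (p i)) *
        ((∑ σ : V → ℤˣ, (∏ k, sgn (σ (p (i.succAbove k)))) * W σ) *
          (∑ σ : V → ℤˣ, sgn (σ o) * sgn (σ (p i)) * W σ)) := by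
        exact hswap (fun o p => b o * ∏ i, b (p i)) fun i o p => _
    _ = ∑ _i : Fin (n + 1), (∑ σ : V → ℤˣ, (∑ v, b v * sgn (σ v)) ^ 2 * W σ) *
        ∑ σ : V → ℤˣ, (∑ v, b v * sgn (σ v)) ^ n * W σ := by
        refine Finset.sum_congr rfl fun i _ => ?_
        rw [h2, h3, Finset.sum_mul]
        refine Finset.sum_congr rfl fun o _ => ?_
        rw [← Equiv.sum_comp (Fin.insertNthEquiv (fun _ => V) i), Fintype.sum_prod_type,
          Finset.sum_mul]
        refine Finset.sum_congr rfl fun v _ => ?_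
        rw [Finset.mul_sum]
        refine Finset.sum_congr rfl fun p _ => ?_
        simp only [Fin.insertNthEquiv_apply, Fin.prod_univ_succAbove _ i, Fin.insertNth_apply_same,
          Fin.insertNth_apply_succAbove]
        ring
    _ = _ := by
        rw [Finset.sum_const, Finset.card_univ, Fintype.card_fin, nsmul_eq_mul]
        push_cast
        ring

end Ising

/-! ### Passage from Ising blocks to the whole Griffiths-Simon class. -/

section GriffithsSimon

/-- The recursion links moments of equal parity, and odd moments vanish. The restriction to even
orders also makes the sign of the scale factor a of an Ising block irrelevant. -/
theorem isGaussianSpin_of_even_moments {ρ : Measure ℝ} [IsProbabilityMeasure ρ]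
    (hρ : IsEvenSpin ρ) (h : ∀ n : ℕ, Even n → ∫ t, t ^ (n + 2) ∂ρ ≤
      (n + 1) * (∫ t, t ^ 2 ∂ρ) * ∫ t, t ^ n ∂ρ) : IsGaussianSpin ρ where
  toIsEvenSpin := hρ
  moment j := by
    rcases Nat.even_or_odd j with hj | hj
    · have h1 : ∫ t, t ^ (j + 1) ∂ρ = 0 :=
        hρ.integral_odd (by fun_prop) fun t => hj.add_one.neg_pow t
      rcases j with _ | j
      · rw [h1]; simp
      · have hj' : Odd j := by
          rcases Nat.even_or_odd j with h | h
          · exact absurd hj (Nat.not_even_iff_odd.2 h.add_one)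
          · exact h
        have h2 : ∫ t, t ^ (j + 1 - 1) ∂ρ = 0 :=
          hρ.integral_odd (by fun_prop) fun t => hj'.neg_pow t
        rw [h1, h2, mul_zero]
    · obtain ⟨n, rfl⟩ := hj
      have := h (2 * n) (even_two_mul n)
      push_cast at this ⊢
      simpa using this

theorem integral_block {N : ℕ} (a : ℝ) (b : Fin N → ℝ) (K : Fin N → Fin N → ℝ) (f : ℝ → ℝ) :
    ∫ t, f t ∂(∑ σ : Fin N → ℤˣ,
      ENNReal.ofReal (blockWeight K σ / ∑ σ' : Fin N → ℤˣ, blockWeight K σ') •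
        Measure.dirac (a * ∑ n, b n * ((σ n : ℤ) : ℝ))) =
      (∑ σ : Fin N → ℤˣ, f (a * ∑ n, b n * sgn (σ n)) * isingWeight K σ) /
        ∑ σ, isingWeight K σ := by
  have hw : ∀ σ : Fin N → ℤˣ, 0 < isingWeight K σ := fun σ => Real.exp_pos _
  have hi : ∀ x : ℝ, Integrable f (Measure.dirac x) := fun x => integrable_dirac (by simp)
  rw [integral_finsetSum_measure fun σ _ => (hi _).smul_measure ENNReal.ofReal_ne_top,
    Finset.sum_div]
  refine Finset.sum_congr rfl fun σ _ => ?_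
  rw [integral_smul_measure, integral_dirac, ENNReal.toReal_ofReal]
  · change isingWeight K σ / (∑ σ, isingWeight K σ) * f (a * ∑ n, b n * sgn (σ n)) = _
    ring
  · exact div_nonneg (hw σ).le (Finset.sum_nonneg fun σ _ => (hw σ).le)

theorem isGaussianSpin_of_isIsingBlock {ρ : Measure ℝ} [IsProbabilityMeasure ρ]
    (h : IsIsingBlock ρ) : IsGaussianSpin ρ := by
  obtain ⟨N, a, b, K, hb, hK, rfl⟩ := h
  set Z := ∑ σ : Fin N → ℤˣ, isingWeight K σ with hZ
  have hw : ∀ σ : Fin N → ℤˣ, 0 < isingWeight K σ := fun σ => Real.exp_pos _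
  have hZ0 : 0 < Z := Finset.sum_pos (fun σ _ => hw σ) Finset.univ_nonempty
  refine isGaussianSpin_of_even_moments ⟨?_, fun B => ?_⟩ fun n hn => ?_
  · rw [← Measure.mapₗ_apply_of_measurable measurable_neg, map_sum]
    simp only [Measure.mapₗ_apply_of_measurable measurable_neg, Measure.map_smul,
      Measure.map_dirac' measurable_neg]
    rw [← Equiv.sum_comp (Equiv.neg (Fin N → ℤˣ))]
    refine Finset.sum_congr rfl fun σ _ => ?_
    have h1 : blockWeight K (-σ) = blockWeight K σ := by simp [blockWeight]
    simp [h1]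
  · exact integrable_finsetSum_measure.2 fun σ _ =>
      (integrable_dirac (by simp)).smul_measure ENNReal.ofReal_ne_top
  · rw [integral_block, integral_block, integral_block]
    simp only [mul_pow, mul_assoc, ← Finset.mul_sum]
    have h1 := ising_moment hK hb n
    simp only [← hZ] at h1 ⊢
    set A := ∑ σ : Fin N → ℤˣ, (∑ v, b v * sgn (σ v)) ^ (n + 2) * isingWeight K σ
    set A2 := ∑ σ : Fin N → ℤˣ, (∑ v, b v * sgn (σ v)) ^ 2 * isingWeight K σ
    set A0 := ∑ σ : Fin N → ℤˣ, (∑ v, b v * sgn (σ v)) ^ n * isingWeight K σ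
    have h2 : A / Z ≤ (n + 1) * (A2 / Z * (A0 / Z)) := by
      rw [div_le_iff₀ hZ0]
      have : (n + 1) * (A2 / Z * (A0 / Z)) * Z = (n + 1) * A2 * A0 / Z := by
        field_simp
      rw [this, le_div_iff₀ hZ0]
      exact h1
    have h3 := mul_le_mul_of_nonneg_left h2 (hn.add (by decide : Even 2) |>.pow_nonneg a)
    calc a ^ (n + 2) * A / Z = a ^ (n + 2) * (A / Z) := by ring
      _ ≤ _ := h3
      _ = _ := by ring

theorem exists_min_moment_le {f : ℝ → ℝ} (hf : Continuous f) (hf0 : ∀ t, 0 ≤ f t)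
    {u : ℕ → ProbabilityMeasure ℝ} {ρ : ProbabilityMeasure ℝ} (ht : Tendsto u atTop (𝓝 ρ))
    (A : ℝ) (hA : 0 ≤ A) : Tendsto (fun k => ∫ t, min (f t) A ∂(u k : Measure ℝ)) atTop
      (𝓝 (∫ t, min (f t) A ∂(ρ : Measure ℝ))) := by
  have h := ProbabilityMeasure.tendsto_iff_forall_integral_tendsto.1 ht
    (BoundedContinuousFunction.ofNormedAddCommGroup (fun t => min (f t) A)
      (hf.min continuous_const) A fun t => by
        rw [Real.norm_eq_abs, abs_of_nonneg (le_min (hf0 t) hA)]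
        exact min_le_right _ _)
  simpa using h

/-- Convergence of integrals under weak convergence and a uniform second-moment bound. -/
theorem tendsto_integral_of_sq_bound {f : ℝ → ℝ} (hf : Continuous f) (hf0 : ∀ t, 0 ≤ f t)
    {u : ℕ → ProbabilityMeasure ℝ} {ρ : ProbabilityMeasure ℝ} (ht : Tendsto u atTop (𝓝 ρ))
    (hfρ : Integrable f (ρ : Measure ℝ)) (hfu : ∀ k, Integrable f (u k : Measure ℝ))
    (hfu2 : ∀ k, Integrable (fun t => f t ^ 2) (u k : Measure ℝ)) {R : ℝ}
    (hR : ∀ᶠ k in atTop, ∫ t, f t ^ 2 ∂(u k : Measure ℝ) ≤ R) :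
    Tendsto (fun k => ∫ t, f t ∂(u k : Measure ℝ)) atTop (𝓝 (∫ t, f t ∂(ρ : Measure ℝ))) := by
  have hmin : ∀ A : ℝ, 0 ≤ A → ∀ (μ : Measure ℝ) (_ : Integrable f μ),
      Integrable (fun t => min (f t) A) μ := fun A hA μ hμ =>
    hμ.mono' (hf.min continuous_const).aestronglyMeasurable (ae_of_all _ fun t => by
      rw [Real.norm_eq_abs, abs_of_nonneg (le_min (hf0 t) hA)]; exact min_le_left _ _)
  have hlim : Tendsto (fun n : ℕ => ∫ t, min (f t) n ∂(ρ : Measure ℝ)) atTop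
      (𝓝 (∫ t, f t ∂(ρ : Measure ℝ))) := by
    refine tendsto_integral_of_dominated_convergence f
      (fun n => (hf.min continuous_const).aestronglyMeasurable) hfρ
      (fun n => ae_of_all _ fun t => by
        rw [Real.norm_eq_abs, abs_of_nonneg (le_min (hf0 t) n.cast_nonneg)]
        exact min_le_left _ _)
      (ae_of_all _ fun t => ?_)
    refine tendsto_const_nhds.congr' ?_
    filter_upwards [eventually_ge_atTop ⌈f t⌉₊] with n hn
    exact (min_eq_left ((Nat.le_ceil _).trans (by exact_mod_cast hn))).symm
  rw [Metric.tendsto_atTop']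
  intro ε hε
  have h1 : ∀ᶠ n : ℕ in atTop, |∫ t, min (f t) n ∂(ρ : Measure ℝ) - ∫ t, f t ∂(ρ : Measure ℝ)| < ε / 3 :=
    (Metric.tendsto_nhds.1 hlim) (ε / 3) (by positivity)
  have h2 : ∀ᶠ n : ℕ in atTop, |R| / (n : ℝ) < ε / 3 :=
    (tendsto_const_div_atTop_nhds_zero_nat |R|).eventually (gt_mem_nhds (by positivity))
  obtain ⟨n, h1, h2, hn⟩ := (h1.and (h2.and (eventually_gt_atTop 0))).exists
  have hn0 : (0 : ℝ) < n := by exact_mod_cast hn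
  have h3 := (Metric.tendsto_nhds.1 (exists_min_moment_le hf hf0 ht n hn0.le)) (ε / 3)
    (by positivity)
  obtain ⟨M, hM⟩ := eventually_atTop.1 (h3.and hR)
  refine ⟨M, fun k hk => ?_⟩
  obtain ⟨h3, h4⟩ := hM k (le_of_lt hk)
  rw [Real.dist_eq] at h3 ⊢
  have h5 : ∫ t, min (f t) n ∂(u k : Measure ℝ) ≤ ∫ t, f t ∂(u k : Measure ℝ) :=
    integral_mono (hmin n hn0.le _ (hfu k)) (hfu k) fun t => min_le_left _ _
  -- Truncation at height n costs at most f² / n, uniformly in k by the second-moment bound.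
  have h6 : ∫ t, f t ∂(u k : Measure ℝ) ≤ ∫ t, min (f t) n ∂(u k : Measure ℝ) + |R| / n := by
    have h7 : ∫ t, f t ∂(u k : Measure ℝ) ≤
        ∫ t, (min (f t) n + f t ^ 2 / n) ∂(u k : Measure ℝ) := by
      refine integral_mono (hfu k) ((hmin n hn0.le _ (hfu k)).add ((hfu2 k).div_const _))
        fun t => ?_
      simp only
      rcases le_total (f t) n with h | h
      · rw [min_eq_left h]
        have : 0 ≤ f t ^ 2 / n := by positivity
        linarith
      · rw [min_eq_right h]
        have : f t ≤ f t ^ 2 / n := by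
          rw [le_div_iff₀ hn0, sq]; exact mul_le_mul_of_nonneg_left h (hf0 t)
        linarith
    rw [integral_add (hmin n hn0.le _ (hfu k)) ((hfu2 k).div_const _), integral_div] at h7
    have : (∫ t, f t ^ 2 ∂(u k : Measure ℝ)) / n ≤ |R| / n :=
      div_le_div_of_nonneg_right (h4.trans (le_abs_self R)) hn0.le
    linarith
  rw [abs_lt] at *
  constructor <;> linarith

theorem IsEvenSpin.integrable_pow {ρ : Measure ℝ} [IsProbabilityMeasure ρ] (hρ : IsEvenSpin ρ)
    (n : ℕ) : Integrable (fun t : ℝ => t ^ n) ρ :=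
  (tame_id.pow n).integrable hρ.expInt

/-- Weak convergence only gives tightness. The case j = 3 of the recursion, which bounds the fourth
moment by 3 m², excludes that a large second moment m comes from a small amount of mass far away. -/
theorem exists_second_moment_bound {u : ℕ → ProbabilityMeasure ℝ} {ρ : ProbabilityMeasure ℝ}
    (hu : ∀ k, IsGaussianSpin (u k : Measure ℝ)) (ht : Tendsto u atTop (𝓝 ρ)) :
    ∃ R : ℝ, 0 ≤ R ∧ ∀ᶠ k in atTop, ∫ t, t ^ 2 ∂(u k : Measure ℝ) ≤ R := by
  set χ : ℕ → ℝ → ℝ := fun n t => max 0 (|t| - n) with hχ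
  have hχc : ∀ n, Continuous (χ n) := fun n => by simp only [hχ]; fun_prop
  have hχ0 : ∀ n t, 0 ≤ χ n t := fun n t => le_max_left _ _
  have h1 : Tendsto (fun n : ℕ => ∫ t, min (χ n t) 1 ∂(ρ : Measure ℝ)) atTop (𝓝 0) := by
    have : (0 : ℝ) = ∫ t, (0 : ℝ) ∂(ρ : Measure ℝ) := by simp
    rw [this]
    refine tendsto_integral_of_dominated_convergence (fun _ => (1 : ℝ))
      (fun n => ((hχc n).min continuous_const).aestronglyMeasurable) (integrable_const _)
      (fun n => ae_of_all _ fun t => ?_) (ae_of_all _ fun t => ?_)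
    · rw [Real.norm_eq_abs, abs_of_nonneg (le_min (hχ0 n t) zero_le_one)]
      exact min_le_right _ _
    · refine tendsto_const_nhds.congr' ?_
      filter_upwards [eventually_ge_atTop ⌈|t|⌉₊] with n hn
      have : |t| ≤ n := (Nat.le_ceil _).trans (by exact_mod_cast hn)
      simp [hχ, this]
  obtain ⟨n, hn⟩ := (h1.eventually (gt_mem_nhds (show (0 : ℝ) < 1 / 12 by norm_num))).exists
  refine ⟨2 * (n + 1) ^ 2, by positivity, ?_⟩
  filter_upwards [(exists_min_moment_le (hχc n) (hχ0 n) ht 1 zero_le_one).eventually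
    (gt_mem_nhds hn)] with k hk
  set m := ∫ t, t ^ 2 ∂(u k : Measure ℝ) with hm
  have hm0 : 0 ≤ m := integral_nonneg fun t => sq_nonneg t
  rcases hm0.eq_or_lt with h | hmpos
  · rw [← h]; positivity
  have h4 : ∫ t, t ^ 4 ∂(u k : Measure ℝ) ≤ 3 * m * m := by
    have := (hu k).moment 3
    simpa using this
  have hi2 := (hu k).toIsEvenSpin.integrable_pow 2
  have hi4 := (hu k).toIsEvenSpin.integrable_pow 4
  have hiχ : Integrable (fun t => min (χ n t) 1) (u k : Measure ℝ) :=
    (integrable_const (1 : ℝ)).mono' ((hχc n).min continuous_const).aestronglyMeasurable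
      (ae_of_all _ fun t => by
        rw [Real.norm_eq_abs, abs_of_nonneg (le_min (hχ0 n t) zero_le_one)]
        exact min_le_right _ _)
  -- Beyond n + 1 use t² ≤ t⁴ / (12 m) + 3 m. The first term integrates to at most m / 4, and so
  -- does the second, since the tail has mass at most 1/12; hence m ≤ (n + 1)² + m / 2.
  have h5 : m ≤ ∫ t, (((n : ℝ) + 1) ^ 2 + (t ^ 4 * (1 / (12 * m)) + min (χ n t) 1 * (3 * m)))
      ∂(u k : Measure ℝ) := by
    refine integral_mono hi2 ((integrable_const _).add ((hi4.mul_const _).add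
      (hiχ.mul_const _))) fun t => ?_
    simp only
    rcases le_total |t| (n + 1) with h | h
    · have h6 : t ^ 2 ≤ ((n : ℝ) + 1) ^ 2 := by
        rw [← sq_abs]; exact pow_le_pow_left₀ (abs_nonneg t) h 2
      have h7 : 0 ≤ t ^ 4 * (1 / (12 * m)) := by positivity
      have h8 : 0 ≤ min (χ n t) 1 * (3 * m) := mul_nonneg (le_min (hχ0 n t) zero_le_one)
        (by positivity)
      linarith
    · have h6 : min (χ n t) 1 = 1 := min_eq_right ((le_max_right _ _).trans' (by linarith))
      rw [h6]
      have h7 : t ^ 2 ≤ t ^ 4 * (1 / (12 * m)) + 1 * (3 * m) := by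
        have : t ^ 4 * (1 / (12 * m)) + 1 * (3 * m) - t ^ 2 = (t ^ 2 - 6 * m) ^ 2 / (12 * m) := by
          field_simp; ring
        have h8 : 0 ≤ (t ^ 2 - 6 * m) ^ 2 / (12 * m) := by positivity
        linarith
      nlinarith [sq_nonneg ((n : ℝ) + 1)]
  rw [integral_add (g := fun t => t ^ 4 * (1 / (12 * m)) + min (χ n t) 1 * (3 * m))
    (integrable_const _) ((hi4.mul_const _).add (hiχ.mul_const _)), integral_add (hi4.mul_const _) (hiχ.mul_const _), integral_mul_const, integral_mul_const] at h5
  have h6 : (∫ t, t ^ 4 ∂(u k : Measure ℝ)) * (1 / (12 * m)) ≤ m / 4 := by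
    calc _ ≤ 3 * m * m * (1 / (12 * m)) := mul_le_mul_of_nonneg_right h4 (by positivity)
      _ = m / 4 := by field_simp; norm_num
  have h7 : (∫ t, min (χ n t) 1 ∂(u k : Measure ℝ)) * (3 * m) ≤ 1 / 12 * (3 * m) :=
    mul_le_mul_of_nonneg_right hk.le (by positivity)
  simp only [integral_const, probReal_univ, one_smul] at h5
  linarith

/-- Iterating the recursion turns the bound on second moments into uniform bounds on all even
moments. The moment of order 2n makes that of order n uniformly integrable, so even moments converge
and the inequality survives in the limit. -/
theorem isGaussianSpin_of_tendsto {u : ℕ → ProbabilityMeasure ℝ} {ρ : ProbabilityMeasure ℝ}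
    (hu : ∀ k, IsGaussianSpin (u k : Measure ℝ)) (ht : Tendsto u atTop (𝓝 ρ))
    (hint : ∀ B : ℝ, Integrable (fun t : ℝ => Real.exp (B * t ^ 2)) (ρ : Measure ℝ)) :
    IsGaussianSpin (ρ : Measure ℝ) := by
  have hsymm : (ρ : Measure ℝ).map (fun t => -t) = ρ := by
    have h1 := ProbabilityMeasure.tendsto_map_of_tendsto_of_continuous u ρ ht
      (continuous_neg : Continuous fun t : ℝ => -t)
    have h2 : ∀ k, (u k).map (continuous_neg : Continuous fun t : ℝ => -t).measurable.aemeasurable =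
        u k := fun k => Subtype.ext (hu k).symm
    simp only [h2] at h1
    have h3 := tendsto_nhds_unique h1 ht
    have h4 := congrArg (fun ν : ProbabilityMeasure ℝ => (ν : Measure ℝ)) h3
    simpa [ProbabilityMeasure.toMeasure_map] using h4
  have hρ : IsEvenSpin (ρ : Measure ℝ) := ⟨hsymm, hint⟩
  obtain ⟨R, hR0, hR⟩ := exists_second_moment_bound hu ht
  have hbound : ∀ n : ℕ, ∃ R' : ℝ, ∀ᶠ k in atTop, ∫ t, t ^ (2 * n) ∂(u k : Measure ℝ) ≤ R' := by
    intro n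
    induction n with
    | zero => exact ⟨1, Eventually.of_forall fun k => by simp⟩
    | succ n ih =>
      obtain ⟨R', h'⟩ := ih
      refine ⟨(2 * n + 1 : ℕ) * R * R', ?_⟩
      filter_upwards [hR, h'] with k h1 h2
      have h3 := (hu k).moment (2 * n + 1)
      have h4 : 0 ≤ ∫ t, t ^ (2 * n) ∂(u k : Measure ℝ) :=
        integral_nonneg fun t => (even_two_mul n).pow_nonneg t
      refine h3.trans ?_
      simp only [Nat.add_sub_cancel]
      exact mul_le_mul (mul_le_mul_of_nonneg_left h1 (by positivity)) h2 h4 (by positivity)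
  have hconv : ∀ n : ℕ, Even n → Tendsto (fun k => ∫ t, t ^ n ∂(u k : Measure ℝ)) atTop
      (𝓝 (∫ t, t ^ n ∂(ρ : Measure ℝ))) := fun n hn => by
    obtain ⟨R', h'⟩ := hbound n
    refine tendsto_integral_of_sq_bound (R := R') (by fun_prop) (fun t => hn.pow_nonneg t) ht
      (hρ.integrable_pow n) (fun k => (hu k).toIsEvenSpin.integrable_pow n) (fun k => ?_) ?_
    · simp only [← pow_mul]
      exact (hu k).toIsEvenSpin.integrable_pow _
    · simpa only [← pow_mul, mul_comm n] using h'
  refine isGaussianSpin_of_even_moments hρ fun n hn => ?_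
  refine le_of_tendsto_of_tendsto' (hconv (n + 2) (hn.add (by decide)))
    (((hconv 2 (by decide)).const_mul ((n : ℝ) + 1)).mul (hconv n hn)) fun k => ?_
  have := (hu k).moment (n + 1)
  simpa using this

/-- Since α > 2, the power |t| ^ α exceeds B t² outside a bounded set. -/
theorem SubGaussianGrowth.integrable {ρ : Measure ℝ} (h : SubGaussianGrowth ρ) (B : ℝ) :
    Integrable (fun t : ℝ => Real.exp (B * t ^ 2)) ρ := by
  obtain ⟨α, hα, hint⟩ := h
  obtain ⟨T, hT⟩ := eventually_atTop.1
    ((tendsto_rpow_atTop (show 0 < α - 2 by linarith)).eventually_ge_atTop B)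
  set T' := max T 1
  refine (hint.const_mul (Real.exp (|B| * T' ^ 2))).mono' (by fun_prop) (ae_of_all _ fun t => ?_)
  rw [Real.norm_eq_abs, Real.abs_exp, ← Real.exp_add]
  refine Real.exp_le_exp.2 ?_
  rcases le_total |t| T' with h | h
  · have h1 : t ^ 2 ≤ T' ^ 2 := by
      rw [← sq_abs]; exact pow_le_pow_left₀ (abs_nonneg t) h 2
    have h2 : 0 ≤ |t| ^ α := Real.rpow_nonneg (abs_nonneg t) _
    nlinarith [le_abs_self B, abs_nonneg B, sq_nonneg t]
  · have h1 := hT |t| ((le_max_left _ _).trans h)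
    have h0 : 0 < |t| := lt_of_lt_of_le (by positivity) ((le_max_right T 1).trans h)
    have h2 : |t| ^ α = |t| ^ (α - 2) * t ^ 2 := by
      rw [← sq_abs t, ← Real.rpow_natCast |t| 2, ← Real.rpow_add h0]
      norm_num
    rw [h2]
    have := mul_le_mul_of_nonneg_right h1 (sq_nonneg t)
    nlinarith [abs_nonneg B, sq_nonneg T']

theorem IsGS.isGaussianSpin {ρ : ProbabilityMeasure ℝ} (h : IsGS ρ) :
    IsGaussianSpin (ρ : Measure ℝ) := by
  rcases h with h | ⟨h, u, hu, ht⟩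
  · exact isGaussianSpin_of_isIsingBlock h
  · exact isGaussianSpin_of_tendsto (fun k => isGaussianSpin_of_isIsingBlock (hu k)) ht
      h.integrable

end GriffithsSimon

/-! ### The thermodynamic limit -/

section Embedding

variable {ι ι' : Type*} [Fintype ι] [Fintype ι'] {ρ : Measure ℝ} [IsProbabilityMeasure ρ]

theorem measurePreserving_comp_injective {e : ι' → ι} (he : Function.Injective e) :
    MeasurePreserving (fun (τ : ι → ℝ) (i : ι') => τ (e i)) (Measure.pi fun _ : ι => ρ)
      (Measure.pi fun _ : ι' => ρ) := by
  classical
  have hm : Measurable fun (τ : ι → ℝ) (i : ι') => τ (e i) := by fun_prop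
  refine ⟨hm, (Measure.pi_eq fun s hs => ?_).symm⟩
  rw [Measure.map_apply hm (MeasurableSet.univ_pi hs)]
  have : (fun (τ : ι → ℝ) (i : ι') => τ (e i)) ⁻¹' Set.pi Set.univ s =
      Set.pi Set.univ fun x => {t | ∀ i, e i = x → t ∈ s i} := by
    ext τ
    simp only [Set.mem_preimage, Set.mem_pi, Set.mem_univ, true_implies, Set.mem_ofPred_eq]
    exact ⟨fun h x i hi => hi ▸ h i, fun h i => h (e i) i rfl⟩
  rw [this, Measure.pi_pi]
  refine (Fintype.prod_of_injective e he _ _ (fun x hx => ?_) fun i => ?_).symm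
  · have : {t : ℝ | ∀ i, e i = x → t ∈ s i} = Set.univ :=
      Set.eq_univ_of_forall fun t i hi => absurd ⟨i, hi⟩ hx
    rw [this, measure_univ]
  · congr 1
    ext t
    exact ⟨fun h j hj => he hj ▸ h, fun h => h i rfl⟩

/-- Extend c' by zero along e. The sites outside the range decouple and integrate out, and
Griffiths' second inequality compares with c. This covers both growing volumes and the symmetries of
the lattice. -/
theorem corr_le_of_injective (hρ : IsEvenSpin ρ) {e : ι' → ι} (he : Function.Injective e)
    {c' : ι' → ι' → ℝ} {c : ι → ι → ℝ} (hc' : ∀ i j, 0 ≤ c' i j) (hs' : ∀ i j, c' i j = c' j i)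
    (hc : ∀ x y, 0 ≤ c x y) (h : ∀ i j, c' i j ≤ c (e i) (e j)) (i j : ι') :
    corr ρ c' i j ≤ corr ρ c (e i) (e j) := by
  classical
  set c₀ : ι → ι → ℝ := fun x y => ∑ i, ∑ j, if e i = x ∧ e j = y then c' i j else 0 with hc₀
  have hq : ∀ τ : ι → ℝ, quad c₀ τ = quad c' fun i => τ (e i) := fun τ => by
    unfold quad
    congr 1
    have h1 : ∀ x y, c₀ x y * τ x * τ y =
        ∑ i, ∑ j, if e i = x then (if e j = y then c' i j * τ x * τ y else 0) else 0 := by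
      intro x y
      simp only [hc₀, Finset.sum_mul, ite_and]
      refine Finset.sum_congr rfl fun i _ => Finset.sum_congr rfl fun j _ => ?_
      split_ifs <;> simp
    simp only [h1]
    calc _ = ∑ x, ∑ i, ∑ j, ∑ y,
          (if e i = x then (if e j = y then c' i j * τ x * τ y else 0) else 0) := by
          refine Finset.sum_congr rfl fun x _ => ?_
          rw [Finset.sum_comm]
          exact Finset.sum_congr rfl fun i _ => Finset.sum_comm
      _ = ∑ i, ∑ j, ∑ x, ∑ y,
          (if e i = x then (if e j = y then c' i j * τ x * τ y else 0) else 0) := by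
          rw [Finset.sum_comm]
          exact Finset.sum_congr rfl fun i _ => Finset.sum_comm
      _ = _ := by
          refine Finset.sum_congr rfl fun i _ => Finset.sum_congr rfl fun j _ => ?_
          rw [Finset.sum_eq_single (e i)]
          · simp
          · intro x _ hx; simp [hx.symm]
          · simp
  have hmp := measurePreserving_comp_injective (ρ := ρ) he
  have hW := tame_exp_quad c'
  have h1 : corr ρ c' i j = corr ρ c₀ (e i) (e j) := by
    unfold corr gibbsMean
    simp only [hq]
    congr 1
    · rw [← hmp.map_eq, integral_map hmp.measurable.aemeasurable
        ((tame_pair i j).mul hW).meas.aestronglyMeasurable]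
    · rw [← hmp.map_eq, integral_map hmp.measurable.aemeasurable hW.meas.aestronglyMeasurable]
  rw [h1]
  have h0 : ∀ x y, 0 ≤ c₀ x y := fun x y =>
    Finset.sum_nonneg fun i _ => Finset.sum_nonneg fun j _ => by
      split_ifs; exacts [hc' i j, le_rfl]
  refine gibbsMean_mono hρ h0 (fun x y => ?_) (fun x y => ?_) _ _
  · simp only [hc₀]
    rw [Finset.sum_comm]
    refine Finset.sum_congr rfl fun i _ => Finset.sum_congr rfl fun j _ => ?_
    rw [hs' j i]
    simp only [and_comm]
  · by_cases hxy : ∃ i j, e i = x ∧ e j = y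
    · obtain ⟨i, j, rfl, rfl⟩ := hxy
      refine le_trans (le_of_eq ?_) (h i j)
      simp only [hc₀, he.eq_iff, ite_and]
      simp
    · push Not at hxy
      have : c₀ x y = 0 := Finset.sum_eq_zero fun i _ => Finset.sum_eq_zero fun j _ =>
        if_neg fun h => hxy i j h.1 h.2
      rw [this]; exact hc x y

end Embedding

/-- Ferromagnetic pair couplings on a countable set, of total strength at most `D` at each site. -/
structure IsCoupling {V : Type*} (k : V → V → ℝ) (D : ℝ) : Prop where
  pos : 0 < D
  nonneg : ∀ x y, 0 ≤ k x y
  symm : ∀ x y, k x y = k y x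
  diag : ∀ x, k x x = 0
  bound : ∀ x (s : Finset V), ∑ y ∈ s, k x y ≤ D

/-! ### Infinite-volume correlations as suprema over finite volumes, and the inequalities they
inherit. -/

section Infinite

variable {V : Type*} {ρ : Measure ℝ} [IsProbabilityMeasure ρ] {k : V → V → ℝ} {D : ℝ}

open Classical in
/-- The pair correlation in the finite volume `Λ` (zero if one of the points is outside). -/
noncomputable def fcorr (ρ : Measure ℝ) (k : V → V → ℝ) (Λ : Finset V) (x y : V) : ℝ :=
  if h : x ∈ Λ ∧ y ∈ Λ then corr ρ (fun a b : Λ => k a b) ⟨x, h.1⟩ ⟨y, h.2⟩ else 0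

/-- The pair correlation in infinite volume. -/
noncomputable def icorr (ρ : Measure ℝ) (k : V → V → ℝ) (x y : V) : ℝ := ⨆ Λ, fcorr ρ k Λ x y

theorem fcorr_of_mem {Λ : Finset V} {x y : V} (hx : x ∈ Λ) (hy : y ∈ Λ) :
    fcorr ρ k Λ x y = corr ρ (fun a b : Λ => k a b) ⟨x, hx⟩ ⟨y, hy⟩ := dif_pos ⟨hx, hy⟩

theorem fcorr_comm (Λ : Finset V) (x y : V) : fcorr ρ k Λ x y = fcorr ρ k Λ y x := by
  by_cases h : x ∈ Λ ∧ y ∈ Λ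
  · rw [fcorr_of_mem h.1 h.2, fcorr_of_mem h.2 h.1, corr_comm]
  · rw [fcorr, fcorr, dif_neg h, dif_neg (by tauto)]

theorem icorr_comm (x y : V) : icorr ρ k x y = icorr ρ k y x := by
  unfold icorr; simp only [fcorr_comm]

theorem fcorr_nonneg (hρ : IsEvenSpin ρ) (hk : IsCoupling k D) (Λ : Finset V) (x y : V) :
    0 ≤ fcorr ρ k Λ x y := by
  unfold fcorr
  split_ifs with h
  · exact corr_nonneg hρ (fun _ _ => hk.nonneg _ _) (fun _ _ => hk.symm _ _) _ _
  · exact le_rfl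

theorem fcorr_le_map (hρ : IsEvenSpin ρ) (hk : IsCoupling k D) {φ : V → V}
    (hφ : Function.Injective φ) (hφk : ∀ x y, k (φ x) (φ y) = k x y) {Λ Λ' : Finset V}
    (h : ∀ x ∈ Λ, φ x ∈ Λ') (x y : V) : fcorr ρ k Λ x y ≤ fcorr ρ k Λ' (φ x) (φ y) := by
  by_cases hxy : x ∈ Λ ∧ y ∈ Λ
  · rw [fcorr_of_mem hxy.1 hxy.2, fcorr_of_mem (h x hxy.1) (h y hxy.2)]
    exact corr_le_of_injective (e := fun a : Λ => (⟨φ a, h a a.2⟩ : Λ')) hρ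
      (fun a b hab => Subtype.ext (hφ (by simpa using hab)))
      (fun _ _ => hk.nonneg _ _) (fun _ _ => hk.symm _ _) (fun _ _ => hk.nonneg _ _)
      (fun a b => (hφk a b).ge) ⟨x, hxy.1⟩ ⟨y, hxy.2⟩
  · rw [fcorr, dif_neg hxy]; exact fcorr_nonneg hρ hk _ _ _

theorem fcorr_mono (hρ : IsEvenSpin ρ) (hk : IsCoupling k D) (x y : V) :
    Monotone fun Λ => fcorr ρ k Λ x y := fun _ _ h =>
  fcorr_le_map hρ hk (φ := id) Function.injective_id (fun _ _ => rfl) (fun _ hx => h hx) x y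

theorem bddAbove_fcorr (hρ : IsEvenSpin ρ) (hk : IsCoupling k D) (x y : V) :
    BddAbove (Set.range fun Λ => fcorr ρ k Λ x y) := by
  refine ⟨2 * ∫ t, t ^ 2 * Real.exp ((1 / (2 * D))⁻¹ * t ^ 2) ∂ρ, ?_⟩
  rintro _ ⟨Λ, rfl⟩
  have hself : ∀ z : Λ, corr ρ (fun a b : Λ => k a b) z z ≤ _ :=
    corr_self_le hρ (fun a b : Λ => hk.nonneg a b) (fun a b => hk.symm a b) (fun a => hk.diag a)
      hk.pos (fun a => by
        rw [Finset.sum_coe_sort Λ fun y => k a y]; exact hk.bound a Λ)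
  by_cases h : x ∈ Λ ∧ y ∈ Λ
  · simp only [fcorr_of_mem h.1 h.2]
    refine (corr_sq_le _ _ hρ).trans ?_
    linarith [hself ⟨x, h.1⟩, hself ⟨y, h.2⟩]
  · simp only [fcorr, dif_neg h]
    exact mul_nonneg (by norm_num) (integral_nonneg fun t => by positivity)

theorem fcorr_le_icorr (hρ : IsEvenSpin ρ) (hk : IsCoupling k D) (Λ : Finset V) (x y : V) :
    fcorr ρ k Λ x y ≤ icorr ρ k x y :=
  le_ciSup (bddAbove_fcorr hρ hk x y) Λ

theorem icorr_nonneg (hρ : IsEvenSpin ρ) (hk : IsCoupling k D) (x y : V) :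
    0 ≤ icorr ρ k x y :=
  (fcorr_nonneg hρ hk ∅ x y).trans (fcorr_le_icorr hρ hk ∅ x y)

theorem tendsto_fcorr (hρ : IsEvenSpin ρ) (hk : IsCoupling k D) (x y : V) :
    Tendsto (fun Λ => fcorr ρ k Λ x y) atTop (𝓝 (icorr ρ k x y)) :=
  tendsto_atTop_ciSup (fcorr_mono hρ hk x y) (bddAbove_fcorr hρ hk x y)

theorem icorr_le_map (hρ : IsEvenSpin ρ) (hk : IsCoupling k D) {φ : V → V}
    (hφ : Function.Injective φ) (hφk : ∀ x y, k (φ x) (φ y) = k x y) (x y : V) :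
    icorr ρ k x y ≤ icorr ρ k (φ x) (φ y) := by
  classical
  exact ciSup_le fun Λ => (fcorr_le_map hρ hk hφ hφk
    (fun x hx => Finset.mem_image_of_mem φ hx) x y).trans (fcorr_le_icorr hρ hk (Λ.image φ) _ _)

theorem icorr_map (hρ : IsEvenSpin ρ) (hk : IsCoupling k D) (φ : V ≃ V)
    (hφk : ∀ x y, k (φ x) (φ y) = k x y) (x y : V) :
    icorr ρ k (φ x) (φ y) = icorr ρ k x y := by
  refine le_antisymm ?_ (icorr_le_map hρ hk φ.injective hφk x y)
  have := icorr_le_map (ρ := ρ) hρ hk φ.symm.injective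
    (fun x y => by rw [← hφk]; simp) (φ x) (φ y)
  simpa using this

theorem integral_sq_le_icorr (hρ : IsEvenSpin ρ) (hk : IsCoupling k D) (x : V) :
    ∫ t, t ^ 2 ∂ρ ≤ icorr ρ k x x := by
  have h := fcorr_le_icorr hρ hk {x} x x
  rw [fcorr_of_mem (by simp) (by simp)] at h
  exact (le_corr_self hρ (fun _ _ => hk.nonneg _ _) _).trans h

theorem icorr_ge_of_edge (hρ : IsEvenSpin ρ) (hk : IsCoupling k D) {o x : V} (hx : x ≠ o) :
    k o x * (∫ t, t ^ 2 ∂ρ) ^ 2 / (1 + (k o x * ∫ t, t ^ 2 ∂ρ) ^ 2) ≤ icorr ρ k o x := by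
  classical
  have h := fcorr_le_icorr hρ hk {o, x} o x
  rw [fcorr_of_mem (by simp) (by simp)] at h
  exact (corr_ge_of_edge (c := fun a b : ({o, x} : Finset V) => k a b) hρ
    (fun _ _ => hk.nonneg _ _) (fun _ _ => hk.symm _ _) (o := ⟨o, by simp⟩) (x := ⟨x, by simp⟩)
    (by simpa using hx)).trans h

theorem sum_corr_le_icorr (hρ : IsEvenSpin ρ) (hk : IsCoupling k D) {Λ N : Finset V} {o x : V}
    (hN : ∀ y, k o y ≠ 0 → y ∈ N) (hx : x ∈ Λ) :
    ∑ y : Λ, k o y * corr ρ (fun a b : Λ => k a b) y ⟨x, hx⟩ ≤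
      ∑ y ∈ N, k o y * icorr ρ k y x := by
  classical
  have h1 : ∑ y : Λ, k o y * corr ρ (fun a b : Λ => k a b) y ⟨x, hx⟩ =
      ∑ y ∈ Λ, k o y * fcorr ρ k Λ y x := by
    rw [← Finset.sum_coe_sort Λ]
    exact Finset.sum_congr rfl fun y _ => by rw [fcorr_of_mem y.2 hx]
  rw [h1]
  calc _ ≤ ∑ y ∈ Λ, k o y * icorr ρ k y x := Finset.sum_le_sum fun y _ =>
        mul_le_mul_of_nonneg_left (fcorr_le_icorr hρ hk Λ y x) (hk.nonneg o y)
    _ = ∑ y ∈ Λ with k o y ≠ 0, k o y * icorr ρ k y x := by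
        rw [Finset.sum_filter]
        refine Finset.sum_congr rfl fun y _ => ?_
        split_ifs with h
        · rfl
        · simp [not_not.1 h]
    _ ≤ _ := Finset.sum_le_sum_of_subset_of_nonneg
        (fun y hy => hN y (Finset.mem_filter.1 hy).2)
        fun y _ _ => mul_nonneg (hk.nonneg o y) (icorr_nonneg hρ hk y x)

theorem icorr_le_sum (hρ : IsGaussianSpin ρ) (hk : IsCoupling k D) {N : Finset V} {o x : V}
    (hN : ∀ y, k o y ≠ 0 → y ∈ N) (hx : x ≠ o) :
    icorr ρ k o x ≤ (∫ t, t ^ 2 ∂ρ) * ∑ y ∈ N, k o y * icorr ρ k y x := by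
  have hs : 0 ≤ ∫ t, t ^ 2 ∂ρ := integral_nonneg fun t => sq_nonneg t
  have h0 : 0 ≤ (∫ t, t ^ 2 ∂ρ) * ∑ y ∈ N, k o y * icorr ρ k y x :=
    mul_nonneg hs (Finset.sum_nonneg fun y _ =>
      mul_nonneg (hk.nonneg o y) (icorr_nonneg hρ.toIsEvenSpin hk y x))
  refine ciSup_le fun Λ => ?_
  by_cases h : o ∈ Λ ∧ x ∈ Λ
  · rw [fcorr_of_mem h.1 h.2]
    exact (corr_le_sum (c := fun a b : Λ => k a b) hρ (fun _ _ => hk.nonneg _ _)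
      (fun _ _ => hk.symm _ _) (o := ⟨o, h.1⟩) (hk.diag o) (by simpa using hx)).trans
      (mul_le_mul_of_nonneg_left (sum_corr_le_icorr hρ.toIsEvenSpin hk hN h.2) hs)
  · rw [fcorr, dif_neg h]; exact h0

theorem icorr_self_le_sum (hρ : IsGaussianSpin ρ) (hk : IsCoupling k D) {N : Finset V} {o : V}
    (hN : ∀ y, k o y ≠ 0 → y ∈ N) :
    icorr ρ k o o ≤ (∫ t, t ^ 2 ∂ρ) * (1 + ∑ y ∈ N, k o y * icorr ρ k y o) := by
  have hs : 0 ≤ ∫ t, t ^ 2 ∂ρ := integral_nonneg fun t => sq_nonneg t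
  have h0 : 0 ≤ (∫ t, t ^ 2 ∂ρ) * (1 + ∑ y ∈ N, k o y * icorr ρ k y o) :=
    mul_nonneg hs (add_nonneg zero_le_one (Finset.sum_nonneg fun y _ =>
      mul_nonneg (hk.nonneg o y) (icorr_nonneg hρ.toIsEvenSpin hk y o)))
  refine ciSup_le fun Λ => ?_
  by_cases h : o ∈ Λ
  · rw [fcorr_of_mem h h]
    exact (corr_self_le_sum (c := fun a b : Λ => k a b) hρ (fun _ _ => hk.nonneg _ _)
      (fun _ _ => hk.symm _ _) (o := ⟨o, h⟩) (hk.diag o)).trans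
      (mul_le_mul_of_nonneg_left (add_le_add_right
        (sum_corr_le_icorr hρ.toIsEvenSpin hk hN h) 1) hs)
  · rw [fcorr, dif_neg (by tauto)]; exact h0

variable {θ : V → V} {P : V → Prop}

open Classical in
/-- The smallest volume that contains `Λ` and is symmetric under the involution `θ`. -/
noncomputable def symmetrize (θ : V → V) (Λ : Finset V) : Finset V := Λ ∪ Λ.image θ

theorem subset_symmetrize (θ : V → V) (Λ : Finset V) : Λ ⊆ symmetrize θ Λ := by
  classical
  exact Finset.subset_union_left

theorem mem_symmetrize (hr : IsReflection k θ P) {Λ : Finset V} {x : V}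
    (hx : x ∈ symmetrize θ Λ) : θ x ∈ symmetrize θ Λ := by
  classical
  unfold symmetrize at *
  simp only [Finset.mem_union, Finset.mem_image] at *
  rcases hx with h | ⟨y, hy, rfl⟩
  · exact Or.inr ⟨x, h, rfl⟩
  · rw [hr.invol]; exact Or.inl hy

theorem tendsto_symmetrize (θ : V → V) : Tendsto (symmetrize θ) atTop atTop :=
  tendsto_atTop_mono (subset_symmetrize θ) tendsto_id

theorem IsReflection.restrict (hr : IsReflection k θ P) {Λ : Finset V}
    (hΛ : ∀ x ∈ Λ, θ x ∈ Λ) :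
    IsReflection (fun a b : Λ => k a b) (fun a => ⟨θ a, hΛ a a.2⟩) fun a => P a where
  nonneg _ _ := hr.nonneg _ _
  symm _ _ := hr.symm _ _
  invol _ := Subtype.ext (hr.invol _)
  inv _ _ := hr.inv _ _
  disj _ h := hr.disj _ h
  fixed _ h h' := Subtype.ext (hr.fixed _ h h')
  cross _ _ h h' h'' := Subtype.ext (hr.cross _ _ h h' h'')

/-- The finite-volume inequality needs a volume invariant under θ; enlarging Λ to its symmetrization
only increases the correlation. -/
theorem icorr_reflection_le (hρ : IsEvenSpin ρ) (hk : IsCoupling k D) (hr : IsReflection k θ P)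
    {u y : V} (hu : ¬P (θ u)) (hy : ¬P (θ y)) : icorr ρ k u (θ y) ≤ icorr ρ k u y := by
  refine ciSup_le fun Λ => (fcorr_mono hρ hk u (θ y) (subset_symmetrize θ Λ)).trans
    (le_trans ?_ (fcorr_le_icorr hρ hk (symmetrize θ Λ) u y))
  simp only
  by_cases h : u ∈ symmetrize θ Λ ∧ y ∈ symmetrize θ Λ
  · rw [fcorr_of_mem h.1 (mem_symmetrize hr h.2), fcorr_of_mem h.1 h.2]
    exact corr_reflection_le hρ (hr.restrict fun x hx => mem_symmetrize hr hx)
      (u := ⟨u, h.1⟩) (y := ⟨y, h.2⟩) hu hy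
  · rw [fcorr, fcorr, dif_neg h, dif_neg]
    rintro ⟨h1, h2⟩
    exact h ⟨h1, by simpa [hr.invol] using mem_symmetrize hr h2⟩

theorem sum_icorr_reflection_nonneg (hρ : IsEvenSpin ρ) (hk : IsCoupling k D)
    (hr : IsReflection k θ P) (s : Finset V) (hs : ∀ x ∈ s, ¬P (θ x)) (v : V → ℝ) :
    0 ≤ ∑ x ∈ s, ∑ y ∈ s, v x * v y * icorr ρ k x (θ y) := by
  classical
  have ht : Tendsto (fun Λ => ∑ x ∈ s, ∑ y ∈ s, v x * v y * fcorr ρ k (symmetrize θ Λ) x (θ y))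
      atTop (𝓝 (∑ x ∈ s, ∑ y ∈ s, v x * v y * icorr ρ k x (θ y))) :=
    tendsto_finsetSum _ fun x _ => tendsto_finsetSum _ fun y _ =>
      ((tendsto_fcorr hρ hk x (θ y)).comp (tendsto_symmetrize θ)).const_mul _
  refine ge_of_tendsto ht ?_
  filter_upwards [eventually_ge_atTop s] with Λ hΛ
  set M := symmetrize θ Λ with hM
  have hsM : ∀ x ∈ s, x ∈ M := fun x hx => subset_symmetrize θ Λ (hΛ hx)
  have key := sum_corr_reflection_nonneg hρ (hr.restrict (Λ := M) fun x hx => mem_symmetrize hr hx)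
    (Finset.univ.filter fun a : M => (a : V) ∈ s)
    (fun a ha => hs a (Finset.mem_filter.1 ha).2) fun a => v a
  refine key.trans_eq ?_
  have hsum : ∀ f : V → ℝ, ∑ a ∈ Finset.univ.filter (fun a : M => (a : V) ∈ s), f a =
      ∑ x ∈ s, f x := fun f => by
    rw [Finset.sum_filter, Finset.sum_coe_sort M fun x => if x ∈ s then f x else 0,
      ← Finset.sum_filter]
    congr 1
    ext x
    simp only [Finset.mem_filter]
    exact ⟨fun h => h.2, fun h => ⟨hsM x h, h⟩⟩
  rw [← hsum]
  refine Finset.sum_congr rfl fun a _ => ?_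
  rw [← hsum]
  refine Finset.sum_congr rfl fun b _ => ?_
  rw [fcorr_of_mem a.2 (mem_symmetrize hr b.2)]

theorem icorr_gaussian_domination (hρ : IsEvenSpin ρ) (hk : IsCoupling k D)
    (hr : IsReflection k θ P) {o : V} (ho : P o) (ha : 0 < k o (θ o)) :
    k o (θ o) * (icorr ρ k o o + icorr ρ k (θ o) (θ o) - 2 * icorr ρ k o (θ o)) ≤ 1 := by
  have ht := fun x y => (tendsto_fcorr hρ hk x y).comp (tendsto_symmetrize θ)
  refine le_of_tendsto ((((ht o o).add (ht (θ o) (θ o))).sub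
    ((ht o (θ o)).const_mul 2)).const_mul (k o (θ o))) ?_
  filter_upwards [eventually_ge_atTop {o}] with Λ hΛ
  have h1 : o ∈ symmetrize θ Λ := subset_symmetrize θ Λ (hΛ (by simp))
  have h2 := mem_symmetrize hr h1
  simp only [Function.comp_apply]
  rw [fcorr_of_mem h1 h1, fcorr_of_mem h2 h2, fcorr_of_mem h1 h2]
  exact corr_gaussian_domination hρ
    (hr.restrict (Λ := symmetrize θ Λ) fun x hx => mem_symmetrize hr hx) (o := ⟨o, h1⟩) ho ha

end Infinite

/-! ### The nearest-neighbour model on the lattice -/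

section Lattice

variable {d : ℕ} {ρ : Measure ℝ} [IsProbabilityMeasure ρ] {J β : ℝ}

/-- The coupling constants of the nearest-neighbour model, including the temperature. -/
noncomputable def latCoupling (d : ℕ) (J β : ℝ) (x y : Fin d → ℤ) : ℝ := β * coupling J x y

/-- The nearest neighbours of a site. -/
def nbrs (x : Fin d → ℤ) : Finset (Fin d → ℤ) :=
  (Finset.univ ×ˢ {1, -1} : Finset (Fin d × ℤ)).image fun p => x + Pi.single p.1 p.2

theorem card_nbrs_le (x : Fin d → ℤ) : (nbrs x).card ≤ 2 * d := by
  refine Finset.card_image_le.trans ?_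
  rw [Finset.card_product]
  simp [mul_comm]

theorem mem_nbrs {x y : Fin d → ℤ} (h : ∑ i, |x i - y i| = 1) : y ∈ nbrs x := by
  obtain ⟨i, -, hi⟩ : ∃ i ∈ Finset.univ, |x i - y i| ≠ 0 :=
    Finset.exists_ne_zero_of_sum_ne_zero (by rw [h]; exact one_ne_zero)
  have hsplit := Finset.add_sum_erase Finset.univ (fun i => |x i - y i|) (Finset.mem_univ i)
  have hnn : 0 ≤ ∑ l ∈ Finset.univ.erase i, |x l - y l| :=
    Finset.sum_nonneg fun _ _ => abs_nonneg _
  have hpos : 0 < |x i - y i| := lt_of_le_of_ne (abs_nonneg _) (Ne.symm hi)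
  have h0 : ∑ l ∈ Finset.univ.erase i, |x l - y l| = 0 := by omega
  have h1 : |x i - y i| = 1 := by omega
  rw [Finset.sum_eq_zero_iff_of_nonneg fun _ _ => abs_nonneg _] at h0
  refine Finset.mem_image.2 ⟨(i, y i - x i), ?_, ?_⟩
  · simp only [Finset.mem_product, Finset.mem_univ, true_and, Finset.mem_insert,
      Finset.mem_singleton]
    rcases abs_eq (zero_le_one' ℤ) |>.1 h1 with h | h <;> omega
  · funext l
    by_cases hl : l = i
    · subst hl; simp
    · have := abs_eq_zero.1 (h0 l (by simp [hl]))
      simp only [Pi.add_apply, Pi.single_eq_of_ne hl]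
      omega

theorem dist_eq_one_of_coupling_ne {x y : Fin d → ℤ} (h : latCoupling d J β x y ≠ 0) :
    ∑ i, |x i - y i| = 1 := by
  by_contra h'
  exact h (by simp [latCoupling, coupling, h'])

theorem latCoupling_congr {x y x' y' : Fin d → ℤ}
    (h : ∑ i, |x i - y i| = ∑ i, |x' i - y' i|) :
    latCoupling d J β x y = latCoupling d J β x' y' := by
  simp only [latCoupling, coupling, h]

theorem latCoupling_symm (x y : Fin d → ℤ) : latCoupling d J β x y = latCoupling d J β y x :=
  latCoupling_congr (Finset.sum_congr rfl fun _ _ => abs_sub_comm _ _)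

theorem latCoupling_nonneg (hJ : 0 < J) (hβ : 0 < β) (x y : Fin d → ℤ) :
    0 ≤ latCoupling d J β x y := by
  unfold latCoupling coupling
  split_ifs
  · positivity
  · simp

theorem latCoupling_le (hJ : 0 < J) (hβ : 0 < β) (x y : Fin d → ℤ) :
    latCoupling d J β x y ≤ β * J := by
  unfold latCoupling coupling
  split_ifs
  · exact le_rfl
  · simp only [mul_zero]; positivity

theorem isCoupling_latCoupling (hd : 0 < d) (hJ : 0 < J) (hβ : 0 < β) :
    IsCoupling (latCoupling d J β) (2 * d * (β * J)) where
  pos := by positivity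
  nonneg := latCoupling_nonneg hJ hβ
  symm := latCoupling_symm
  diag x := by simp [latCoupling, coupling]
  bound x s := by
    calc ∑ y ∈ s, latCoupling d J β x y
        = ∑ y ∈ s with latCoupling d J β x y ≠ 0, latCoupling d J β x y :=
          (Finset.sum_filter_ne_zero s).symm
      _ ≤ ∑ y ∈ nbrs x, latCoupling d J β x y := Finset.sum_le_sum_of_subset_of_nonneg
          (fun y hy => mem_nbrs (dist_eq_one_of_coupling_ne (Finset.mem_filter.1 hy).2))
          fun y _ _ => latCoupling_nonneg hJ hβ x y
      _ ≤ (nbrs x).card • (β * J) :=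
          Finset.sum_le_card_nsmul _ _ _ fun y _ => latCoupling_le hJ hβ x y
      _ ≤ _ := by
          rw [nsmul_eq_mul]
          refine mul_le_mul_of_nonneg_right ?_ (by positivity)
          exact_mod_cast card_nbrs_le x

theorem tendsto_box : Tendsto (box d) atTop atTop := by
  refine tendsto_atTop_finset_of_monotone (fun a b h x hx => ?_) fun x => ?_
  · simp only [box, Finset.mem_Icc, Pi.le_def] at *
    have : (a : ℤ) ≤ b := by exact_mod_cast h
    exact ⟨fun i => by have := hx.1 i; omega, fun i => by have := hx.2 i; omega⟩
  · refine ⟨maxNorm x, ?_⟩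
    simp only [box, Finset.mem_Icc, Pi.le_def]
    have h : ∀ i, (x i).natAbs ≤ maxNorm x := fun i =>
      Finset.le_sup (f := fun i => (x i).natAbs) (Finset.mem_univ i)
    exact ⟨fun i => by have := h i; omega, fun i => by have := h i; omega⟩

theorem boxTwoPoint_eq_fcorr (ρ : ProbabilityMeasure ℝ) (J β : ℝ) (L : ℕ) (x : Fin d → ℤ) :
    boxTwoPoint ρ J β L x = fcorr (ρ : Measure ℝ) (latCoupling d J β) (box d L) 0 x := by
  have hW : ∀ τ : box d L → ℝ, -β * hamiltonian J 0 (box d L) τ =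
      quad (fun a b : box d L => latCoupling d J β a b) τ := fun τ => by
    have : ∑ x : box d L, ∑ y : box d L, latCoupling d J β x y * τ x * τ y =
        β * ∑ x : box d L, ∑ y : box d L, coupling J x.1 y.1 * τ x * τ y := by
      simp only [Finset.mul_sum, latCoupling, mul_assoc]
    rw [hamiltonian, quad, this]; ring
  unfold boxTwoPoint gibbs spin
  simp only [hW]
  by_cases h : (0 : Fin d → ℤ) ∈ box d L ∧ x ∈ box d L
  · rw [fcorr_of_mem h.1 h.2]
    simp only [dif_pos h.1, dif_pos h.2]
    rfl
  · rw [fcorr, dif_neg h]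
    rcases not_and_or.1 h with h' | h' <;> simp [h']

theorem tendsto_boxTwoPoint (hd : 0 < d) {ρ : ProbabilityMeasure ℝ}
    (hρ : IsEvenSpin (ρ : Measure ℝ)) (hJ : 0 < J) (hβ : 0 < β) (x : Fin d → ℤ) :
    Tendsto (fun L => boxTwoPoint ρ J β L x) atTop
      (𝓝 (icorr (ρ : Measure ℝ) (latCoupling d J β) 0 x)) := by
  simp only [boxTwoPoint_eq_fcorr]
  exact (tendsto_fcorr hρ (isCoupling_latCoupling hd hJ hβ) 0 x).comp tendsto_box

theorem twoPoint_eq_icorr (hd : 0 < d) {ρ : ProbabilityMeasure ℝ}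
    (hρ : IsEvenSpin (ρ : Measure ℝ)) (hJ : 0 < J) (hβ : 0 < β) (x : Fin d → ℤ) :
    twoPoint ρ J β x = icorr (ρ : Measure ℝ) (latCoupling d J β) 0 x :=
  (tendsto_boxTwoPoint hd hρ hJ hβ x).limUnder_eq

/-! ### Symmetries and reflections of the lattice -/

theorem icorr_translate (hρ : IsEvenSpin ρ) (hd : 0 < d) (hJ : 0 < J) (hβ : 0 < β)
    (x y : Fin d → ℤ) :
    icorr ρ (latCoupling d J β) x y = icorr ρ (latCoupling d J β) 0 (y - x) := by
  have := icorr_map hρ (isCoupling_latCoupling hd hJ hβ) (Equiv.addRight x)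
    (fun a b => latCoupling_congr (by simp)) 0 (y - x)
  simpa using this

theorem icorr_perm (hρ : IsEvenSpin ρ) (hd : 0 < d) (hJ : 0 < J) (hβ : 0 < β)
    (σ : Equiv.Perm (Fin d)) (x : Fin d → ℤ) :
    icorr ρ (latCoupling d J β) 0 (fun i => x (σ i)) = icorr ρ (latCoupling d J β) 0 x :=
  icorr_map hρ (isCoupling_latCoupling hd hJ hβ) (Equiv.arrowCongr σ.symm (Equiv.refl ℤ))
    (fun a b => latCoupling_congr (by simpa using Equiv.sum_comp σ fun i => |a i - b i|)) 0 x

theorem icorr_sign (hρ : IsEvenSpin ρ) (hd : 0 < d) (hJ : 0 < J) (hβ : 0 < β)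
    (ε : Fin d → ℤˣ) (x : Fin d → ℤ) :
    icorr ρ (latCoupling d J β) 0 (fun i => ε i * x i) = icorr ρ (latCoupling d J β) 0 x := by
  have hε : ∀ i, (ε i : ℤ) * ε i = 1 := fun i => by
    rw [← Units.val_mul, Int.units_mul_self, Units.val_one]
  have hinv : Function.Involutive fun (x : Fin d → ℤ) i => (ε i : ℤ) * x i := fun x => by
    funext i
    simp only
    rw [← mul_assoc, hε, one_mul]
  have := icorr_map hρ (isCoupling_latCoupling hd hJ hβ) hinv.toPerm
    (fun a b => latCoupling_congr (Finset.sum_congr rfl fun i _ => by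
      have : |(ε i : ℤ)| = 1 := by rcases Int.units_eq_one_or (ε i) with h | h <;> simp [h]
      simp [← mul_sub, abs_mul, this])) 0 x
  simpa [Pi.zero_def] using this

theorem add_le_dist {x y : Fin d → ℤ} {i j : Fin d} (hij : i ≠ j) :
    |x i - y i| + |x j - y j| ≤ ∑ l, |x l - y l| := by
  rw [← Finset.sum_pair hij (f := fun l => |x l - y l|)]
  exact Finset.sum_le_sum_of_subset_of_nonneg (Finset.subset_univ _) fun _ _ _ => abs_nonneg _

/-- The reflection in the plane `2 * x j = a`. -/
def planeRefl (j : Fin d) (a : ℤ) (x : Fin d → ℤ) : Fin d → ℤ := Function.update x j (a - x j)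

theorem planeRefl_same (j : Fin d) (a : ℤ) (x : Fin d → ℤ) : planeRefl j a x j = a - x j := by
  simp [planeRefl]

theorem planeRefl_of_ne {j l : Fin d} (h : l ≠ j) (a : ℤ) (x : Fin d → ℤ) :
    planeRefl j a x l = x l := by
  simp [planeRefl, h]

/-- For even a the plane passes through sites and no bond crosses it; for odd a it lies midway
between two layers of sites and cuts only bonds between mirror images. -/
theorem isReflection_planeRefl (hJ : 0 < J) (hβ : 0 < β) (j : Fin d) (a : ℤ) :
    IsReflection (latCoupling d J β) (planeRefl j a) fun x => 2 * x j < a where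
  nonneg := latCoupling_nonneg hJ hβ
  symm := latCoupling_symm
  invol x := by
    funext l
    by_cases hl : l = j
    · subst hl; simp [planeRefl_same]
    · simp [planeRefl_of_ne hl]
  inv x y := latCoupling_congr (Finset.sum_congr rfl fun l _ => by
    by_cases hl : l = j
    · subst hl
      rw [planeRefl_same, planeRefl_same, abs_sub_comm]
      congr 1; ring
    · simp [planeRefl_of_ne hl])
  disj x h := by simp only [planeRefl_same]; omega
  fixed x h h' := by
    simp only [planeRefl_same] at h'
    funext l
    by_cases hl : l = j
    · subst hl; rw [planeRefl_same]; omega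
    · exact planeRefl_of_ne hl a x
  cross x y hx hy h := by
    have h1 := dist_eq_one_of_coupling_ne h
    have hj : |x j - planeRefl j a y j| = a - x j - y j := by
      rw [planeRefl_same, abs_of_nonpos (by omega)]; ring
    have hsplit := Finset.add_sum_erase Finset.univ (fun i => |x i - planeRefl j a y i|)
      (Finset.mem_univ j)
    have hnn : 0 ≤ ∑ l ∈ Finset.univ.erase j, |x l - planeRefl j a y l| :=
      Finset.sum_nonneg fun _ _ => abs_nonneg _
    have h0 : ∑ l ∈ Finset.univ.erase j, |x l - planeRefl j a y l| = 0 := by omega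
    rw [Finset.sum_eq_zero_iff_of_nonneg fun _ _ => abs_nonneg _] at h0
    funext l
    by_cases hl : l = j
    · subst hl; omega
    · have := abs_eq_zero.1 (h0 l (by simp [hl]))
      rw [planeRefl_of_ne hl] at this
      omega

/-- The reflection in the diagonal plane `x i - x j = a`. -/
def diagRefl (i j : Fin d) (a : ℤ) (x : Fin d → ℤ) : Fin d → ℤ := fun l =>
  if l = i then x j + a else if l = j then x i - a else x l

theorem diagRefl_left (i j : Fin d) (a : ℤ) (x : Fin d → ℤ) : diagRefl i j a x i = x j + a := by
  simp [diagRefl]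

theorem diagRefl_right {i j : Fin d} (hij : i ≠ j) (a : ℤ) (x : Fin d → ℤ) :
    diagRefl i j a x j = x i - a := by
  simp [diagRefl, hij.symm]

theorem diagRefl_of_ne {i j l : Fin d} (hi : l ≠ i) (hj : l ≠ j) (a : ℤ) (x : Fin d → ℤ) :
    diagRefl i j a x l = x l := by
  simp [diagRefl, hi, hj]

/-- Points strictly on opposite sides of a diagonal plane are at ℓ¹-distance at least 2, so no bond
joins the two open half-spaces. -/
theorem isReflection_diagRefl (hJ : 0 < J) (hβ : 0 < β) {i j : Fin d} (hij : i ≠ j) (a : ℤ) :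
    IsReflection (latCoupling d J β) (diagRefl i j a) fun x => x i - x j < a where
  nonneg := latCoupling_nonneg hJ hβ
  symm := latCoupling_symm
  invol x := by
    funext l
    by_cases hl : l = i
    · subst hl; simp [diagRefl_left, diagRefl_right hij]
    by_cases hl' : l = j
    · subst hl'; simp [diagRefl_left, diagRefl_right hij]
    · simp [diagRefl_of_ne hl hl']
  inv x y := by
    refine latCoupling_congr ?_
    rw [← Equiv.sum_comp (Equiv.swap i j) fun l => |x l - y l|]
    refine Finset.sum_congr rfl fun l _ => ?_
    by_cases hl : l = i
    · subst hl; simp [diagRefl_left]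
    by_cases hl' : l = j
    · subst hl'; simp [diagRefl_right hij]
    · simp [diagRefl_of_ne hl hl', Equiv.swap_apply_of_ne_of_ne hl hl']
  disj x h := by simp only [diagRefl_left, diagRefl_right hij]; omega
  fixed x h h' := by
    simp only [diagRefl_left, diagRefl_right hij] at h'
    funext l
    by_cases hl : l = i
    · subst hl; rw [diagRefl_left]; omega
    by_cases hl' : l = j
    · subst hl'; rw [diagRefl_right hij]; omega
    · exact diagRefl_of_ne hl hl' a x
  cross x y hx hy h := by
    have h1 := dist_eq_one_of_coupling_ne h
    have h2 := add_le_dist (x := x) (y := diagRefl i j a y) hij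
    rw [diagRefl_left, diagRefl_right hij, h1] at h2
    have h3 := neg_abs_le (x i - (y j + a))
    have h4 := le_abs_self (x j - (y i - a))
    omega

end Lattice

/-! ### Properties of the two-point function -/

section TwoPoint

variable {d : ℕ} {ρ : Measure ℝ} [IsProbabilityMeasure ρ] {J β : ℝ}

/-- Reflect in the plane midway between x and x + e_j; the origin lies on the side of x. -/
theorem icorr_plane (hρ : IsEvenSpin ρ) (hd : 0 < d) (hJ : 0 < J) (hβ : 0 < β)
    (x : Fin d → ℤ) (j : Fin d) (hx : 0 ≤ x j) :
    icorr ρ (latCoupling d J β) 0 (x + Pi.single j 1) ≤ icorr ρ (latCoupling d J β) 0 x := by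
  have h := icorr_reflection_le hρ (isCoupling_latCoupling hd hJ hβ)
    (isReflection_planeRefl hJ hβ j (2 * x j + 1)) (u := 0) (y := x)
    (by simp only [planeRefl_same, Pi.zero_apply]; omega) (by simp only [planeRefl_same]; omega)
  convert h using 2
  funext l
  by_cases hl : l = j
  · subst hl; simp only [planeRefl_same, Pi.add_apply, Pi.single_eq_same]; ring
  · simp [planeRefl_of_ne hl, hl]

/-- The diagonal plane is the one that exchanges x + e_j and x + e_i. The condition on the
coordinates puts the origin on the side of x + e_j, or on the plane. -/
theorem icorr_diag (hρ : IsEvenSpin ρ) (hd : 0 < d) (hJ : 0 < J) (hβ : 0 < β)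
    (x : Fin d → ℤ) {i j : Fin d} (hij : i ≠ j) (hx : x j ≤ x i) :
    icorr ρ (latCoupling d J β) 0 (x + Pi.single i 1) ≤
      icorr ρ (latCoupling d J β) 0 (x + Pi.single j 1) := by
  have h := icorr_reflection_le hρ (isCoupling_latCoupling hd hJ hβ)
    (isReflection_diagRefl hJ hβ hij (x i - x j)) (u := 0) (y := x + Pi.single j 1)
    (by simp only [diagRefl_left, diagRefl_right hij, Pi.zero_apply]; omega)
    (by
      simp only [diagRefl_left, diagRefl_right hij, Pi.add_apply, Pi.single_eq_same,
        Pi.single_eq_of_ne hij]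
      omega)
  convert h using 2
  funext l
  by_cases hl : l = i
  · subst hl
    simp only [diagRefl_left, Pi.add_apply, Pi.single_eq_same]; ring
  by_cases hl' : l = j
  · subst hl'
    simp only [diagRefl_right hij, Pi.add_apply, Pi.single_eq_of_ne hl,
      Pi.single_eq_of_ne (Ne.symm hl)]; ring
  · simp [diagRefl_of_ne hl hl', hl, hl']

/-- The test points may coincide, as they do in `icorr_logconvex` for p = 0; the weights of equal
points add up. -/
theorem sum_family_icorr_reflection_nonneg {V : Type*} {k : V → V → ℝ} {D : ℝ} {θ : V → V}
    {P : V → Prop} (hρ : IsEvenSpin ρ) (hk : IsCoupling k D)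
    (hr : IsReflection k θ P) {I : Type*} [Fintype I] (u : I → V) (hu : ∀ i, ¬P (θ (u i)))
    (w : I → ℝ) : 0 ≤ ∑ i, ∑ j, w i * w j * icorr ρ k (u i) (θ (u j)) := by
  classical
  set v : V → ℝ := fun x => ∑ i with u i = x, w i with hv
  have hsum : ∀ g : V → ℝ, ∑ x ∈ Finset.univ.image u, v x * g x = ∑ i, w i * g (u i) := fun g => by
    rw [← Finset.sum_fiberwise_of_maps_to (s := Finset.univ) (t := Finset.univ.image u) (g := u)
      fun i hi => Finset.mem_image_of_mem u hi]
    refine Finset.sum_congr rfl fun x _ => ?_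
    rw [hv, Finset.sum_mul]
    exact Finset.sum_congr rfl fun i hi => by rw [(Finset.mem_filter.1 hi).2]
  refine (sum_icorr_reflection_nonneg hρ hk hr (Finset.univ.image u) (fun x hx => ?_) v).trans_eq ?_
  · obtain ⟨i, -, rfl⟩ := Finset.mem_image.1 hx
    exact hu i
  · simp only [mul_assoc, ← Finset.mul_sum]
    rw [hsum fun x => ∑ y ∈ Finset.univ.image u, v y * icorr ρ k x (θ y)]
    exact Finset.sum_congr rfl fun i _ => by rw [hsum fun y => icorr ρ k (u i) (θ y)]

theorem sq_le_mul_of_quadratic_nonneg {X Y Z : ℝ}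
    (h : ∀ t : ℝ, 0 ≤ X * (t * t) + 2 * Y * t + Z) : Y ^ 2 ≤ X * Z := by
  have := discrim_le_zero h
  unfold discrim at this
  nlinarith

/-- Reflection positivity for the plane 2 x_j = n, tested on the four points 0, p, -e_j, p - e_j.
Pairs of equal offset contribute values on the axis, pairs of different offset values at ±p, and
these agree by symmetry. Hence only the sum of both values along the line is seen to be log-convex.
-/
theorem icorr_logconvex (hρ : IsEvenSpin ρ) (hd : 0 < d) (hJ : 0 < J) (hβ : 0 < β)
    (j : Fin d) (p : Fin d → ℤ) (hp : p j = 0) (n : ℕ) :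
    (icorr ρ (latCoupling d J β) 0 (Pi.single j ((n : ℤ) + 1)) +
      icorr ρ (latCoupling d J β) 0 (Pi.single j ((n : ℤ) + 1) + p)) ^ 2 ≤
    (icorr ρ (latCoupling d J β) 0 (Pi.single j (n : ℤ)) +
      icorr ρ (latCoupling d J β) 0 (Pi.single j (n : ℤ) + p)) *
    (icorr ρ (latCoupling d J β) 0 (Pi.single j ((n : ℤ) + 2)) +
      icorr ρ (latCoupling d J β) 0 (Pi.single j ((n : ℤ) + 2) + p)) := by
  set S := icorr ρ (latCoupling d J β) 0 with hS
  have hneg : ∀ a : ℤ, S (Pi.single j a - p) = S (Pi.single j a + p) := fun a => by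
    have h := icorr_sign hρ hd hJ hβ (fun l => if l = j then 1 else -1) (Pi.single j a + p)
    rw [← hS] at h
    rw [← h]
    congr 1
    funext l
    by_cases hl : l = j
    · subst hl; simp [hp]
    · simp [hl]
  have hdist : ∀ (b b' : ℤ) (q q' : Fin d → ℤ), q j = 0 → q' j = 0 →
      icorr ρ (latCoupling d J β) (Pi.single j (-b) + q)
        (planeRefl j n (Pi.single j (-b') + q')) =
        S (Pi.single j ((n : ℤ) + b + b') + (q' - q)) := fun b b' q q' hq hq' => by
    rw [icorr_translate hρ hd hJ hβ, hS]
    congr 1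
    funext l
    by_cases hl : l = j
    · subst hl; simp [planeRefl_same, hq, hq']; ring
    · simp [planeRefl_of_ne hl, hl]
  -- The weights are t on the points with j-coordinate 0 and 1 on those with j-coordinate -1, so the
  -- form is quadratic in t.
  refine sq_le_mul_of_quadratic_nonneg fun t => ?_
  have h := sum_family_icorr_reflection_nonneg hρ (isCoupling_latCoupling hd hJ hβ)
    (isReflection_planeRefl hJ hβ j n)
    (fun i : Bool × Bool => Pi.single j (-(if i.1 then 1 else 0 : ℤ)) + if i.2 then p else 0)
    (fun i => by
      rcases i with ⟨b, q⟩
      cases b <;> cases q <;> simp [planeRefl_same, hp] <;> omega)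
    (fun i => if i.1 then 1 else t)
  have hq : ∀ b : Bool, (if b then p else 0) j = 0 := fun b => by cases b <;> simp [hp]
  simp only [hdist _ _ _ _ (hq _) (hq _), Fintype.sum_prod_type, Fintype.sum_bool] at h
  simp only [if_true, Bool.false_eq_true, if_false, sub_self, sub_zero, zero_sub, add_zero,
    ← sub_eq_add_neg, hneg, add_assoc, one_add_one_eq_two] at h
  linarith

theorem latCoupling_single (j : Fin d) :
    latCoupling d J β 0 (Pi.single j 1) = β * J := by
  unfold latCoupling coupling
  rw [if_pos]
  rw [Finset.sum_eq_single j (fun l _ hl => by simp [hl]) (by simp)]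
  simp

/-- Gaussian domination for the reflection that exchanges the origin with e_j. It keeps S(0) and
S(e_j) comparable when β J times the variance is large. -/
theorem icorr_zero_sub_le (hρ : IsEvenSpin ρ) (hd : 0 < d) (hJ : 0 < J) (hβ : 0 < β) (j : Fin d) :
    2 * (β * J) * (icorr ρ (latCoupling d J β) 0 0 -
      icorr ρ (latCoupling d J β) 0 (Pi.single j 1)) ≤ 1 := by
  have hθ : planeRefl j 1 0 = Pi.single j 1 := by
    funext l
    by_cases hl : l = j
    · subst hl; simp [planeRefl_same]
    · simp [planeRefl_of_ne hl, hl]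
  have h := icorr_gaussian_domination hρ (isCoupling_latCoupling hd hJ hβ)
    (isReflection_planeRefl hJ hβ j 1) (o := 0) (by simp) (by rw [hθ, latCoupling_single]; positivity)
  rw [hθ, latCoupling_single, icorr_translate hρ hd hJ hβ (Pi.single j 1) (Pi.single j 1), sub_self] at h
  linarith

theorem icorr_zero_le_of_nbrs (hρ : IsGaussianSpin ρ) (hd : 0 < d) (hJ : 0 < J) (hβ : 0 < β)
    {B : ℝ} {x : Fin d → ℤ}
    (hB : ∀ y ∈ nbrs (0 : Fin d → ℤ), icorr ρ (latCoupling d J β) y x ≤ B) :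
    ∑ y ∈ nbrs (0 : Fin d → ℤ), latCoupling d J β 0 y * icorr ρ (latCoupling d J β) y x ≤
      2 * d * (β * J) * B := by
  have hk := isCoupling_latCoupling hd hJ hβ
  have hB0 : 0 ≤ B := by
    refine (icorr_nonneg hρ.toIsEvenSpin hk _ x).trans (hB (0 + Pi.single ⟨0, hd⟩ 1) ?_)
    exact Finset.mem_image.2 ⟨(⟨0, hd⟩, 1), by simp, rfl⟩
  calc _ ≤ ∑ y ∈ nbrs (0 : Fin d → ℤ), latCoupling d J β 0 y * B :=
        Finset.sum_le_sum fun y hy => mul_le_mul_of_nonneg_left (hB y hy) (hk.nonneg _ _)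
    _ = (∑ y ∈ nbrs (0 : Fin d → ℤ), latCoupling d J β 0 y) * B := by rw [Finset.sum_mul]
    _ ≤ _ := mul_le_mul_of_nonneg_right (hk.bound _ _) hB0

end TwoPoint

/-! ### From log-convexity to the gradient estimate -/

section LogConvex

variable {f : ℕ → ℝ}

theorem log_sub_antitone (hpos : ∀ k, 0 < f k) (hf : ∀ k, f (k + 1) ^ 2 ≤ f k * f (k + 2)) :
    Antitone fun k => Real.log (f k) - Real.log (f (k + 1)) := by
  refine antitone_nat_of_succ_le fun k => ?_
  have h := Real.log_le_log (pow_pos (hpos (k + 1)) 2) (hf k)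
  rw [Real.log_pow, Real.log_mul (hpos _).ne' (hpos _).ne'] at h
  push_cast at h
  linarith

theorem mul_log_sub_le (hpos : ∀ k, 0 < f k) (hf : ∀ k, f (k + 1) ^ 2 ≤ f k * f (k + 2))
    (m l : ℕ) :
    (l + 1) * (Real.log (f (m + l)) - Real.log (f (m + l + 1))) ≤
      Real.log (f m) - Real.log (f (m + l + 1)) := by
  have h : ∀ k ∈ Finset.range (l + 1), Real.log (f (m + l)) - Real.log (f (m + l + 1)) ≤
      Real.log (f (m + k)) - Real.log (f (m + (k + 1))) := fun k hk =>
    log_sub_antitone hpos hf (Nat.add_le_add_left (Nat.lt_succ_iff.1 (Finset.mem_range.1 hk)) m)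
  have := Finset.card_nsmul_le_sum _ _ _ h
  rw [Finset.sum_range_sub' fun k => Real.log (f (m + k)), Finset.card_range, nsmul_eq_mul] at this
  push_cast at this
  simpa [add_assoc] using this

/-- The last logarithmic decrement is the smallest of those between ⌊(n+1)/2⌋ and n + 1, of which
there are at least (n + 1) / 2. -/
theorem mul_log_sub_le_half (hpos : ∀ k, 0 < f k) (hf : ∀ k, f (k + 1) ^ 2 ≤ f k * f (k + 2))
    (hanti : Antitone f) (n : ℕ) :
    (n + 1) * (Real.log (f n) - Real.log (f (n + 1))) ≤
      2 * (Real.log (f ((n + 1) / 2)) - Real.log (f (n + 1))) := by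
  obtain ⟨l, hl⟩ : ∃ l, n = (n + 1) / 2 + l := ⟨n - (n + 1) / 2, by omega⟩
  have h := mul_log_sub_le hpos hf ((n + 1) / 2) l
  rw [← hl] at h
  have hd : 0 ≤ Real.log (f n) - Real.log (f (n + 1)) :=
    sub_nonneg.2 (Real.log_le_log (hpos _) (hanti n.le_succ))
  have hn : (n + 1 : ℝ) ≤ 2 * (l + 1) := by exact_mod_cast (by omega : n + 1 ≤ 2 * (l + 1))
  nlinarith

theorem mul_le_mul_of_logconvex (hpos : ∀ k, 0 < f k) (hf : ∀ k, f (k + 1) ^ 2 ≤ f k * f (k + 2))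
    (n : ℕ) : f n * f 1 ≤ f 0 * f (n + 1) := by
  have h := log_sub_antitone hpos hf (Nat.zero_le n)
  simp only [zero_add] at h
  rw [← Real.log_le_log_iff (mul_pos (hpos _) (hpos _)) (mul_pos (hpos _) (hpos _)),
    Real.log_mul (hpos _).ne' (hpos _).ne', Real.log_mul (hpos _).ne' (hpos _).ne']
  linarith

end LogConvex

/-- The properties of a reflection positive two-point function that imply the gradient
estimate. -/
structure IsReflectionPositive {d : ℕ} (S : (Fin d → ℤ) → ℝ) (C : ℝ) : Prop where
  one_le : 1 ≤ C
  sign : ∀ (ε : Fin d → ℤˣ) x, S (fun i => ε i * x i) = S x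
  perm : ∀ (σ : Equiv.Perm (Fin d)) x, S (fun i => x (σ i)) = S x
  plane : ∀ (x : Fin d → ℤ) j, 0 ≤ x j → S (x + Pi.single j 1) ≤ S x
  diag : ∀ (x : Fin d → ℤ) i j, i ≠ j → x j ≤ x i → S (x + Pi.single i 1) ≤ S (x + Pi.single j 1)
  logconvex : ∀ j (p : Fin d → ℤ), p j = 0 → ∀ n : ℕ,
    (S (Pi.single j ((n : ℤ) + 1)) + S (Pi.single j ((n : ℤ) + 1) + p)) ^ 2 ≤
      (S (Pi.single j (n : ℤ)) + S (Pi.single j (n : ℤ) + p)) *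
      (S (Pi.single j ((n : ℤ) + 2)) + S (Pi.single j ((n : ℤ) + 2) + p))
  -- On the axis log-convexity bounds S((n+1) e) / S(n e) from below by S(e) / S(0). This is the
  -- reverse bound, up to the factor C.
  step : ∀ j (n : ℕ), S (Pi.single j ((n : ℤ) + 1)) * S 0 ≤
    C * S (Pi.single j 1) * S (Pi.single j (n : ℤ))
  nonneg : ∀ x, 0 ≤ S x
  one_pos : ∀ j, 0 < S (Pi.single j 1)

/-! ### Comparison of S with its values on the coordinate axes. -/

namespace IsReflectionPositive

variable {d : ℕ} {S : (Fin d → ℤ) → ℝ} {C : ℝ}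

theorem axis_eq (h : IsReflectionPositive S C) (i j : Fin d) (a : ℤ) :
    S (Pi.single i a) = S (Pi.single j a) := by
  rw [← h.perm (Equiv.swap i j) (Pi.single j a)]
  congr 1
  funext l
  simp only [Pi.single_apply]
  congr 1
  rw [eq_iff_iff, Equiv.swap_apply_eq_iff, Equiv.swap_apply_right]

theorem add_single_le (h : IsReflectionPositive S C) (x : Fin d → ℤ) (j : Fin d) (hx : 0 ≤ x j)
    (m : ℕ) : S (x + Pi.single j (m : ℤ)) ≤ S x := by
  induction m with
  | zero => simp
  | succ m ih =>
    have := h.plane (x + Pi.single j (m : ℤ)) j (by simp; omega)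
    rw [add_assoc, ← Pi.single_add] at this
    push_cast
    exact this.trans ih

theorem add_le (h : IsReflectionPositive S C) (x y : Fin d → ℤ) (hx : 0 ≤ x) (hy : 0 ≤ y) :
    S (x + y) ≤ S x := by
  have key : ∀ s : Finset (Fin d), S (x + ∑ i ∈ s, Pi.single i (y i)) ≤ S x := fun s => by
    induction s using Finset.induction_on with
    | empty => simp
    | insert a s ha ih =>
      rw [Finset.sum_insert ha, add_comm (Pi.single a (y a) : Fin d → ℤ), ← add_assoc]
      obtain ⟨m, hm⟩ := Int.eq_ofNat_of_zero_le (hy a)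
      rw [hm]
      refine (h.add_single_le _ a ?_ m).trans ih
      rw [Pi.add_apply, Finset.sum_apply]
      refine add_nonneg (hx a) (Finset.sum_nonneg fun i _ => ?_)
      rw [Pi.single_apply]
      split_ifs
      exacts [hy i, le_rfl]
  simpa [Finset.univ_sum_single] using key Finset.univ

theorem le_axis (h : IsReflectionPositive S C) {x : Fin d → ℤ} (hx : 0 ≤ x) (j : Fin d) :
    S x ≤ S (Pi.single j (x j)) := by
  have := h.add_le (Pi.single j (x j)) (x - Pi.single j (x j)) (fun l => ?_) (fun l => ?_)
  · simpa using this
  · by_cases hl : l = j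
    · subst hl; simpa using hx l
    · simp [hl]
  · by_cases hl : l = j
    · subst hl; simp
    · simpa [hl] using hx l

theorem axis_antitone (h : IsReflectionPositive S C) (j : Fin d) :
    Antitone fun n : ℕ => S (Pi.single j (n : ℤ)) := by
  refine antitone_nat_of_succ_le fun n => ?_
  have := h.plane (Pi.single j (n : ℤ)) j (by simp)
  rw [← Pi.single_add] at this
  exact_mod_cast this

theorem transfer (h : IsReflectionPositive S C) {i j : Fin d} (hij : i ≠ j) (m : ℕ)
    (x : Fin d → ℤ) (hx : x i + m ≤ x j) :
    S (x + Pi.single j (m : ℤ)) ≤ S (x + Pi.single i (m : ℤ)) := by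
  induction m generalizing x with
  | zero => simp
  | succ m ih =>
    push_cast at *
    have h1 := ih (x + Pi.single j 1) (by simp [hij]; omega)
    have h2 := h.diag (x + Pi.single i (m : ℤ)) j i hij.symm (by simp [hij.symm]; omega)
    calc _ = S (x + Pi.single j 1 + Pi.single j (m : ℤ)) := by
          rw [add_assoc, ← Pi.single_add, add_comm (1 : ℤ)]
      _ ≤ S (x + Pi.single j 1 + Pi.single i (m : ℤ)) := h1
      _ = S (x + Pi.single i (m : ℤ) + Pi.single j 1) := by rw [add_right_comm]
      _ ≤ _ := h2
      _ = _ := by rw [add_assoc, ← Pi.single_add]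

/-- Diagonal reflections move the coordinates, one after the other, onto the largest one, and each
move decreases S. This lower bound of S(x) by S(‖x‖₁ e) is the origin of d n in the gradient factor.
-/
theorem axis_le (h : IsReflectionPositive S C) {x : Fin d → ℤ} (hx : 0 ≤ x) {j : Fin d}
    (hj : ∀ i, x i ≤ x j) : S (Pi.single j (∑ i, x i)) ≤ S x := by
  have key : ∀ s : Finset (Fin d), j ∉ s →
      S (x + ∑ i ∈ s, (Pi.single j (x i) - Pi.single i (x i))) ≤ S x := fun s => by
    induction s using Finset.induction_on with
    | empty => simp
    | insert a s ha ih =>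
      intro hjs
      rw [Finset.mem_insert, not_or] at hjs
      have haj : a ≠ j := fun h => hjs.1 h.symm
      refine le_trans ?_ (ih hjs.2)
      set z := x + ∑ i ∈ s, (Pi.single j (x i) - Pi.single i (x i)) with hz
      have hza : z a = x a := by
        rw [hz, Pi.add_apply, Finset.sum_apply, Finset.sum_eq_zero, add_zero]
        intro i hi
        have : a ≠ i := fun h => ha (h ▸ hi)
        simp [haj, this]
      have hzj : x j ≤ z j := by
        rw [hz, Pi.add_apply, Finset.sum_apply]
        refine le_add_of_nonneg_right (Finset.sum_nonneg fun i hi => ?_)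
        have : j ≠ i := fun h => hjs.2 (h ▸ hi)
        simpa [this] using hx i
      obtain ⟨m, hm⟩ := Int.eq_ofNat_of_zero_le (hx a)
      have := h.transfer haj m (z - Pi.single a (m : ℤ)) (by
        have := hj a
        simp only [Pi.sub_apply, Pi.single_eq_same, Pi.single_eq_of_ne haj.symm]
        omega)
      rw [sub_add_cancel] at this
      rw [Finset.sum_insert ha, hm]
      refine le_trans (le_of_eq ?_) this
      congr 1
      rw [hz]; abel
  have h1 := key (Finset.univ.erase j) (by simp)
  convert h1 using 2
  have h2 := Finset.univ_sum_single x
  rw [← Finset.add_sum_erase _ _ (Finset.mem_univ j)] at h2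
  rw [Finset.sum_sub_distrib, ← Finset.add_sum_erase _ _ (Finset.mem_univ j), Pi.single_add]
  nth_rewrite 3 [← h2]
  have h3 : Pi.single j (∑ i ∈ Finset.univ.erase j, x i) =
      ∑ i ∈ Finset.univ.erase j, (Pi.single j (x i) : Fin d → ℤ) :=
    map_sum (AddMonoidHom.single (fun _ : Fin d => ℤ) j) _ _
  rw [h3]
  abel

theorem axis_logconvex (h : IsReflectionPositive S C) (j : Fin d) (n : ℕ) :
    S (Pi.single j ((n + 1 : ℕ) : ℤ)) ^ 2 ≤
      S (Pi.single j (n : ℤ)) * S (Pi.single j ((n + 2 : ℕ) : ℤ)) := by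
  have := h.logconvex j 0 rfl n
  simp only [add_zero] at this
  push_cast
  linarith

theorem axis_pos (h : IsReflectionPositive S C) (j : Fin d) (n : ℕ) :
    0 < S (Pi.single j (n : ℤ)) := by
  have key : ∀ n : ℕ, 0 < S (Pi.single j (n : ℤ)) ∧ 0 < S (Pi.single j ((n + 1 : ℕ) : ℤ)) := by
    intro n
    induction n with
    | zero =>
      have h1 := h.axis_antitone j (Nat.zero_le 1)
      have h2 := h.one_pos j
      simp only [Nat.cast_zero, Nat.cast_one, zero_add] at *
      exact ⟨h2.trans_le h1, h2⟩
    | succ n ih =>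
      refine ⟨ih.2, lt_of_le_of_ne (h.nonneg _) fun h0 => ?_⟩
      have := h.axis_logconvex j n
      rw [add_assoc] at h0
      norm_num at h0 this
      rw [← h0, mul_zero] at this
      have := ih.2
      norm_num at this
      nlinarith
  exact (key n).1

end IsReflectionPositive

/-! ### The gradient estimate along lattice lines and its extension to all points and directions. -/

namespace IsReflectionPositive

variable {d : ℕ} {S : (Fin d → ℤ) → ℝ} {C : ℝ}

/-- The sequence along a lattice line, symmetrized with the axis. -/
def lineSum (S : (Fin d → ℤ) → ℝ) (j : Fin d) (p : Fin d → ℤ) (n : ℕ) : ℝ :=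
  S (Pi.single j (n : ℤ)) + S (Pi.single j (n : ℤ) + p)

theorem lineSum_pos (h : IsReflectionPositive S C) (j : Fin d) (p : Fin d → ℤ) (n : ℕ) :
    0 < lineSum S j p n :=
  add_pos_of_pos_of_nonneg (h.axis_pos j n) (h.nonneg _)

theorem lineSum_logconvex (h : IsReflectionPositive S C) {j : Fin d} {p : Fin d → ℤ}
    (hp : p j = 0) (n : ℕ) :
    lineSum S j p (n + 1) ^ 2 ≤ lineSum S j p n * lineSum S j p (n + 2) := by
  have := h.logconvex j p hp n
  unfold lineSum
  push_cast
  exact this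

theorem lineSum_antitone (h : IsReflectionPositive S C) {j : Fin d} {p : Fin d → ℤ}
    (hp : p j = 0) : Antitone (lineSum S j p) := by
  refine antitone_nat_of_succ_le fun n => ?_
  have := h.plane (Pi.single j (n : ℤ) + p) j (by simp [hp])
  rw [add_right_comm, ← Pi.single_add] at this
  refine add_le_add (h.axis_antitone j n.le_succ) ?_
  push_cast
  exact this

theorem lineSum_le (h : IsReflectionPositive S C) (j : Fin d) {p : Fin d → ℤ}
    (hp : 0 ≤ p) (n : ℕ) : lineSum S j p n ≤ 2 * S (Pi.single j (n : ℤ)) := by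
  have := h.add_le (Pi.single j (n : ℤ)) p (by simp) hp
  unfold lineSum
  linarith

/-- The logarithm in the gradient estimate. -/
noncomputable def dropLog (S : (Fin d → ℤ) → ℝ) (j : Fin d) (n : ℕ) : ℝ :=
  Real.log (2 * S (Pi.single j ((n / 2 : ℕ) : ℤ)) / S (Pi.single j (n : ℤ)))

theorem dropLog_nonneg (h : IsReflectionPositive S C) (j : Fin d) (n : ℕ) :
    0 ≤ dropLog S j n := by
  refine Real.log_nonneg ?_
  rw [le_div_iff₀ (h.axis_pos j n)]
  have h1 := h.axis_antitone j (Nat.div_le_self n 2)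
  have h2 := h.axis_pos j n
  simp only at h1
  linarith

/-- Here the 2 inside the logarithm arises: at the half scale the off-axis term is at most the axis
term, and at scale n + 1 it is dropped. -/
theorem log_lineSum_le (h : IsReflectionPositive S C) {j : Fin d} {p : Fin d → ℤ}
    (hp : p j = 0) (hp' : 0 ≤ p) (n : ℕ) :
    (n + 1) * (Real.log (lineSum S j p n) - Real.log (lineSum S j p (n + 1))) ≤
      2 * dropLog S j (n + 1) := by
  refine (mul_log_sub_le_half (h.lineSum_pos j p) (h.lineSum_logconvex hp)
    (h.lineSum_antitone hp) n).trans (mul_le_mul_of_nonneg_left ?_ zero_le_two)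
  rw [dropLog, Real.log_div (mul_pos two_pos (h.axis_pos j _)).ne' (h.axis_pos j _).ne']
  refine sub_le_sub (Real.log_le_log (h.lineSum_pos j p _) (h.lineSum_le j hp' _))
    (Real.log_le_log (h.axis_pos j _) ?_)
  exact le_add_of_nonneg_right (h.nonneg _)

theorem exp_sub_one_le {l : ℝ} (h0 : 0 ≤ l) (h1 : l ≤ 1) : Real.exp l - 1 ≤ 2 * l := by
  have := Real.abs_exp_sub_one_le (x := l) (by rwa [abs_of_nonneg h0])
  rw [abs_of_nonneg h0] at this
  exact (le_abs_self _).trans this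

theorem sub_le_mul_log {a b : ℝ} (ha : 0 < a) (hb : 0 < b) :
    a - b ≤ a * (Real.log a - Real.log b) := by
  have h := Real.log_le_sub_one_of_pos (div_pos hb ha)
  rw [Real.log_div hb.ne' ha.ne'] at h
  have h2 : a * (b / a - 1) = b - a := by field_simp
  nlinarith

theorem sub_le_mul_log_of_le {a b : ℝ} (ha : 0 < a) (hb : 0 < b) (hab : b ≤ a)
    (h1 : Real.log a - Real.log b ≤ 1) : a - b ≤ 2 * b * (Real.log a - Real.log b) := by
  have h := exp_sub_one_le (sub_nonneg.2 (Real.log_le_log hb hab)) h1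
  rw [Real.exp_sub, Real.exp_log ha, Real.exp_log hb] at h
  have h2 : b * (a / b - 1) = a - b := by field_simp
  nlinarith

/-- The forward difference in the direction of a largest coordinate. -/
theorem forward_le (h : IsReflectionPositive S C) {x : Fin d → ℤ} (hx : 0 ≤ x) {j : Fin d} {n : ℕ}
    (hn : x j = (n + 1 : ℕ)) :
    (n + 1) * (S x - S (x + Pi.single j 1)) ≤
      4 * S (Pi.single j ((n + 1 : ℕ) : ℤ)) * dropLog S j (n + 1) := by
  set p := x - Pi.single j (x j) with hpdef
  have hp : p j = 0 := by simp [hpdef]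
  have hp' : 0 ≤ p := fun l => by
    by_cases hl : l = j
    · subst hl; simp [hpdef]
    · simpa [hpdef, hl] using hx l
  have hxp : Pi.single j ((n + 1 : ℕ) : ℤ) + p = x := by rw [hpdef, hn]; simp
  have hxp' : Pi.single j ((n + 2 : ℕ) : ℤ) + p = x + Pi.single j 1 := by
    rw [← hxp, add_right_comm, ← Pi.single_add]
    push_cast
    rw [add_assoc, one_add_one_eq_two]
  set f := lineSum S j p
  have hpos := h.lineSum_pos j p
  -- The decrement of the axis term is nonnegative, so adding it only enlarges the difference.
  have h1 : S x - S (x + Pi.single j 1) ≤ f (n + 1) - f (n + 2) := by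
    have := h.axis_antitone j (Nat.le_succ (n + 1))
    simp only [f, lineSum, hxp, hxp']
    simp only at this
    linarith
  have h2 := sub_le_mul_log (hpos (n + 1)) (hpos (n + 2))
  have h3 := log_sub_antitone hpos (h.lineSum_logconvex hp) (Nat.le_succ n)
  simp only [Nat.succ_eq_add_one, add_assoc, one_add_one_eq_two] at h3
  have h4 := h.log_lineSum_le hp hp' n
  have h5 := h.lineSum_le j hp' (n + 1)
  have h6 := h.dropLog_nonneg j (n + 1)
  have hn0 : (0 : ℝ) ≤ n + 1 := by positivity
  calc (n + 1) * (S x - S (x + Pi.single j 1))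
      ≤ (n + 1) * (f (n + 1) * (Real.log (f n) - Real.log (f (n + 1)))) := by
        refine mul_le_mul_of_nonneg_left ?_ hn0
        exact h1.trans (h2.trans (mul_le_mul_of_nonneg_left h3 (hpos _).le))
    _ = f (n + 1) * ((n + 1) * (Real.log (f n) - Real.log (f (n + 1)))) := by ring
    _ ≤ f (n + 1) * (2 * dropLog S j (n + 1)) := mul_le_mul_of_nonneg_left h4 (hpos _).le
    _ ≤ 2 * S (Pi.single j ((n + 1 : ℕ) : ℤ)) * (2 * dropLog S j (n + 1)) :=
        mul_le_mul_of_nonneg_right h5 (by positivity)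
    _ = _ := by ring

/-- The backward difference in the direction of a largest coordinate: either it is small, or the
two-point function drops exponentially fast. -/
theorem backward_le (h : IsReflectionPositive S C) {x : Fin d → ℤ} (hx : 0 ≤ x) {j : Fin d} {n : ℕ}
    (hn : x j = (n + 1 : ℕ)) :
    (n + 1) * (S (x - Pi.single j 1) - S x) ≤
      8 * S (Pi.single j ((n + 1 : ℕ) : ℤ)) * dropLog S j (n + 1) ∨
    n + 1 ≤ 2 * dropLog S j (n + 1) := by
  set p := x - Pi.single j (x j) with hpdef
  have hp : p j = 0 := by simp [hpdef]
  have hp' : 0 ≤ p := fun l => by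
    by_cases hl : l = j
    · subst hl; simp [hpdef]
    · simpa [hpdef, hl] using hx l
  have hxp : Pi.single j ((n + 1 : ℕ) : ℤ) + p = x := by rw [hpdef, hn]; simp
  have hxp' : Pi.single j (n : ℤ) + p = x - Pi.single j 1 := by
    rw [← hxp]
    push_cast
    rw [Pi.single_add]; abel
  set f := lineSum S j p
  have hpos := h.lineSum_pos j p
  have h4 := h.log_lineSum_le hp hp' n
  have hn0 : (0 : ℝ) < n + 1 := by positivity
  -- Here a - b ≤ a (log a - log b) would leave the value at n, whereas the value at n + 1 is
  -- wanted. This costs a factor 2 and needs the logarithmic decrement to be at most 1; otherwise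
  -- the average bound itself gives the second alternative.
  by_cases hl : Real.log (f n) - Real.log (f (n + 1)) ≤ 1
  · left
    have h1 : S (x - Pi.single j 1) - S x ≤ f n - f (n + 1) := by
      have := h.axis_antitone j (Nat.le_succ n)
      simp only [f, lineSum, hxp, hxp']
      simp only [Nat.succ_eq_add_one] at this
      linarith
    have h2 := sub_le_mul_log_of_le (hpos n) (hpos (n + 1)) (h.lineSum_antitone hp n.le_succ) hl
    have h5 := h.lineSum_le j hp' (n + 1)
    have h6 := h.dropLog_nonneg j (n + 1)
    calc (n + 1) * (S (x - Pi.single j 1) - S x)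
        ≤ (n + 1) * (2 * f (n + 1) * (Real.log (f n) - Real.log (f (n + 1)))) :=
          mul_le_mul_of_nonneg_left (h1.trans h2) hn0.le
      _ = 2 * f (n + 1) * ((n + 1) * (Real.log (f n) - Real.log (f (n + 1)))) := by ring
      _ ≤ 2 * f (n + 1) * (2 * dropLog S j (n + 1)) :=
          mul_le_mul_of_nonneg_left h4 (mul_pos two_pos (hpos _)).le
      _ ≤ 2 * (2 * S (Pi.single j ((n + 1 : ℕ) : ℤ))) * (2 * dropLog S j (n + 1)) :=
          mul_le_mul_of_nonneg_right (mul_le_mul_of_nonneg_left h5 zero_le_two) (by positivity)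
      _ = _ := by ring
  · right
    push Not at hl
    exact (le_mul_of_one_le_right hn0.le hl.le).trans h4

/-- A crude comparison of neighbours, for two-point functions that drop fast. -/
theorem sub_single_mul_le (h : IsReflectionPositive S C) (hd : 2 ≤ d) {x : Fin d → ℤ} (hx : 0 ≤ x)
    {j : Fin d} (hj : ∀ i, x i ≤ x j) {n : ℕ} (hn : x j = (n + 1 : ℕ)) :
    S (x - Pi.single j 1) * S (Pi.single j ((d * (n + 1) : ℕ) : ℤ)) ≤
      C * S (Pi.single j ((n + 1 : ℕ) : ℤ)) * S x := by
  have hy : 0 ≤ x - Pi.single j 1 := fun l => by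
    by_cases hl : l = j
    · subst hl; simp [hn]
    · simpa [hl] using hx l
  obtain ⟨m, hm⟩ := Int.eq_ofNat_of_zero_le (Finset.sum_nonneg fun i (_ : i ∈ Finset.univ) => hx i)
  have hSm := h.axis_le hx hj
  rw [hm] at hSm
  have hle : ∑ i, x i ≤ ∑ _i : Fin d, ((n + 1 : ℕ) : ℤ) := Finset.sum_le_sum fun i _ => hn ▸ hj i
  have hmd : m ≤ d * (n + 1) := by
    rw [hm] at hle
    simp only [Finset.sum_const, Finset.card_univ, Fintype.card_fin, nsmul_eq_mul] at hle
    exact_mod_cast hle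
  have hA := h.axis_pos j
  have hC := h.one_le
  -- With m = ‖x‖₁ < d (n + 1) there is room for one more step on the axis: log-convexity gives S(n
  -- e) ≤ S((n+1) e) S(0) / S(e), `step` gives S((m+1) e) ≤ C S(m e) S(e) / S(0), and in the product
  -- S(0) and S(e) cancel.
  rcases hmd.lt_or_eq with hlt | heq
  · have h1 : S (x - Pi.single j 1) ≤ S (Pi.single j (n : ℤ)) := by
      refine (h.le_axis hy j).trans_eq ?_
      simp [hn]
    have h2 : S (Pi.single j (n : ℤ)) * S (Pi.single j 1) ≤
        S 0 * S (Pi.single j ((n + 1 : ℕ) : ℤ)) := by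
      have := mul_le_mul_of_logconvex hA (h.axis_logconvex j) n
      simpa using this
    have h3 : S (Pi.single j ((d * (n + 1) : ℕ) : ℤ)) ≤ S (Pi.single j ((m + 1 : ℕ) : ℤ)) :=
      h.axis_antitone j hlt
    have h4 := h.step j m
    have h0 : 0 < S 0 := by simpa using hA 0
    have hA1 := h.one_pos j
    refine le_of_mul_le_mul_right ?_ (mul_pos h0 hA1)
    calc _ ≤ S (Pi.single j (n : ℤ)) * S (Pi.single j ((m + 1 : ℕ) : ℤ)) *
          (S 0 * S (Pi.single j 1)) :=
          mul_le_mul_of_nonneg_right (mul_le_mul h1 h3 (h.nonneg _) (h.nonneg _))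
            (mul_pos h0 hA1).le
      _ = (S (Pi.single j (n : ℤ)) * S (Pi.single j 1)) *
          (S (Pi.single j ((m : ℤ) + 1)) * S 0) := by push_cast; ring
      _ ≤ (S 0 * S (Pi.single j ((n + 1 : ℕ) : ℤ))) *
          (C * S (Pi.single j 1) * S (Pi.single j (m : ℤ))) :=
          mul_le_mul h2 h4 (mul_nonneg (h.nonneg _) h0.le) (mul_nonneg h0.le (h.nonneg _))
      _ ≤ (S 0 * S (Pi.single j ((n + 1 : ℕ) : ℤ))) * (C * S (Pi.single j 1) * S x) :=
          mul_le_mul_of_nonneg_left (mul_le_mul_of_nonneg_left hSm (by positivity))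
            (mul_nonneg h0.le (h.nonneg _))
      _ = _ := by ring
  -- In the extreme case x = (n+1, …, n+1). As d ≥ 2, another coordinate of x - e_j still equals n +
  -- 1, so no step on the axis is lost.
  · have hall : ∀ i, x i = (n + 1 : ℕ) := fun i => by
      refine (Finset.sum_eq_sum_iff_of_le fun i _ => hn ▸ hj i).1 (?_ : ∑ i, x i = _) i
        (Finset.mem_univ i)
      rw [hm, heq]
      simp
    have : Nontrivial (Fin d) := Fin.nontrivial_iff_two_le.2 hd
    obtain ⟨l, hl⟩ := exists_ne j
    have h1 : S (x - Pi.single j 1) ≤ S (Pi.single j ((n + 1 : ℕ) : ℤ)) := by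
      refine (h.le_axis hy l).trans_eq ?_
      rw [← h.axis_eq l j]
      simp [hl, hall]
    rw [heq] at hSm
    have := mul_le_mul h1 hSm (h.nonneg _) (h.nonneg _)
    refine this.trans ?_
    rw [mul_assoc]
    exact le_mul_of_one_le_left (mul_nonneg (h.nonneg _) (h.nonneg _)) hC

/-- The gradient estimate in the direction of a largest coordinate. -/
theorem gradient_max (h : IsReflectionPositive S C) (hd : 2 ≤ d) {x : Fin d → ℤ} (hx : 0 ≤ x)
    {j : Fin d} (hj : ∀ i, x i ≤ x j) {n : ℕ} (hn : x j = (n + 1 : ℕ)) {B : ℝ}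
    (hB : B = (8 + 2 * C) * (S (Pi.single j ((n + 1 : ℕ) : ℤ)) /
      S (Pi.single j ((d * (n + 1) : ℕ) : ℤ))) * dropLog S j (n + 1) / (n + 1) * S x) :
    S x - S (x + Pi.single j 1) ≤ B ∧ S (x - Pi.single j 1) - S x ≤ B := by
  set A := S (Pi.single j ((n + 1 : ℕ) : ℤ)) with hAdef
  set A' := S (Pi.single j ((d * (n + 1) : ℕ) : ℤ)) with hAdef'
  set Λ := dropLog S j (n + 1)
  have hA : 0 < A := h.axis_pos j _
  have hA' : 0 < A' := h.axis_pos j _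
  have hΛ : 0 ≤ Λ := h.dropLog_nonneg j _
  have hn0 : (0 : ℝ) < n + 1 := by positivity
  have hC := h.one_le
  have hS := h.nonneg x
  have hA'x : A' ≤ S x := by
    obtain ⟨m, hm⟩ := Int.eq_ofNat_of_zero_le
      (Finset.sum_nonneg fun i (_ : i ∈ Finset.univ) => hx i)
    have hle : ∑ i, x i ≤ ∑ _i : Fin d, ((n + 1 : ℕ) : ℤ) :=
      Finset.sum_le_sum fun i _ => hn ▸ hj i
    have hSm := h.axis_le hx hj
    rw [hm] at hSm hle
    simp only [Finset.sum_const, Finset.card_univ, Fintype.card_fin, nsmul_eq_mul] at hle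
    exact (h.axis_antitone j (by exact_mod_cast hle : m ≤ d * (n + 1))).trans hSm
  have hratio : A ≤ A / A' * S x := by
    rw [div_mul_eq_mul_div, le_div_iff₀ hA']
    exact mul_le_mul_of_nonneg_left hA'x hA.le
  have key : ∀ t : ℝ, (n + 1) * t ≤ 8 * A * Λ → t ≤ B := fun t ht => by
    have h1 : t ≤ 8 * A * Λ / (n + 1) := by rw [le_div_iff₀ hn0]; linarith
    refine h1.trans ?_
    rw [hB, div_mul_eq_mul_div, div_le_div_iff_of_pos_right hn0]
    have h2 : 8 * A * Λ ≤ 8 * (A / A' * S x) * Λ := by gcongr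
    have h3 : 0 ≤ 2 * C * (A / A' * S x) * Λ := by positivity
    nlinarith
  refine ⟨key _ ((h.forward_le hx hn).trans ?_), ?_⟩
  · gcongr; norm_num
  · rcases h.backward_le hx hn with h1 | h1
    · exact key _ h1
    -- Fast drop: since n + 1 ≤ 2 Λ, the factor Λ / (n + 1) in B is at least 1/2, and the crude
    -- comparison suffices. This accounts for 2 C in the constant; the 8 covers the regular case.
    · have h2 := h.sub_single_mul_le hd hx hj hn
      have h3 : S (x - Pi.single j 1) ≤ C * (A / A') * S x := by
        rw [mul_div_assoc', div_mul_eq_mul_div, le_div_iff₀ hA']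
        exact h2
      have h4 : S (x - Pi.single j 1) ≤ B := by
        rw [hB, div_mul_eq_mul_div, le_div_iff₀ hn0]
        have h5 : 0 ≤ C * (A / A') * S x := by positivity
        have h6 : 0 ≤ 8 * (A / A') * Λ * S x := by positivity
        calc _ ≤ C * (A / A') * S x * (2 * Λ) := mul_le_mul h3 h1 hn0.le h5
          _ ≤ _ := by nlinarith
      linarith

/-- The gradient estimate at points with nonnegative coordinates. -/
theorem gradient_nonneg (h : IsReflectionPositive S C) (hd : 2 ≤ d) {x : Fin d → ℤ} (hx : 0 ≤ x)
    {j : Fin d} (hj : ∀ i, x i ≤ x j) {n : ℕ} (hn : x j = (n + 1 : ℕ)) {B : ℝ}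
    (hB : B = (8 + 2 * C) * (S (Pi.single j ((n + 1 : ℕ) : ℤ)) /
      S (Pi.single j ((d * (n + 1) : ℕ) : ℤ))) * dropLog S j (n + 1) / (n + 1) * S x) (i : Fin d) :
    |S (x + Pi.single i 1) - S x| ≤ B ∧ (1 ≤ x i → |S (x - Pi.single i 1) - S x| ≤ B) := by
  obtain ⟨h1, h2⟩ := h.gradient_max hd hx hj hn hB
  refine ⟨?_, fun hi => ?_⟩
  · have h3 := h.plane x i (hx i)
    -- A step along the largest coordinate changes S the most, by diagonal reflection.
    have h4 : S (x + Pi.single j 1) ≤ S (x + Pi.single i 1) := by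
      by_cases hij : j = i
      · rw [hij]
      · exact h.diag x j i hij (hj i)
    rw [abs_sub_comm, abs_of_nonneg (sub_nonneg.2 h3)]
    linarith
  · have h3 := h.plane (x - Pi.single i 1) i (by simpa using hi)
    rw [sub_add_cancel] at h3
    have h4 : S (x - Pi.single i 1) ≤ S (x - Pi.single j 1) := by
      by_cases hij : j = i
      · rw [hij]
      · have := h.diag (x - Pi.single i 1 - Pi.single j 1) j i hij (by
          simp [hij, Ne.symm hij, hj i])
        rwa [sub_add_cancel, sub_right_comm, sub_add_cancel] at this
    rw [abs_of_nonneg (sub_nonneg.2 h3)]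
    linarith

theorem axisPoint_eq_single (hd : 0 < d) (n : ℕ) :
    axisPoint d n = Pi.single ⟨0, hd⟩ (n : ℤ) := by
  funext i
  simp only [axisPoint, Pi.single_apply, Fin.ext_iff]

theorem apply_axisPoint (h : IsReflectionPositive S C) (j : Fin d) (n : ℕ) :
    S (axisPoint d n) = S (Pi.single j (n : ℤ)) := by
  rw [axisPoint_eq_single j.pos, h.axis_eq _ j]

/-- Sign changes of the coordinates bring x into the positive orthant, where `gradient_nonneg`
applies. -/
theorem gradient (h : IsReflectionPositive S C) (hd : 2 ≤ d) {x : Fin d → ℤ} (hx : x ≠ 0)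
    (i : Fin d) {s : ℤ} (hs : s = 1 ∨ s = -1) :
    |S (x + Pi.single i s) - S x| ≤
      gradientFactor d S (8 + 2 * C) (maxNorm x) / (maxNorm x : ℝ) * S x := by
  obtain ⟨j, -, hj⟩ : ∃ j ∈ Finset.univ, maxNorm x = (x j).natAbs :=
    Finset.exists_mem_eq_sup _ ⟨i, Finset.mem_univ i⟩ _
  have hle : ∀ l, (x l).natAbs ≤ maxNorm x := fun l =>
    Finset.le_sup (f := fun i => (x i).natAbs) (Finset.mem_univ l)
  obtain ⟨n, hn⟩ : ∃ n, maxNorm x = n + 1 := by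
    refine Nat.exists_eq_succ_of_ne_zero fun h0 => hx (funext fun l => ?_)
    have := hle l
    simp only [Pi.zero_apply]
    omega
  -- At a vanishing coordinate the sign is free and is chosen so that the step becomes +1. A
  -- backward step then occurs only at coordinates at least 1.
  set ε : Fin d → ℤˣ := fun l => if x l < 0 ∨ (x l = 0 ∧ s = -1) then -1 else 1 with hε
  set y : Fin d → ℤ := fun l => ε l * x l with hy
  have hyabs : ∀ l, y l = (x l).natAbs := fun l => by
    simp only [hy, hε]
    split_ifs with hc
    · rw [Units.val_neg, Units.val_one]; omega
    · rw [Units.val_one]; omega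
  have hSy : S y = S x := h.sign ε x
  have hshift : S (y + Pi.single i (ε i * s)) = S (x + Pi.single i s) := by
    refine Eq.trans ?_ (h.sign ε _)
    congr 1
    funext l
    by_cases hl : l = i
    · subst hl; simp [hy, mul_add]
    · simp [hy, hl]
  have hyj : ∀ l, y l ≤ y j := fun l => by
    rw [hyabs, hyabs, ← hj]; exact_mod_cast hle l
  have hyn : y j = (n + 1 : ℕ) := by rw [hyabs, ← hj, hn]
  obtain ⟨h1, h2⟩ := h.gradient_nonneg hd (fun l => by rw [hyabs]; simp) hyj hyn rfl i
  have hgoal : gradientFactor d S (8 + 2 * C) (maxNorm x) / (maxNorm x : ℝ) * S x =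
      (8 + 2 * C) * (S (Pi.single j ((n + 1 : ℕ) : ℤ)) /
      S (Pi.single j ((d * (n + 1) : ℕ) : ℤ))) * dropLog S j (n + 1) / (n + 1) * S y := by
    rw [gradientFactor, dropLog, hSy, hn]
    simp only [h.apply_axisPoint j]
    push_cast
    rfl
  rw [hgoal, ← hshift, ← hSy]
  have hcase : (ε i * s = 1) ∨ (ε i * s = -1 ∧ 1 ≤ y i) := by
    rw [hyabs]
    simp only [hε]
    split_ifs with hc
    · rw [Units.val_neg, Units.val_one]; omega
    · rw [Units.val_one]; omega
  rcases hcase with hc | ⟨hc, hc'⟩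
  · rw [hc]; exact h1
  · rw [hc, Pi.single_neg, ← sub_eq_add_neg]; exact h2 hc'

end IsReflectionPositive

/-! ### The lattice two-point function satisfies the hypotheses of the deterministic estimate. -/

section Conclusion

variable {d : ℕ} {ρ : Measure ℝ} [IsProbabilityMeasure ρ] {J β : ℝ}

theorem icorr_single_neg (hρ : IsEvenSpin ρ) (hd : 0 < d) (hJ : 0 < J) (hβ : 0 < β)
    {x : Fin d → ℤ} {i : Fin d} (hx : x i = 0) (s : ℤ) :
    icorr ρ (latCoupling d J β) 0 (x + Pi.single i (-s)) =
      icorr ρ (latCoupling d J β) 0 (x + Pi.single i s) := by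
  have h := icorr_sign hρ hd hJ hβ (fun l => if l = i then -1 else 1) (x + Pi.single i s)
  rw [← h]
  congr 1
  funext l
  by_cases hl : l = i
  · subst hl; simp [hx]
  · simp [hl]

theorem icorr_nbr_zero (hρ : IsEvenSpin ρ) (hd : 0 < d) (hJ : 0 < J) (hβ : 0 < β) (j : Fin d)
    {y : Fin d → ℤ} (hy : y ∈ nbrs (0 : Fin d → ℤ)) :
    icorr ρ (latCoupling d J β) y 0 = icorr ρ (latCoupling d J β) 0 (Pi.single j 1) := by
  obtain ⟨⟨i, s⟩, hs, rfl⟩ := Finset.mem_image.1 hy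
  have h1 : icorr ρ (latCoupling d J β) 0 (Pi.single i 1) =
      icorr ρ (latCoupling d J β) 0 (Pi.single j 1) := by
    rw [← icorr_perm hρ hd hJ hβ (Equiv.swap i j) (Pi.single j 1)]
    congr 1
    funext l
    simp only [Pi.single_apply]
    congr 1
    rw [eq_iff_iff, Equiv.swap_apply_eq_iff, Equiv.swap_apply_right]
  rw [icorr_comm, ← h1]
  simp only [Finset.mem_product, Finset.mem_univ, true_and, Finset.mem_insert,
    Finset.mem_singleton] at hs
  rcases hs with rfl | rfl
  · rw [zero_add]
  · have := icorr_single_neg hρ hd hJ hβ (x := 0) (i := i) rfl 1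
    rw [zero_add, zero_add] at this
    rw [zero_add]
    exact this

/-- Among the neighbours of the origin, e_j is the one most strongly correlated with (n + 1) e_j. -/
theorem icorr_nbr_axis_le (hρ : IsEvenSpin ρ) (hd : 0 < d) (hJ : 0 < J) (hβ : 0 < β) (j : Fin d)
    (n : ℕ) {y : Fin d → ℤ} (hy : y ∈ nbrs (0 : Fin d → ℤ)) :
    icorr ρ (latCoupling d J β) y (Pi.single j ((n : ℤ) + 1)) ≤
      icorr ρ (latCoupling d J β) 0 (Pi.single j (n : ℤ)) := by
  obtain ⟨⟨i, s⟩, hs, rfl⟩ := Finset.mem_image.1 hy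
  have h1 : icorr ρ (latCoupling d J β) 0 (Pi.single j ((n : ℤ) + 1)) ≤
      icorr ρ (latCoupling d J β) 0 (Pi.single j (n : ℤ)) := by
    rw [Pi.single_add]
    exact icorr_plane hρ hd hJ hβ _ j (by simp)
  have h2 : icorr ρ (latCoupling d J β) 0 (Pi.single j ((n : ℤ) + 1) + Pi.single i 1) ≤
      icorr ρ (latCoupling d J β) 0 (Pi.single j (n : ℤ)) := by
    refine (icorr_plane hρ hd hJ hβ _ i ?_).trans h1
    rw [Pi.single_apply]
    split_ifs <;> omega
  rw [icorr_translate hρ hd hJ hβ, zero_add, sub_eq_add_neg, ← Pi.single_neg]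
  simp only [Finset.mem_product, Finset.mem_univ, true_and, Finset.mem_insert,
    Finset.mem_singleton] at hs
  rcases hs with rfl | rfl
  · by_cases hij : i = j
    · subst hij
      rw [← Pi.single_add, add_neg_cancel_right]
    · rw [icorr_single_neg hρ hd hJ hβ (by simp [hij])]
      exact h2
  · rw [neg_neg]
    exact h2

/-- Let s be the variance and κ = β J. If κ s ≥ 1, then κ S(0) ≥ 1 and gaussian domination gives
S(0) ≤ 2 S(e), so monotonicity suffices. If κ s ≤ 1, the integration by parts bounds give S((n+1) e)
≤ 2 d κ s S(n e) and S(0) ≤ s (1 + 2 d κ S(e)); in their product κ s² ≤ 2 S(e) by the one-bond lower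
bound. The constant is thus free of ρ, J and β. -/
theorem icorr_step (hρ : IsGaussianSpin ρ) (hd : 0 < d) (hJ : 0 < J) (hβ : 0 < β) (j : Fin d)
    (n : ℕ) :
    icorr ρ (latCoupling d J β) 0 (Pi.single j ((n : ℤ) + 1)) *
        icorr ρ (latCoupling d J β) 0 0 ≤
      (4 * d + 4 * d ^ 2) * icorr ρ (latCoupling d J β) 0 (Pi.single j 1) *
        icorr ρ (latCoupling d J β) 0 (Pi.single j (n : ℤ)) := by
  have hρ' := hρ.toIsEvenSpin
  have hk := isCoupling_latCoupling hd hJ hβ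
  have hN : ∀ y : Fin d → ℤ, latCoupling d J β 0 y ≠ 0 → y ∈ nbrs (0 : Fin d → ℤ) := fun y hy =>
    mem_nbrs (dist_eq_one_of_coupling_ne hy)
  have ha := icorr_zero_sub_le hρ' hd hJ hβ j
  have hb := icorr_self_le_sum hρ hk hN
  have hb' := icorr_zero_le_of_nbrs hρ hd hJ hβ fun y hy =>
    (icorr_nbr_zero hρ' hd hJ hβ j hy).le
  have hc := icorr_le_sum hρ hk hN (x := Pi.single j ((n : ℤ) + 1))
    (by simp; omega)
  have hc' := icorr_zero_le_of_nbrs hρ hd hJ hβ fun y hy =>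
    icorr_nbr_axis_le hρ' hd hJ hβ j n hy
  have he := integral_sq_le_icorr hρ' hk 0
  have hd1 := icorr_ge_of_edge hρ' hk (o := 0) (x := Pi.single j 1) (by simp)
  have hanti : icorr ρ (latCoupling d J β) 0 (Pi.single j ((n : ℤ) + 1)) ≤
      icorr ρ (latCoupling d J β) 0 (Pi.single j (n : ℤ)) := by
    rw [Pi.single_add]
    exact icorr_plane hρ' hd hJ hβ _ j (by simp)
  rw [latCoupling_single] at hd1
  have hs0 : 0 ≤ ∫ t, t ^ 2 ∂ρ := integral_nonneg fun t => sq_nonneg t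
  have hn0 := icorr_nonneg hρ' hk 0 (Pi.single j (n : ℤ))
  have hn1 := icorr_nonneg hρ' hk 0 (Pi.single j ((n : ℤ) + 1))
  have hA0 := icorr_nonneg hρ' hk 0 0
  have hA1 := icorr_nonneg hρ' hk 0 (Pi.single j 1)
  set s := ∫ t, t ^ 2 ∂ρ
  set A0 := icorr ρ (latCoupling d J β) 0 0
  set A1 := icorr ρ (latCoupling d J β) 0 (Pi.single j 1)
  set X := icorr ρ (latCoupling d J β) 0 (Pi.single j ((n : ℤ) + 1))
  set Y := icorr ρ (latCoupling d J β) 0 (Pi.single j (n : ℤ))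
  set κ := β * J
  have hκ0 : 0 < κ := mul_pos hβ hJ
  have hd' : (1 : ℝ) ≤ d := by exact_mod_cast hd
  have hb2 : A0 ≤ s * (1 + 2 * d * κ * A1) :=
    hb.trans (mul_le_mul_of_nonneg_left (by linarith) hs0)
  have hc2 : X ≤ s * (2 * d * κ * Y) := hc.trans (mul_le_mul_of_nonneg_left hc' hs0)
  rcases le_total 1 (κ * s) with h1 | h1
  · have h2 : A0 ≤ 2 * A1 := by
      by_contra! hlt
      have h3 : 1 ≤ κ * A0 := h1.trans (mul_le_mul_of_nonneg_left he hκ0.le)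
      nlinarith
    calc X * A0 ≤ Y * (2 * A1) := mul_le_mul hanti h2 hA0 hn0
      _ = 2 * (A1 * Y) := by ring
      _ ≤ (4 * d + 4 * d ^ 2) * (A1 * Y) :=
        mul_le_mul_of_nonneg_right (by nlinarith) (mul_nonneg hA1 hn0)
      _ = _ := by ring
  · have h0 : 0 ≤ κ * s := mul_nonneg hκ0.le hs0
    have h2 : κ * s ^ 2 ≤ 2 * A1 := by
      rw [div_le_iff₀ (by positivity)] at hd1
      have : (κ * s) ^ 2 ≤ 1 := by nlinarith
      nlinarith
    have h3 : (κ * s) ^ 2 ≤ 1 := by nlinarith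
    calc X * A0 ≤ s * (2 * d * κ * Y) * (s * (1 + 2 * d * κ * A1)) :=
          mul_le_mul hc2 hb2 hA0 (by positivity)
      _ = Y * (2 * d * (κ * s ^ 2) + 4 * d ^ 2 * A1 * (κ * s) ^ 2) := by ring
      _ ≤ Y * (2 * d * (2 * A1) + 4 * d ^ 2 * A1 * 1) := by gcongr
      _ = _ := by ring

theorem isReflectionPositive_icorr (hρ : IsGaussianSpin ρ) (hd : 0 < d) (hJ : 0 < J) (hβ : 0 < β)
    (hs : 0 < ∫ t, t ^ 2 ∂ρ) :
    IsReflectionPositive (icorr ρ (latCoupling d J β) 0) (4 * d + 4 * d ^ 2) where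
  one_le := by
    have : (1 : ℝ) ≤ d := by exact_mod_cast hd
    nlinarith
  sign := icorr_sign hρ.toIsEvenSpin hd hJ hβ
  perm := icorr_perm hρ.toIsEvenSpin hd hJ hβ
  plane := icorr_plane hρ.toIsEvenSpin hd hJ hβ
  diag x _ _ := icorr_diag hρ.toIsEvenSpin hd hJ hβ x
  logconvex := icorr_logconvex hρ.toIsEvenSpin hd hJ hβ
  step := icorr_step hρ hd hJ hβ
  nonneg := icorr_nonneg hρ.toIsEvenSpin (isCoupling_latCoupling hd hJ hβ) 0
  one_pos j := by
    refine lt_of_lt_of_le ?_ (icorr_ge_of_edge hρ.toIsEvenSpin (isCoupling_latCoupling hd hJ hβ)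
      (o := 0) (x := Pi.single j 1) (by simp))
    rw [latCoupling_single]
    positivity

theorem icorr_eq_zero (hρ : IsGaussianSpin ρ) (hd : 0 < d) (hJ : 0 < J) (hβ : 0 < β)
    (hs : ∫ t, t ^ 2 ∂ρ = 0) (x : Fin d → ℤ) : icorr ρ (latCoupling d J β) 0 x = 0 := by
  have hk := isCoupling_latCoupling hd hJ hβ
  have hN : ∀ y : Fin d → ℤ, latCoupling d J β 0 y ≠ 0 → y ∈ nbrs (0 : Fin d → ℤ) := fun y hy =>
    mem_nbrs (dist_eq_one_of_coupling_ne hy)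
  refine le_antisymm ?_ (icorr_nonneg hρ.toIsEvenSpin hk 0 x)
  by_cases hx : x = 0
  · subst hx
    simpa [hs] using icorr_self_le_sum hρ hk hN
  · simpa [hs] using icorr_le_sum hρ hk hN hx

/-- The alternative is whether the single-spin variance is positive; if it vanishes, the integration
by parts bounds force S to vanish identically. -/
theorem twoPoint_cases (hd : 0 < d) {ρ : ProbabilityMeasure ℝ} (hρ : IsGS ρ) (hJ : 0 < J)
    (hβ : 0 < β) :
    IsReflectionPositive (twoPoint (d := d) ρ J β) (4 * d + 4 * d ^ 2) ∨
      ∀ x : Fin d → ℤ, twoPoint ρ J β x = 0 := by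
  have hg := hρ.isGaussianSpin
  have heq : twoPoint (d := d) ρ J β = icorr (ρ : Measure ℝ) (latCoupling d J β) 0 :=
    funext (twoPoint_eq_icorr hd hg.toIsEvenSpin hJ hβ)
  rw [heq]
  rcases (integral_nonneg fun t => sq_nonneg t : 0 ≤ ∫ t, t ^ 2 ∂(ρ : Measure ℝ)).eq_or_lt
    with hs | hs
  · exact Or.inr (icorr_eq_zero hg hd hJ hβ hs.symm)
  · exact Or.inl (isReflectionPositive_icorr hg hd hJ hβ hs)

/-- The gradient factor is bounded if the two-point function does not drop too fast. -/
theorem IsReflectionPositive.gradientFactor_le {S : (Fin d → ℤ) → ℝ} {C C' c₀ : ℝ}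
    (h : IsReflectionPositive S C) (hd : 0 < d) (hC' : 0 ≤ C') (hc₀ : 0 < c₀) {n : ℕ}
    (hn : c₀ * S (axisPoint d (n / 2)) ≤ S (axisPoint d (2 * d * n))) :
    gradientFactor d S C' n ≤ C' * c₀⁻¹ * |Real.log (2 / c₀)| := by
  simp only [gradientFactor, h.apply_axisPoint ⟨0, hd⟩] at *
  have hpos := h.axis_pos ⟨0, hd⟩
  have hanti := h.axis_antitone ⟨0, hd⟩
  have hhalf : S (Pi.single ⟨0, hd⟩ (n : ℤ)) ≤ S (Pi.single ⟨0, hd⟩ ((n / 2 : ℕ) : ℤ)) :=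
    hanti (Nat.div_le_self n 2)
  have hdn : S (Pi.single ⟨0, hd⟩ ((2 * d * n : ℕ) : ℤ)) ≤
      S (Pi.single ⟨0, hd⟩ ((d * n : ℕ) : ℤ)) := hanti (by
    rw [mul_assoc]; exact Nat.le_mul_of_pos_left _ two_pos)
  have hn2 : S (Pi.single ⟨0, hd⟩ ((2 * d * n : ℕ) : ℤ)) ≤ S (Pi.single ⟨0, hd⟩ (n : ℤ)) :=
    hanti (Nat.le_mul_of_pos_left _ (by positivity))
  have h1 : S (Pi.single ⟨0, hd⟩ (n : ℤ)) / S (Pi.single ⟨0, hd⟩ ((d * n : ℕ) : ℤ)) ≤ c₀⁻¹ := by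
    rw [div_le_iff₀ (hpos _), ← div_eq_inv_mul, le_div_iff₀ hc₀]
    nlinarith
  have h2 : 2 * S (Pi.single ⟨0, hd⟩ ((n / 2 : ℕ) : ℤ)) / S (Pi.single ⟨0, hd⟩ (n : ℤ)) ≤
      2 / c₀ := by
    rw [div_le_div_iff₀ (hpos _) hc₀]
    nlinarith
  have h3 := Real.log_le_log (div_pos (mul_pos two_pos (hpos _)) (hpos _)) h2
  have h4 := h.dropLog_nonneg ⟨0, hd⟩ n
  rw [IsReflectionPositive.dropLog] at h4
  exact mul_le_mul (mul_le_mul_of_nonneg_left h1 hC') (h3.trans (le_abs_self _)) h4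
    (by positivity)

end Conclusion

end GSModel

open GSModel
theorem mainTheorem9 (d : ℕ) (hd : 2 ≤ d) :
    -- the infinite-volume limits defining the two-point function exist
    (∀ (ρ : ProbabilityMeasure ℝ) (J β : ℝ), IsGS ρ → 0 < J → 0 < β →
      (β : EReal) ≤ criticalBeta d ρ J → ∀ x : Fin d → ℤ,
        Tendsto (fun L : ℕ => boxTwoPoint ρ J β L x) atTop (𝓝 (twoPoint ρ J β x))) ∧
    -- the gradient estimate
    (∃ C : ℝ, 0 < C ∧ ∀ (ρ : ProbabilityMeasure ℝ) (J β : ℝ), IsGS ρ → 0 < J → 0 < β →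
      (β : EReal) ≤ criticalBeta d ρ J →
        ∀ (x : Fin d → ℤ) (i : Fin d) (s : ℤ), x ≠ 0 → (s = 1 ∨ s = -1) →
          |twoPoint ρ J β (x + Pi.single i s) - twoPoint ρ J β x| ≤
            gradientFactor d (twoPoint ρ J β) C (maxNorm x) / (maxNorm x : ℝ) *
              twoPoint ρ J β x) ∧
    -- the gradient is of order `1 / |x|` if the two-point function does not drop too fast
    (∀ c₀ : ℝ, 0 < c₀ → ∃ C₀ : ℝ, 0 < C₀ ∧
      ∀ (ρ : ProbabilityMeasure ℝ) (J β : ℝ), IsGS ρ → 0 < J → 0 < β →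
        (β : EReal) ≤ criticalBeta d ρ J →
          ∀ n : ℕ, 1 ≤ n →
            c₀ * twoPoint ρ J β (axisPoint d (n / 2)) ≤
              twoPoint ρ J β (axisPoint d (2 * d * n)) →
            ∀ (x : Fin d → ℤ) (i : Fin d) (s : ℤ), maxNorm x = n → (s = 1 ∨ s = -1) →
              |twoPoint ρ J β (x + Pi.single i s) - twoPoint ρ J β x| ≤
                C₀ / (n : ℝ) * twoPoint ρ J β x) := by
  have hd0 : 0 < d := by omega
  set C : ℝ := 8 + 2 * (4 * d + 4 * d ^ 2) with hC
  have hCpos : 0 < C := by positivity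
  refine ⟨fun ρ J β hρ hJ hβ _ x => ?_, ⟨C, hCpos, fun ρ J β hρ hJ hβ _ x i s hx hs => ?_⟩,
    -- The added 1 keeps the constant positive when c₀ = 2, where the logarithm vanishes.
    fun c₀ hc₀ => ⟨C * c₀⁻¹ * |Real.log (2 / c₀)| + 1, by positivity,
      fun ρ J β hρ hJ hβ _ n hn hdrop x i s hx hs => ?_⟩⟩
  · have h := hρ.isGaussianSpin.toIsEvenSpin
    rw [twoPoint_eq_icorr hd0 h hJ hβ]
    exact tendsto_boxTwoPoint hd0 h hJ hβ x
  · rcases twoPoint_cases hd0 hρ hJ hβ with h | h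
    · exact h.gradient hd hx i hs
    · simp [h]
  · rcases twoPoint_cases hd0 hρ hJ hβ with h | h
    · have hx0 : x ≠ 0 := by
        rintro rfl
        have h0 : maxNorm (0 : Fin d → ℤ) = 0 := Nat.le_zero.1 (Finset.sup_le fun _ _ => by simp)
        omega
      refine (h.gradient hd hx0 i hs).trans ?_
      rw [hx]
      refine mul_le_mul_of_nonneg_right ?_ (h.nonneg x)
      refine div_le_div_of_nonneg_right ?_ n.cast_nonneg
      exact (h.gradientFactor_le hd0 hCpos.le hc₀ hdrop).trans (le_add_of_nonneg_right zero_le_one)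
    · simp [h]
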